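/- There exist an absolute constant $C>0$ and a randomized polynomial-time algorithm with the following property. The algorithm receives a set system, consisting of a ground set $\mathcal U$ of $N$ elements and $m$ subsets $\mathcal S$ of $\mathcal U$ that together cover $\mathcal U$, with nonnegative rational costs $c$. It also receives a number $n$ and one sample $\hat v^i\sim D^i$ from each of $n$ unknown (arbitrary, not necessarily identical) probability distributions $D^1,\dots,D^n$ on $\mathcal U$. From these alone, and from polynomially many fair random bits, it always outputs within polynomial time a universal solution, that is, a map $\mathfrak S:\mathcal U\to\mathcal S$ with $u\in\mathfrak S(u)$ for all $u\in\mathcal U$. Moreover, if $mn\ge 2$, then for all distributions $D^1,\dots,D^n$, $$\mathbb E\bigl[c(\mathfrak S(U))\bigr]\;\le\; C\,\log(mn)\cdot \mathbb E\bigl[c(\mathrm{OPT}(U))\bigr].$$ Here the requests $U=(v^1,\dots,v^n)$ are drawn with $v^i\sim D^i$; all the $v^i$, all the samples $\hat v^i$ and the random bits are mutually independent. $\mathfrak S(U)=\{\mathfrak S(v^i): 1\le i\le n\}$ is the subcollection bought by the map (each set is paid for once), $\mathrm{OPT}(U)$ is a minimum-cost subcollection of $\mathcal S$ covering $v^1,\dots,v^n$,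 and the expectation on the left is over the samples, the random bits and the requests. Polynomial time means time polynomial in the bit length of the explicit input (cost numerators and denominators in binary, the $m\times N$ incidence matrix, and the $n$ samples), on a random access machine with logarithmic cost. -/

import Mathlib

/-! ## Weighted set cover -/

namespace ProphetSetCover

/-- A weighted set cover instance: `numSets` sets (the number `m`) over a ground set of `numElts`
elements (the number `N`), with nonnegative rational costs.  Every element lies in some set. -/
structure SetSystem where
  numElts : ℕ
  numSets : ℕ
  sets : Fin numSets → Finset (Fin numElts)
  cost : Fin numSets → ℚ≥0
  covers : ∀ u, ∃ j, u ∈ sets j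

namespace SetSystem

variable (I : SetSystem)

/-- The total cost of a subcollection. -/
noncomputable def costOf (T : Finset (Fin I.numSets)) : ℝ :=
  ∑ j ∈ T, (I.cost j : ℝ)

/-- The subcollection `T` covers all the requests `v 0, …, v (n - 1)`. -/
def Covers {n : ℕ} (T : Finset (Fin I.numSets)) (v : Fin n → Fin I.numElts) : Prop :=
  ∀ i, ∃ j ∈ T, v i ∈ I.sets j

/-- The minimum cost of a subcollection covering the requests `v`
(the infimum is over a finite nonempty set, hence attained). -/
noncomputable def opt {n : ℕ} (v : Fin n → Fin I.numElts) : ℝ :=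
  sInf {x : ℝ | ∃ T : Finset (Fin I.numSets), I.Covers T v ∧ I.costOf T = x}

/-- The cost `c(S(U))` of the subcollection `{S (v i) | i}` which a universal map `S`
buys on the requests `v`; a set used for several requests is paid for once. -/
noncomputable def universalCost {n : ℕ} (S : Fin I.numElts → Fin I.numSets)
    (v : Fin n → Fin I.numElts) : ℝ :=
  I.costOf (Finset.univ.image fun i => S (v i))

end SetSystem

/-! ## Expectations -/

/-- The expectation of `f (v 0, …, v (n - 1))`, where the `v i` are independent and `v i`
is drawn from the distribution `D i`. -/
noncomputable def expect {n N : ℕ} (D : Fin n → PMF (Fin N))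
    (f : (Fin n → Fin N) → ℝ) : ℝ :=
  ∑ v : Fin n → Fin N, (∏ i, (D i (v i)).toReal) * f v

/-- The expectation of `f` over `r` independent fair coins. -/
noncomputable def coinExpect {r : ℕ} (f : (Fin r → Bool) → ℝ) : ℝ :=
  (∑ ω : Fin r → Bool, f ω) / 2 ^ r

/-! ## A random access machine with logarithmic cost

The machine has a read-only input array of natural numbers and a read-write memory, whose cells
are indexed by the natural numbers, hold natural numbers, and are all zero at the start.
Every operation is charged the bit lengths of the numbers (addresses included) that it handles,
so that polynomial time is the same as for Turing machines. -/

/-- Expressions.  Subtraction is truncated, and division is rounded down. -/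
inductive Exp where
  | lit (k : ℕ)
  | input (a : Exp)
  | read (a : Exp)
  | add (a b : Exp)
  | sub (a b : Exp)
  | mul (a b : Exp)
  | div (a b : Exp)
  | mod (a b : Exp)

namespace Exp

/-- The value of an expression, with input `x` and memory `M`. -/
def eval (x M : ℕ → ℕ) : Exp → ℕ
  | lit k => k
  | input a => x (a.eval x M)
  | read a => M (a.eval x M)
  | add a b => a.eval x M + b.eval x M
  | sub a b => a.eval x M - b.eval x M
  | mul a b => a.eval x M * b.eval x M
  | div a b => a.eval x M / b.eval x M
  | mod a b => a.eval x M % b.eval x M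

/-- The time needed to evaluate an expression (`Nat.size k` is the bit length of `k`). -/
def time (x M : ℕ → ℕ) : Exp → ℕ
  | lit k => 1 + k.size
  | input a => a.time x M + (1 + (a.eval x M).size + (x (a.eval x M)).size)
  | read a => a.time x M + (1 + (a.eval x M).size + (M (a.eval x M)).size)
  | add a b => a.time x M + b.time x M + (1 + (a.eval x M).size + (b.eval x M).size)
  | sub a b => a.time x M + b.time x M + (1 + (a.eval x M).size + (b.eval x M).size)
  | mul a b => a.time x M + b.time x M + (1 + (a.eval x M).size + (b.eval x M).size)
  | div a b => a.time x M + b.time x M + (1 + (a.eval x M).size + (b.eval x M).size)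
  | mod a b => a.time x M + b.time x M + (1 + (a.eval x M).size + (b.eval x M).size)

end Exp

/-- Programs.  `write a e` stores the value of `e` in the memory cell with address `a`;
`cond e P Q` runs `P` if `e` is nonzero, and `Q` otherwise;
`loop e P` repeats `P` as long as `e` is nonzero. -/
inductive Prog where
  | skip
  | write (a e : Exp)
  | seq (P Q : Prog)
  | cond (e : Exp) (P Q : Prog)
  | loop (e : Exp) (P : Prog)

/-- `Runs x P M t M'`: on input `x`, the program `P` started with memory `M` halts
after time exactly `t` with memory `M'`. -/
inductive Runs (x : ℕ → ℕ) : Prog → (ℕ → ℕ) → ℕ → (ℕ → ℕ) → Prop where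
  | skip (M : ℕ → ℕ) : Runs x .skip M 1 M
  | write (a e : Exp) (M : ℕ → ℕ) :
      Runs x (.write a e) M
        (a.time x M + e.time x M + (1 + (a.eval x M).size + (e.eval x M).size))
        (Function.update M (a.eval x M) (e.eval x M))
  | seq {P Q : Prog} {M M' M'' : ℕ → ℕ} {t t' : ℕ} :
      Runs x P M t M' → Runs x Q M' t' M'' → Runs x (.seq P Q) M (t + t') M''
  | cond_true {e : Exp} {P Q : Prog} {M M' : ℕ → ℕ} {t : ℕ} :
      e.eval x M ≠ 0 → Runs x P M t M' → Runs x (.cond e P Q) M (e.time x M + 1 + t) M'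
  | cond_false {e : Exp} {P Q : Prog} {M M' : ℕ → ℕ} {t : ℕ} :
      e.eval x M = 0 → Runs x Q M t M' → Runs x (.cond e P Q) M (e.time x M + 1 + t) M'
  | loop_stop {e : Exp} {P : Prog} {M : ℕ → ℕ} :
      e.eval x M = 0 → Runs x (.loop e P) M (e.time x M + 1) M
  | loop_step {e : Exp} {P : Prog} {M M' M'' : ℕ → ℕ} {t t' : ℕ} :
      e.eval x M ≠ 0 → Runs x P M t M' → Runs x (.loop e P) M' t' M'' →
      Runs x (.loop e P) M (e.time x M + 1 + t + t') M''

/-- The machine is deterministic: time and final memory are functions of the input. -/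
theorem Runs.unique {x : ℕ → ℕ} {P : Prog} {M : ℕ → ℕ} {t₁ t₂ : ℕ} {M₁ M₂ : ℕ → ℕ}
    (h₁ : Runs x P M t₁ M₁) (h₂ : Runs x P M t₂ M₂) : t₁ = t₂ ∧ M₁ = M₂ := by
  induction h₁ generalizing t₂ M₂ with
  | skip => cases h₂; exact ⟨rfl, rfl⟩
  | write => cases h₂; exact ⟨rfl, rfl⟩
  | seq _ _ ih ih' =>
    cases h₂ with
    | seq a b =>
      obtain ⟨rfl, rfl⟩ := ih a
      obtain ⟨rfl, rfl⟩ := ih' b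
      exact ⟨rfl, rfl⟩
  | cond_true he _ ih =>
    cases h₂ with
    | cond_true _ a => obtain ⟨rfl, rfl⟩ := ih a; exact ⟨rfl, rfl⟩
    | cond_false he' _ => exact absurd he' he
  | cond_false he _ ih =>
    cases h₂ with
    | cond_true he' _ => exact absurd he he'
    | cond_false _ a => obtain ⟨rfl, rfl⟩ := ih a; exact ⟨rfl, rfl⟩
  | loop_stop he =>
    cases h₂ with
    | loop_stop _ => exact ⟨rfl, rfl⟩
    | loop_step he' _ _ => exact absurd he he'
  | loop_step he _ _ ih ih' =>
    cases h₂ with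
    | loop_stop he' => exact absurd he' he
    | loop_step _ a b =>
      obtain ⟨rfl, rfl⟩ := ih a
      obtain ⟨rfl, rfl⟩ := ih' b
      exact ⟨rfl, rfl⟩

/-! ## Input, output and input size -/

namespace SetSystem

variable (I : SetSystem)

/-- The description of a set system and of the number `n` of requests: the numbers `N`, `m`, `n`,
then numerator and denominator of the cost of each set, then the `m × N` incidence matrix,
row by row. -/
def description (n : ℕ) : List ℕ :=
  [I.numElts, I.numSets, n]
    ++ (List.finRange I.numSets).flatMap (fun j => [(I.cost j).num, (I.cost j).den])
    ++ (List.finRange I.numSets).flatMap (fun j =>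
        (List.finRange I.numElts).map fun u => if u ∈ I.sets j then 1 else 0)

/-- The input size: the total bit length of the description (plus one per entry), plus one
for each of the `n` samples.  It does not exceed the bit length of the whole input
by more than the separators, and it depends neither on the samples nor on the coins. -/
def size (n : ℕ) : ℕ :=
  ((I.description n).map fun k => 1 + k.size).sum + n

/-- The input of the algorithm: the description, followed by one sample from each distribution,
followed by `r` random bits. -/
def inputList {n r : ℕ} (s : Fin n → Fin I.numElts) (ω : Fin r → Bool) : List ℕ :=
  I.description n ++ List.ofFn (fun i => (s i : ℕ)) ++ List.ofFn (fun i => (ω i).toNat)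

/-- On the given samples `s` and random bits `ω`, the program halts within time `T`,
and its output is the table of the map `S` from elements to sets.
Cell `0` of the final memory holds the address at which the table starts. -/
def Outputs (P : Prog) {n r : ℕ} (s : Fin n → Fin I.numElts) (ω : Fin r → Bool)
    (T : ℕ) (S : Fin I.numElts → Fin I.numSets) : Prop :=
  ∃ t M, Runs (fun i => (I.inputList s ω).getD i 0) P (fun _ => 0) t M ∧ t ≤ T ∧
    ∀ u : Fin I.numElts, M (M 0 + u) = S u

/-- `S s ω` is the map chosen from the samples `s` and the random bits `ω`.  The samples and the
requests are two independent draws from the product of the `D i`, independent of the coins. -/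
def IsCompetitive {n r : ℕ}
    (S : (Fin n → Fin I.numElts) → (Fin r → Bool) → Fin I.numElts → Fin I.numSets)
    (D : Fin n → PMF (Fin I.numElts)) (α : ℝ) : Prop :=
  expect D (fun s => coinExpect fun ω => expect D fun v => I.universalCost (S s ω) v)
    ≤ α * expect D fun v => I.opt v

end SetSystem

end ProphetSetCover

open scoped BigOperators

namespace ProphetSetCover

/-! ## A program logic with running times -/

/-! Scale the costs to integers. A learner keeps a guess β of the optimum and a weight w_j for each
set. With W the total weight, it takes each set of cost 0 < c_j ≤ β to the extent x_j = β w_j / (c_j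
W), so its fractional solution costs at most β. An element whose cheapest set costs p (its price) is
a mistake if p > β/n and it is covered to an extent below 1/8. If p ≤ β, the learner repairs a
mistake by multiplying the weights of the sets containing the element by about 1 + p/c_j. Then W
grows by a factor of at most 1 + p/(4β), while for every cover T the sum of c_j log w_j over T grows
by at least p/2. So if c(T) ≤ β, the prices paid under this guess add up to at most 4β log m. Once
they exceed this (with the bit length of m for log m), or when p > β, the guess is refuted and at
least doubled. Altogether the mistakes on samples s cost O(log m) OPT(s), and there are polynomially
many (`Learner.Inv.learn`, `Learner.run_picked`, `Learner.run_steps`).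

The learner always repairs the first mistake and stops when there is none. A sample that is never
picked can therefore be deleted without changing the run, and it is not a mistake at the end. Hence
the losses on sample i of the learner trained without i, summed over i, are bounded by the total
price of the picked samples (`Learner.sum_loss_le`). Fair coins split the samples into two classes,
and each class trains one learner. The request v^i is charged to the learner that did not use the
i-th sample. Exchanging v^i with that sample and then flipping its coin turns the expected loss on
requests into the leave-one-out loss (`SetSystem.expect_loss_le`).

Each fractional solution is rounded with thresholds scaled by 8 times the bit length of n,
independently for different sets. This costs O(log n) β in expectation and leaves an element covered
to an extent of at least 1/8 without a bought set with probability at most 1/n. The universal map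
sends u to a cheapest set containing it, where bought sets count as free. A request adds to the cost
of the bought sets only if its price is at most β/n, or rounding missed it (at most OPT(U)/n in
expectation), or it is a mistake (`SetSystem.expect_cost_selected_le`). Since samples and requests
have the same law, all terms are multiples of E[OPT(U)].

The program is verified in a total-correctness logic `WP` that also bounds time. A repair at most
doubles a weight up to an additive constant, so all numbers keep polynomially many bits. -/

theorem size_add_le (a b : ℕ) : (a + b).size ≤ a.size + b.size + 1 := by
  rw [Nat.size_le]
  have ha := Nat.lt_size_self a
  have hb := Nat.lt_size_self b
  have h1 : 2 ^ a.size ≤ 2 ^ (a.size + b.size) := Nat.pow_le_pow_right (by norm_num) (by omega)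
  have h2 : 2 ^ b.size ≤ 2 ^ (a.size + b.size) := Nat.pow_le_pow_right (by norm_num) (by omega)
  rw [pow_succ]
  omega

theorem size_mul_le (a b : ℕ) : (a * b).size ≤ a.size + b.size := by
  rw [Nat.size_le, pow_add]
  exact Nat.mul_lt_mul'' (Nat.lt_size_self a) (Nat.lt_size_self b)

/-- All cells hold numbers of at most `B` bits. -/
def Bounded (B : ℕ) (M : ℕ → ℕ) : Prop := ∀ a, M a < 2 ^ B

theorem Bounded.update {B : ℕ} {M : ℕ → ℕ} (h : Bounded B M) (a : ℕ) {k : ℕ} (hk : k < 2 ^ B) :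
    Bounded B (Function.update M a k) := by
  intro b
  by_cases hb : b = a
  · subst hb; simpa using hk
  · simpa [Function.update_of_ne hb] using h b

/-- A factor which bounds the sizes and times of an expression in terms of the cell size. -/
def Exp.cst : Exp → ℕ
  | lit k => 1 + k.size
  | input a => 2 * a.cst + 1
  | read a => 2 * a.cst + 1
  | add a b => 2 * a.cst + 2 * b.cst + 1
  | sub a b => 2 * a.cst + 2 * b.cst + 1
  | mul a b => 2 * a.cst + 2 * b.cst + 1
  | div a b => 2 * a.cst + 2 * b.cst + 1
  | mod a b => 2 * a.cst + 2 * b.cst + 1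

/-- Every input or memory access returns at most B bits again, and arithmetic at most adds the sizes
of its operands plus one. So size and time are both linear in B + 1, with a constant that depends
only on the expression. -/
theorem Exp.size_time_le {B : ℕ} {x M : ℕ → ℕ} (hx : Bounded B x) (hM : Bounded B M) (e : Exp) :
    (e.eval x M).size ≤ e.cst * (B + 1) ∧ e.time x M ≤ e.cst * (B + 1) := by
  induction e with
  | lit k =>
    simp only [eval, time, cst]
    constructor <;> nlinarith [Nat.zero_le (k.size * B), Nat.zero_le B]
  | input a ih =>
    have h := Nat.size_le.2 (hx (a.eval x M))
    simp only [eval, time, cst]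
    constructor <;> nlinarith [ih.1, ih.2, Nat.zero_le (a.cst * (B + 1))]
  | read a ih =>
    have h := Nat.size_le.2 (hM (a.eval x M))
    simp only [eval, time, cst]
    constructor <;> nlinarith [ih.1, ih.2, Nat.zero_le (a.cst * (B + 1))]
  | add a b iha ihb =>
    have h := size_add_le (a.eval x M) (b.eval x M)
    simp only [eval, time, cst]
    constructor <;> nlinarith [iha.1, iha.2, ihb.1, ihb.2, Nat.zero_le B]
  | sub a b iha ihb =>
    have h := Nat.size_le_size (Nat.sub_le (a.eval x M) (b.eval x M))
    simp only [eval, time, cst]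
    constructor <;> nlinarith [iha.1, iha.2, ihb.1, ihb.2, Nat.zero_le B]
  | mul a b iha ihb =>
    have h := size_mul_le (a.eval x M) (b.eval x M)
    simp only [eval, time, cst]
    constructor <;> nlinarith [iha.1, iha.2, ihb.1, ihb.2, Nat.zero_le B]
  | div a b iha ihb =>
    have h := Nat.size_le_size (Nat.div_le_self (a.eval x M) (b.eval x M))
    simp only [eval, time, cst]
    constructor <;> nlinarith [iha.1, iha.2, ihb.1, ihb.2, Nat.zero_le B]
  | mod a b iha ihb =>
    have h := Nat.size_le_size (Nat.mod_le (a.eval x M) (b.eval x M))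
    simp only [eval, time, cst]
    constructor <;> nlinarith [iha.1, iha.2, ihb.1, ihb.2, Nat.zero_le B]

/-- A bound for the running time, up to a factor for the cell size, as a polynomial in
a bound for the number of iterations of each loop. -/
noncomputable def Prog.poly : Prog → Polynomial ℕ
  | .skip => 1
  | .write a e => Polynomial.C (2 * a.cst + 2 * e.cst + 1)
  | .seq P Q => P.poly + Q.poly
  | .cond e P Q => Polynomial.C (e.cst + 1) + P.poly + Q.poly
  -- The factor is X + 1 rather than X because the final, failing test of the guard is charged too.
  | .loop e P => (Polynomial.X + 1) * (Polynomial.C (e.cst + 1) + P.poly)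

/-- Started in `M`, the program halts in a memory which satisfies `Q`, in time bounded by
`Prog.poly`, provided that loops make at most `L` iterations and cells hold at most `B` bits. -/
def WP (x : ℕ → ℕ) (L B : ℕ) (P : Prog) (M : ℕ → ℕ) (Q : (ℕ → ℕ) → Prop) : Prop :=
  ∃ t M', Runs x P M t M' ∧ t ≤ P.poly.eval L * (B + 1) ∧ Bounded B M' ∧ Q M'

section Rules

variable {x : ℕ → ℕ} {L B : ℕ} {M : ℕ → ℕ} {Q R : (ℕ → ℕ) → Prop}

theorem WP.mono {P : Prog} (h : WP x L B P M Q) (hQ : ∀ M', Bounded B M' → Q M' → R M') :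
    WP x L B P M R := by
  obtain ⟨t, M', h1, h2, h3, h4⟩ := h
  exact ⟨t, M', h1, h2, h3, hQ M' h3 h4⟩

theorem WP.skip (hM : Bounded B M) (hQ : Q M) : WP x L B .skip M Q :=
  ⟨1, M, .skip M, by simp [Prog.poly], hM, hQ⟩

theorem WP.write {a e : Exp} (hx : Bounded B x) (hM : Bounded B M) (he : e.eval x M < 2 ^ B)
    (hQ : Q (Function.update M (a.eval x M) (e.eval x M))) : WP x L B (.write a e) M Q := by
  refine ⟨_, _, .write a e M, ?_, hM.update _ he, hQ⟩
  have h1 := a.size_time_le hx hM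
  have h2 := e.size_time_le hx hM
  simp only [Prog.poly, Polynomial.eval_C]
  nlinarith [h1.1, h1.2, h2.1, h2.2]

theorem WP.seq {P P' : Prog} (h : WP x L B P M fun M' => WP x L B P' M' Q) :
    WP x L B (.seq P P') M Q := by
  obtain ⟨t, M', h1, h2, h3, t', M'', h4, h5, h6, h7⟩ := h
  refine ⟨_, M'', .seq h1 h4, ?_, h6, h7⟩
  simp only [Prog.poly, Polynomial.eval_add]
  nlinarith

theorem WP.cond {e : Exp} {P P' : Prog} (hx : Bounded B x) (hM : Bounded B M)
    (h1 : e.eval x M ≠ 0 → WP x L B P M Q) (h2 : e.eval x M = 0 → WP x L B P' M Q) :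
    WP x L B (.cond e P P') M Q := by
  have ht := (e.size_time_le hx hM).2
  by_cases he : e.eval x M = 0
  · obtain ⟨t, M', h3, h4, h5, h6⟩ := h2 he
    refine ⟨_, M', .cond_false he h3, ?_, h5, h6⟩
    simp only [Prog.poly, Polynomial.eval_add, Polynomial.eval_C]
    nlinarith [Nat.zero_le (Polynomial.eval L P.poly * (B + 1))]
  · obtain ⟨t, M', h3, h4, h5, h6⟩ := h1 he
    refine ⟨_, M', .cond_true he h3, ?_, h5, h6⟩
    simp only [Prog.poly, Polynomial.eval_add, Polynomial.eval_C]
    nlinarith [Nat.zero_le (Polynomial.eval L P'.poly * (B + 1))]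

/-- The invariant is indexed by the number of completed iterations and decides the guard: nonzero
before T, zero at T. This gives termination after exactly T iterations without a separate variant.
-/
theorem WP.loop {e : Exp} {P : Prog} (Inv : ℕ → (ℕ → ℕ) → Prop) (T : ℕ) (hT : T ≤ L)
    (hx : Bounded B x) (hM : Bounded B M) (h0 : Inv 0 M)
    (hstep : ∀ t < T, ∀ M, Bounded B M → Inv t M →
      e.eval x M ≠ 0 ∧ WP x L B P M (Inv (t + 1)))
    (hend : ∀ M, Bounded B M → Inv T M → e.eval x M = 0 ∧ Q M) :
    WP x L B (.loop e P) M Q := by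
  have key : ∀ k t M, t + k = T → Bounded B M → Inv t M → ∃ s M', Runs x (.loop e P) M s M' ∧
      s ≤ (k + 1) * ((e.cst + 1 + P.poly.eval L) * (B + 1)) ∧ Bounded B M' ∧ Q M' := by
    intro k
    induction k with
    | zero =>
      intro t M ht hM hI
      obtain rfl : t = T := by omega
      obtain ⟨he, hQ⟩ := hend M hM hI
      refine ⟨_, M, Runs.loop_stop he, ?_, hM, hQ⟩
      have ht := (e.size_time_le hx hM).2
      nlinarith [Nat.zero_le (Polynomial.eval L P.poly * (B + 1))]
    | succ k ih =>
      intro t M ht hM hI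
      obtain ⟨he, s, M', h1, h2, h3, h4⟩ := hstep t (by omega) M hM hI
      obtain ⟨s', M'', h5, h6, h7, h8⟩ := ih (t + 1) M' (by omega) h3 h4
      refine ⟨_, M'', .loop_step he h1 h5, ?_, h7, h8⟩
      have ht := (e.size_time_le hx hM).2
      nlinarith
  obtain ⟨s, M', h1, h2, h3, h4⟩ := key T 0 M (by omega) hM h0
  refine ⟨s, M', h1, h2.trans ?_, h3, h4⟩
  simp only [Prog.poly, Polynomial.eval_add, Polynomial.eval_C, Polynomial.eval_mul,
    Polynomial.eval_X, Polynomial.eval_one, mul_assoc]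
  gcongr

/-- The loop which runs `P` with the cell `i` counting from `0` up to `b`. -/
def Prog.forLoop (i : ℕ) (b : Exp) (P : Prog) : Prog :=
  .seq (.write (.lit i) (.lit 0)) (.loop (.sub b (.read (.lit i)))
    (.seq P (.write (.lit i) (.add (.read (.lit i)) (.lit 1)))))

/-- The guard is the truncated difference of bound and counter, and the bound is evaluated anew in
each round. The invariant must therefore fix its value, and the body must restore the counter. -/
theorem WP.forLoop {i : ℕ} {b : Exp} {P : Prog} (Inv : ℕ → (ℕ → ℕ) → Prop) (T : ℕ) (hT : T ≤ L)
    (hB : T < 2 ^ B) (hx : Bounded B x) (hM : Bounded B M) (h0 : Inv 0 (Function.update M i 0))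
    (hb : ∀ k M, Inv k M → b.eval x M = T)
    (hstep : ∀ k < T, ∀ M, Bounded B M → M i = k → Inv k M →
      WP x L B P M fun M' => M' i = k ∧ Inv (k + 1) (Function.update M' i (k + 1)))
    (hend : ∀ M, Bounded B M → Inv T M → Q M) :
    WP x L B (.forLoop i b P) M Q := by
  refine WP.seq (WP.write hx hM (by simp [Exp.eval]) ?_)
  refine WP.loop (fun k M => M i = k ∧ Inv k M) T hT hx
    (hM.update _ (by simp [Exp.eval])) ⟨by simp [Exp.eval], by simpa [Exp.eval] using h0⟩ ?_ ?_
  · intro k hk M hM ⟨hi, hI⟩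
    refine ⟨by simp only [Exp.eval, hb k M hI, hi]; omega, WP.seq ?_⟩
    refine (hstep k hk M hM hi hI).mono ?_
    intro M' hM' ⟨hi', hI'⟩
    refine WP.write hx hM' (by simp only [Exp.eval, hi']; omega) ?_
    simp only [Exp.eval, hi']
    exact ⟨by simp, hI'⟩
  · intro M hM ⟨hi, hI⟩
    exact ⟨by simp only [Exp.eval, hb T M hI, hi]; omega, hend M hM hI⟩

end Rules

/-! ## A multiplicative weights learner for fractional covers -/

/-- The state of the learner: a guess `beta` of the optimum, the total price `spent` of the
mistakes made with this guess, and the weights of the sets. -/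
@[ext] structure Learner where
  beta : ℕ
  spent : ℕ
  w : ℕ → ℕ

/-- An instance with integral costs `c j`; `mem j u` is `1` if the set `j` contains `u`, and
`0` otherwise; `price u` is the cost of the cheapest set which contains `u`. -/
structure Instance where
  m : ℕ
  n : ℕ
  c : ℕ → ℕ
  mem : ℕ → ℕ → ℕ
  price : ℕ → ℕ

/-- The prices of an instance are consistent with its costs. -/
structure Instance.Valid (I : Instance) : Prop where
  mem_le : ∀ j u, I.mem j u ≤ 1
  price_le : ∀ j < I.m, ∀ u, I.mem j u = 1 → I.price u ≤ I.c j

namespace Learner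

/-- The weights with which the learner starts. -/
def fresh (I : Instance) (b : ℕ) : Learner := ⟨b, 0, fun _ => 16 * I.n⟩

variable (I : Instance) (s : Learner)

/-- The total weight. -/
def total : ℕ := ∑ j ∈ Finset.range I.m, s.w j

/-- The fractional solution, multiplied by the total weight. -/
def frac (j : ℕ) : ℕ := s.beta * s.w j / I.c j * (1 - (I.c j - s.beta))

/-- The fractional extent to which `u` is covered, multiplied by the total weight. -/
def coverage (u : ℕ) : ℕ := ∑ j ∈ Finset.range I.m, I.mem j u * s.frac I j

/-- The element `u` is expensive and insufficiently covered. -/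
def Mistake (u : ℕ) : Prop := s.beta < I.price u * I.n ∧ 8 * s.coverage I u < s.total I

instance (u : ℕ) : Decidable (s.Mistake I u) := inferInstanceAs (Decidable (_ ∧ _))

/-- The guess of the optimum is refuted by the next mistake on `u`. -/
def Refuted (u : ℕ) : Prop := s.beta < I.price u ∨ 4 * s.beta * I.m.size < s.spent

instance (u : ℕ) : Decidable (s.Refuted I u) := inferInstanceAs (Decidable (_ ∨ _))

/-- The reaction of the learner to a mistake on `u`. -/
def learn (u : ℕ) : Learner :=
  if s.Refuted I u then fresh I (s.beta + (s.beta + 1 + (I.price u - (s.beta + 1))))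
  else ⟨s.beta, s.spent + I.price u,
    fun j => s.w j + I.mem j u * (s.frac I j * I.price u / s.beta + 2)⟩

variable (act : ℕ → Bool) (smp : ℕ → ℕ)

/-- The first active sample on which the learner makes a mistake. -/
def pick : Option ℕ :=
  (List.range I.n).find? fun i => act i && decide (s.Mistake I (smp i))

/-- The learner repairs its first mistake. -/
def step : Learner :=
  match s.pick I act smp with
  | none => s
  | some i => s.learn I (smp i)

/-- The state after `t` steps. -/
def run (t : ℕ) : Learner := (fun s => step I s act smp)^[t] (fresh I 0)

theorem run_succ (t : ℕ) : run I act smp (t + 1) = (run I act smp t).step I act smp :=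
  Function.iterate_succ_apply' _ _ _

theorem run_eq_of_pick_none {t t' : ℕ} (h : (run I act smp t).pick I act smp = none)
    (ht : t ≤ t') : run I act smp t' = run I act smp t := by
  induction t', ht using Nat.le_induction with
  | base => rfl
  | succ k _ ih => rw [run_succ, ih, step, h]

variable {I s act smp}

theorem pick_some {i : ℕ} (h : s.pick I act smp = some i) :
    i < I.n ∧ act i = true ∧ s.Mistake I (smp i) := by
  have h1 := List.mem_of_find?_eq_some h
  have h2 := List.find?_some h
  simp at h1 h2
  exact ⟨h1, h2.1, h2.2⟩

theorem pick_none (h : s.pick I act smp = none) {i : ℕ} (hi : i < I.n) (ha : act i = true) :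
    ¬ s.Mistake I (smp i) := by
  have h1 := List.find?_eq_none.1 h i (by simpa using hi)
  simpa [ha] using h1

/-- Summed over j, this says that the fractional solution costs at most β, since `frac` is scaled by
the total weight. -/
theorem frac_mul_le (j : ℕ) : I.c j * s.frac I j ≤ s.beta * s.w j := by
  unfold frac
  have h1 : s.beta * s.w j / I.c j * (1 - (I.c j - s.beta)) ≤ s.beta * s.w j / I.c j :=
    (Nat.mul_le_mul_left _ (show 1 - (I.c j - s.beta) ≤ 1 by omega)).trans (mul_one _).le
  exact (Nat.mul_le_mul_left _ h1).trans (Nat.mul_div_le _ _)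

/-- Division by zero gives 0, which discards free sets, and the truncated differences in `frac` are
an indicator of c_j ≤ β. The second fact later keeps the discretisation error of the rounding cheap.
-/
theorem le_of_frac_ne_zero {j : ℕ} (h : s.frac I j ≠ 0) : 0 < I.c j ∧ I.c j ≤ s.beta := by
  unfold frac at h
  constructor
  · by_contra h0
    obtain h0 : I.c j = 0 := by omega
    simp [h0] at h
  · by_contra h0
    obtain h0 : 1 - (I.c j - s.beta) = 0 := by omega
    simp [h0] at h

/-- The sets in `T` cover the active samples. -/
structure Covering (I : Instance) (act : ℕ → Bool) (smp : ℕ → ℕ) (T : Finset ℕ) : Prop where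
  sub : T ⊆ Finset.range I.m
  cov : ∀ i < I.n, act i = true → ∃ j ∈ T, I.mem j (smp i) = 1

/-- The invariants of the learner within one phase. -/
structure Inv (I : Instance) (T : Finset ℕ) (s : Learner) : Prop where
  beta_le : s.beta = 0 ∨ s.beta + 1 ≤ 2 * ∑ j ∈ T, I.c j
  spent_le : s.spent ≤ 4 * s.beta * I.m.size + s.beta
  le_w : ∀ j, 16 * I.n ≤ s.w j
  total_le : (s.total I : ℝ) ≤ 16 * I.n * I.m * Real.exp (s.spent / (4 * s.beta))
  le_log : ∑ j ∈ T, I.c j ≤ s.beta →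
    (s.spent : ℝ) / 2 ≤ ∑ j ∈ T, (I.c j : ℝ) * Real.log (s.w j / (16 * I.n))

theorem Inv.fresh {T : Finset ℕ} {b : ℕ} (hb : b = 0 ∨ b + 1 ≤ 2 * ∑ j ∈ T, I.c j) :
    Inv I T (fresh I b) where
  beta_le := hb
  spent_le := by simp [Learner.fresh]
  le_w := by simp [Learner.fresh]
  total_le := by simp [Learner.fresh, total]; exact le_of_eq (by ring)
  le_log := by
    intro _
    -- For `I.n = 0` both weight and scale vanish, and the logarithm of `0 / 0 = 0` is 0.
    by_cases hn : I.n = 0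
    · simp [Learner.fresh, hn]
    · have : (16 * (I.n : ℝ)) ≠ 0 := by positivity
      simp [Learner.fresh, div_self this]

theorem log_le_size (m : ℕ) : Real.log m ≤ m.size := by
  rcases Nat.eq_zero_or_pos m with rfl | hm
  · simp
  have h1 : (m : ℝ) ≤ 2 ^ m.size := by exact_mod_cast (Nat.lt_size_self m).le
  have h2 : Real.log m ≤ m.size * Real.log 2 := by
    rw [← Real.log_pow]; exact Real.log_le_log (by positivity) h1
  have h3 : Real.log 2 ≤ 1 := by linarith [Real.log_two_lt_d9]
  nlinarith [(Nat.cast_nonneg m.size : (0 : ℝ) ≤ m.size)]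

/-- As long as the guess is not below the cost of a cover, the mistakes are cheap. -/
theorem Inv.spent_le_of_cost_le {T : Finset ℕ} (h : Inv I T s) (hT : T ⊆ Finset.range I.m)
    (hn : 0 < I.n) (hc : ∑ j ∈ T, I.c j ≤ s.beta) : s.spent ≤ 4 * s.beta * I.m.size := by
  rcases Nat.eq_zero_or_pos s.beta with hb | hb
  · have := h.spent_le
    rw [hb] at this ⊢
    simpa using this
  have hn' : (0 : ℝ) < 16 * I.n := by positivity
  have hb' : (0 : ℝ) < s.beta := by positivity
  rcases Nat.eq_zero_or_pos s.spent with h0 | hsp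
  · simp [h0]
  have hm : 0 < I.m := by
    by_contra h0
    have hT0 : T = ∅ := by
      rw [← Finset.subset_empty]; refine hT.trans ?_
      simp; omega
    have := h.le_log hc
    rw [hT0] at this
    have h2 : (0 : ℝ) < s.spent := by positivity
    simp at this
    linarith
  -- A single weight is at most the total weight, which the invariant bounds by 16 n m exp(spent /
  -- (4β)).
  have key : ∀ j ∈ T, Real.log (s.w j / (16 * I.n)) ≤ Real.log I.m + s.spent / (4 * s.beta) := by
    intro j hj
    have hj' := hT hj
    have hw : (s.w j : ℝ) ≤ s.total I := by
      exact_mod_cast Finset.single_le_sum (f := s.w) (fun i _ => Nat.zero_le _) hj'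
    have hw0 : (16 : ℝ) * I.n ≤ s.w j := by exact_mod_cast h.le_w j
    have hm' : (0 : ℝ) < I.m := by positivity
    rw [← Real.log_exp (s.spent / (4 * s.beta) : ℝ), ← Real.log_mul hm'.ne' (Real.exp_pos _).ne']
    refine Real.log_le_log (div_pos (hn'.trans_le hw0) hn') ?_
    rw [div_le_iff₀ hn']
    nlinarith [h.total_le]
  have h1 := h.le_log hc
  have h2 : ∑ j ∈ T, (I.c j : ℝ) * Real.log (s.w j / (16 * I.n)) ≤
      ∑ j ∈ T, (I.c j : ℝ) * (Real.log I.m + s.spent / (4 * s.beta)) :=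
    Finset.sum_le_sum fun j hj => mul_le_mul_of_nonneg_left (key j hj) (by positivity)
  rw [← Finset.sum_mul] at h2
  have hc' : ∑ j ∈ T, (I.c j : ℝ) ≤ s.beta := by exact_mod_cast hc
  have hl : 0 ≤ Real.log I.m := Real.log_natCast_nonneg _
  have h3 : (∑ j ∈ T, (I.c j : ℝ)) * (Real.log I.m + s.spent / (4 * s.beta)) ≤
      s.beta * (Real.log I.m + s.spent / (4 * s.beta)) :=
    mul_le_mul_of_nonneg_right hc' (by positivity)
  have h4 : (s.beta : ℝ) * (Real.log I.m + s.spent / (4 * s.beta)) =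
      s.beta * Real.log I.m + s.spent / 4 := by field_simp
  have h5 := log_le_size I.m
  -- The two potentials give spent/2 ≤ β log m + spent/4, and log m is at most the bit length of m.
  have h6 : (s.spent : ℝ) ≤ 4 * s.beta * I.m.size := by nlinarith
  exact_mod_cast h6

/-- The proportional part of the update adds at most p/β times the coverage, which is below W p/(8β)
on a mistake. The additive terms are at most 2m. As weights start at 16 n and n p > β, these are at
most W p/(8β) as well; this is the reason for the initial weight. -/
theorem total_learn_le {u : ℕ} (hI : I.Valid) (hu : s.Mistake I u) (hr : ¬ s.Refuted I u)
    (hw : ∀ j, 16 * I.n ≤ s.w j) :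
    ((s.learn I u).total I : ℝ) ≤ s.total I * (1 + I.price u / (4 * s.beta)) := by
  have hp : 0 < I.price u := by
    rcases Nat.eq_zero_or_pos (I.price u) with h | h
    · have := hu.1; simp [h] at this
    · exact h
  have hb : I.price u ≤ s.beta := by
    by_contra h; exact hr (Or.inl (by omega))
  have hb' : (0 : ℝ) < s.beta := by exact_mod_cast hp.trans_le hb
  have hlr : (s.learn I u).w = fun j => s.w j + I.mem j u * (s.frac I j * I.price u / s.beta + 2) := by
    rw [learn, if_neg hr]
  have h1 : ((s.learn I u).total I : ℝ) ≤ ∑ j ∈ Finset.range I.m,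
      ((s.w j : ℝ) + ((I.mem j u * s.frac I j : ℕ) * (I.price u / s.beta) + 2)) := by
    rw [total, hlr]
    push_cast
    refine Finset.sum_le_sum fun j _ => ?_
    have h2 : ((s.frac I j * I.price u / s.beta : ℕ) : ℝ) ≤ s.frac I j * (I.price u / s.beta) := by
      refine Nat.cast_div_le.trans (le_of_eq ?_)
      push_cast; ring
    have h3 : (I.mem j u : ℝ) ≤ 1 := by exact_mod_cast hI.mem_le j u
    have h4 : (0 : ℝ) ≤ I.mem j u := by positivity
    nlinarith
  have h2 : (16 * I.n * I.m : ℝ) ≤ s.total I := by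
    have : ∑ j ∈ Finset.range I.m, 16 * I.n ≤ s.total I := Finset.sum_le_sum fun j _ => hw j
    simp at this
    have h3 : ((I.m * (16 * I.n) : ℕ) : ℝ) ≤ s.total I := by exact_mod_cast this
    push_cast at h3; linarith
  have h3 : (8 * s.coverage I u : ℝ) ≤ s.total I := by exact_mod_cast hu.2.le
  have h4 : (s.beta : ℝ) ≤ I.price u * I.n := by exact_mod_cast hu.1.le
  rw [Finset.sum_add_distrib, Finset.sum_add_distrib, ← Finset.sum_mul, ← Nat.cast_sum,
    ← Nat.cast_sum] at h1
  change ((s.learn I u).total I : ℝ) ≤ s.total I +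
    (s.coverage I u * (I.price u / s.beta) + ∑ j ∈ Finset.range I.m, 2) at h1
  simp at h1
  have h5 : (s.coverage I u : ℝ) * (I.price u / s.beta) ≤ s.total I * (I.price u / (8 * s.beta)) := by
    rw [show (s.total I : ℝ) * (I.price u / (8 * s.beta)) = s.total I / 8 * (I.price u / s.beta) by
      field_simp]
    exact mul_le_mul_of_nonneg_right (by linarith) (by positivity)
  have h6 : (I.m * 2 : ℝ) ≤ s.total I * (I.price u / (8 * s.beta)) := by
    rw [← mul_div_assoc, le_div_iff₀ (by positivity)]
    have h7 : (0 : ℝ) ≤ I.price u := by positivity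
    have h8 : (0 : ℝ) ≤ I.m := by positivity
    nlinarith [mul_le_mul_of_nonneg_right h2 h7, mul_le_mul_of_nonneg_left h4 h8]
  have h9 : (s.total I : ℝ) * (1 + I.price u / (4 * s.beta)) =
      s.total I + (s.total I * (I.price u / (8 * s.beta)) + s.total I * (I.price u / (8 * s.beta))) := by
    field_simp; ring
  rw [h9]; linarith

/-- The update multiplies w_j by at least 1 + p/c_j: the summand 2 makes up for the floor inside
`frac` (at most p/β ≤ 1) and for the outer floor. Since p ≤ c_j, the estimate log(1 + a) ≥ a/2 on
[0, 1] applies. -/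
theorem log_learn_ge {u j : ℕ} (hI : I.Valid) (hn : 0 < I.n)
    (hr : ¬ s.Refuted I u) (hw : ∀ j, 16 * I.n ≤ s.w j) (hp : 0 < I.price u)
    (hj : I.mem j u = 1) (hjm : j < I.m) (hc : I.c j ≤ s.beta) :
    (I.c j : ℝ) * Real.log (s.w j / (16 * I.n)) + I.price u / 2 ≤
      I.c j * Real.log ((s.learn I u).w j / (16 * I.n)) := by
  have hb : I.price u ≤ s.beta := by
    by_contra h; exact hr (Or.inl (by omega))
  have hb' : (0 : ℝ) < s.beta := by exact_mod_cast hp.trans_le hb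
  have hpc := hI.price_le j hjm u hj
  have hc0 : (0 : ℝ) < I.c j := by exact_mod_cast hp.trans_le hpc
  have hp' : (0 : ℝ) < I.price u := by exact_mod_cast hp
  have hpc' : (I.price u : ℝ) ≤ I.c j := by exact_mod_cast hpc
  have hpb' : (I.price u : ℝ) ≤ s.beta := by exact_mod_cast hb
  have hlr : (s.learn I u).w j = s.w j + (s.frac I j * I.price u / s.beta + 2) := by
    rw [learn, if_neg hr]; simp [hj]
  have hw0 : (0 : ℝ) < s.w j := by
    have := hw j
    have : 0 < s.w j := by omega
    exact_mod_cast this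
  have hf : (s.beta * s.w j / I.c j : ℝ) ≤ s.frac I j + 1 := by
    have : s.frac I j = s.beta * s.w j / I.c j := by
      simp [frac, Nat.sub_eq_zero_of_le hc]
    rw [this]
    have := (Nat.lt_floor_add_one ((s.beta * s.w j : ℕ) / (I.c j : ℝ) : ℝ)).le
    rw [Nat.floor_div_eq_div] at this
    push_cast at this ⊢
    exact this
  have hg : (s.w j * (1 + I.price u / I.c j) : ℝ) ≤ (s.learn I u).w j := by
    rw [hlr]
    have h1 := (Nat.lt_floor_add_one ((s.frac I j * I.price u : ℕ) / (s.beta : ℝ) : ℝ)).le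
    rw [Nat.floor_div_eq_div] at h1
    push_cast at h1 ⊢
    have h2 : (s.w j : ℝ) * (1 + I.price u / I.c j) =
        s.w j + (s.beta * s.w j / I.c j) * (I.price u / s.beta) := by field_simp
    have h3 : (s.beta * s.w j / I.c j : ℝ) * (I.price u / s.beta) ≤
        (s.frac I j + 1) * (I.price u / s.beta) :=
      mul_le_mul_of_nonneg_right hf (by positivity)
    have h4 : (I.price u / s.beta : ℝ) ≤ 1 := (div_le_one hb').2 hpb'
    have h5 : (s.frac I j * I.price u / s.beta : ℝ) = s.frac I j * (I.price u / s.beta) := by ring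
    rw [h2]; nlinarith
  have hn' : (0 : ℝ) < 16 * I.n := by positivity
  have h1 : Real.log (s.w j / (16 * I.n)) + Real.log (1 + I.price u / I.c j) ≤
      Real.log ((s.learn I u).w j / (16 * I.n)) := by
    rw [← Real.log_mul (by positivity) (by positivity)]
    refine Real.log_le_log (by positivity) ?_
    rw [div_mul_eq_mul_div]
    gcongr
  have h2 : (I.price u / I.c j / 2 : ℝ) ≤ Real.log (1 + I.price u / I.c j) := by
    have h3 := Real.one_sub_inv_le_log_of_pos (show (0 : ℝ) < 1 + I.price u / I.c j by positivity)
    refine le_trans ?_ h3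
    have h4 : (I.price u / I.c j : ℝ) ≤ 1 := (div_le_one hc0).2 hpc'
    have h5 : (0 : ℝ) < I.price u / I.c j := by positivity
    generalize (I.price u / I.c j : ℝ) = a at h4 h5
    rw [show 1 - (1 + a)⁻¹ = a / (1 + a) by field_simp; ring]
    rw [div_le_div_iff₀ (by norm_num) (by positivity)]
    nlinarith
  have h3 : (I.c j : ℝ) * (I.price u / I.c j / 2) = I.price u / 2 := by field_simp
  nlinarith

/-- One set of T contains the mistake and raises the potential of T by p/2; the other weights do not
decrease. The bound on the total weight follows from 1 + y ≤ exp y. -/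
theorem Inv.learn {T : Finset ℕ} {u : ℕ} (h : Inv I T s) (hI : I.Valid)
    (hT : T ⊆ Finset.range I.m) (hcov : ∃ j ∈ T, I.mem j u = 1) (hu : s.Mistake I u) :
    Inv I T (s.learn I u) := by
  have hp : 0 < I.price u := by
    rcases Nat.eq_zero_or_pos (I.price u) with h | h
    · have := hu.1; simp [h] at this
    · exact h
  have hn : 0 < I.n := by
    rcases Nat.eq_zero_or_pos I.n with h | h
    · have := hu.1; simp [h] at this
    · exact h
  obtain ⟨j₀, hj₀, hju⟩ := hcov
  have hcost : ∀ j ∈ T, I.c j ≤ ∑ j ∈ T, I.c j := fun j hj =>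
    Finset.single_le_sum (f := I.c) (fun i _ => Nat.zero_le _) hj
  have hprice : I.price u ≤ ∑ j ∈ T, I.c j :=
    (hI.price_le j₀ (Finset.mem_range.1 (hT hj₀)) u hju).trans (hcost j₀ hj₀)
  by_cases hr : s.Refuted I u
  · rw [Learner.learn, if_pos hr]
    -- The new guess is β + max(β + 1, p). Refutation gives β + 1 ≤ c(T), and p ≤ c(T) always, so
    -- the new guess plus one is at most 2c(T).
    refine Inv.fresh (Or.inr ?_)
    have hlt : s.beta < ∑ j ∈ T, I.c j := by
      rcases hr with hr | hr
      · omega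
      · by_contra hc
        have := h.spent_le_of_cost_le hT hn (by omega)
        omega
    omega
  -- The slack β in `spent_le` is room for one more price, which is at most β here.
  have hb : I.price u ≤ s.beta ∧ s.spent ≤ 4 * s.beta * I.m.size := by
    simp only [Refuted, not_or, not_lt] at hr; exact hr
  have hb' : (0 : ℝ) < s.beta := by exact_mod_cast hp.trans_le hb.1
  have hlb : (s.learn I u).beta = s.beta := by rw [Learner.learn, if_neg hr]
  have hls : (s.learn I u).spent = s.spent + I.price u := by rw [Learner.learn, if_neg hr]
  have hlw : ∀ j, s.w j ≤ (s.learn I u).w j := by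
    intro j; rw [Learner.learn, if_neg hr]; exact Nat.le_add_right _ _
  refine ⟨by rw [hlb]; exact h.beta_le, by rw [hls, hlb]; omega,
    fun j => (h.le_w j).trans (hlw j), ?_, ?_⟩
  · refine (total_learn_le hI hu hr h.le_w).trans ?_
    rw [hls, hlb]
    push_cast
    rw [add_div, Real.exp_add, ← mul_assoc]
    refine mul_le_mul h.total_le ?_ (by positivity) (by positivity)
    rw [add_comm]
    exact Real.add_one_le_exp _
  · rw [hls, hlb]
    intro hc
    have h1 := h.le_log hc
    have hn' : (0 : ℝ) < 16 * I.n := by positivity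
    rw [← Finset.add_sum_erase _ _ hj₀] at h1 ⊢
    have h2 := log_learn_ge hI hn hr h.le_w hp hju (Finset.mem_range.1 (hT hj₀))
      ((hcost j₀ hj₀).trans hc)
    have h3 : ∑ j ∈ T.erase j₀, (I.c j : ℝ) * Real.log (s.w j / (16 * I.n)) ≤
        ∑ j ∈ T.erase j₀, (I.c j : ℝ) * Real.log ((s.learn I u).w j / (16 * I.n)) := by
      refine Finset.sum_le_sum fun j _ => mul_le_mul_of_nonneg_left ?_ (by positivity)
      have hw0 : (16 : ℝ) * I.n ≤ s.w j := by exact_mod_cast h.le_w j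
      refine Real.log_le_log (div_pos (hn'.trans_le hw0) hn') ?_
      have : (s.w j : ℝ) ≤ (s.learn I u).w j := by exact_mod_cast hlw j
      gcongr
    push_cast
    linarith

theorem Mistake.price_pos {u : ℕ} (h : s.Mistake I u) : 0 < I.price u := by
  rcases Nat.eq_zero_or_pos (I.price u) with h0 | h0
  · have := h.1; simp [h0] at this
  · exact h0

theorem run_inv (hI : I.Valid) {T : Finset ℕ} (hT : Covering I act smp T) (t : ℕ) :
    Inv I T (run I act smp t) := by
  induction t with
  | zero => exact Inv.fresh (Or.inl rfl)
  | succ t ih =>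
    rw [run_succ, step]
    split
    · exact ih
    · next i hi =>
      obtain ⟨h1, h2, h3⟩ := pick_some hi
      exact ih.learn hI hT.sub (hT.cov i h1 h2) h3

/-- The items on which the learner makes mistakes have a small total price. -/
theorem run_picked (hI : I.Valid) {T : Finset ℕ} (hT : Covering I act smp T) (t : ℕ) :
    ∃ P : Finset ℕ, (∀ t' < t, ∀ i, (run I act smp t').pick I act smp = some i → i ∈ P) ∧
      ∑ i ∈ P, I.price (smp i) ≤
        (4 * I.m.size + 2) * (run I act smp t).beta + (run I act smp t).spent := by
  induction t with
  | zero => exact ⟨∅, by simp, by simp⟩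
  | succ t ih =>
    obtain ⟨P, hP, hle⟩ := ih
    have hinv := (run_inv hI hT t).spent_le
    rw [run_succ, step]
    split
    · next hn =>
      refine ⟨P, fun t' ht' i hi => ?_, hle⟩
      rcases Nat.lt_succ_iff_lt_or_eq.1 ht' with h | rfl
      · exact hP t' h i hi
      · rw [hn] at hi; simp at hi
    · next i₀ hi₀ =>
      refine ⟨insert i₀ P, fun t' ht' i hi => ?_, ?_⟩
      · rcases Nat.lt_succ_iff_lt_or_eq.1 ht' with h | rfl
        · exact Finset.mem_insert_of_mem (hP t' h i hi)
        · rw [hi₀] at hi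
          obtain rfl := Option.some.inj hi
          exact Finset.mem_insert_self _ _
      have h1 : ∑ i ∈ insert i₀ P, I.price (smp i) ≤
          I.price (smp i₀) + ∑ i ∈ P, I.price (smp i) := by
        by_cases h : i₀ ∈ P
        · rw [Finset.insert_eq_of_mem h]; omega
        · rw [Finset.sum_insert h]
      refine h1.trans ?_
      generalize run I act smp t = s at *
      rw [learn]
      split
      -- A restart discards an amount spent of at most (4·size m + 1)β. The guess grows by at least
      -- max(β, p), which at the rate 4·size m + 2 pays for this amount and for the new price.
      · simp only [fresh]
        have h2 : s.beta + max s.beta (I.price (smp i₀)) ≤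
          s.beta + (s.beta + 1 + (I.price (smp i₀) - (s.beta + 1))) := by omega
        have h3 := Nat.mul_le_mul_left (4 * I.m.size + 2) h2
        have h4 := le_max_left s.beta (I.price (smp i₀))
        have h5 := le_max_right s.beta (I.price (smp i₀))
        generalize max s.beta (I.price (smp i₀)) = b at *
        nlinarith [Nat.mul_le_mul_left I.m.size h4]
      · simp only; omega

/-- A bound for the number of steps within a phase. -/
def phaseBound (I : Instance) : ℕ := I.n * (4 * I.m.size + 1) + 1

/-- A bound for the number of mistakes. -/
def stepBound (I : Instance) : ℕ :=
  (1 + 2 * ∑ j ∈ Finset.range I.m, I.c j).size * phaseBound I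

/-- Here p counts the restarts and r the mistakes since the last one. A restart sends β to at least
2β + 1, so β + 1 at least doubles; a mistake within a phase has price above β/n, so r β ≤ n · spent.
The refuting mistake is the last summand 1 of `phaseBound`. The count of steps is conditional
because t keeps growing after the learner has stopped. -/
theorem run_steps (hI : I.Valid) {T : Finset ℕ} (hT : Covering I act smp T) (t : ℕ) :
    ∃ p r, ((∀ t' < t, (run I act smp t').pick I act smp ≠ none) → t ≤ p * phaseBound I + r) ∧
      2 ^ p ≤ (run I act smp t).beta + 1 ∧
      r * (run I act smp t).beta ≤ I.n * (run I act smp t).spent ∧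
      ((run I act smp t).beta = 0 → r = 0) := by
  induction t with
  | zero => exact ⟨0, 0, by simp, by simp, by simp, by simp⟩
  | succ t ih =>
    obtain ⟨p, r, h1, h2, h3, h4⟩ := ih
    have hinv := (run_inv hI hT t).spent_le
    rw [run_succ, step]
    split
    · next hn => exact ⟨p, r, fun h => absurd hn (h t (Nat.lt_succ_self t)), h2, h3, h4⟩
    · next i hi =>
      have hm := (pick_some hi).2.2
      have hp := hm.price_pos
      have h1' : (∀ t' < t + 1, (run I act smp t').pick I act smp ≠ none) →
          t ≤ p * phaseBound I + r := fun h => h1 fun t' ht' => h t' (by omega)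
      generalize run I act smp t = s at *
      have hb := hm.1
      rw [learn]
      split
      · refine ⟨p + 1, 0, fun h => ?_, ?_, by simp, by simp⟩
        · have hr : r + 1 ≤ phaseBound I := by
            unfold phaseBound
            rcases Nat.eq_zero_or_pos s.beta with h0 | h0
            · rw [h4 h0]; omega
            · have : r * s.beta ≤ I.n * (4 * I.m.size + 1) * s.beta := by nlinarith
              have := Nat.le_of_mul_le_mul_right this h0
              omega
          have := h1' h
          rw [add_mul]; omega
        · simp only [fresh]
          rw [pow_succ]; omega
      · next hr =>
        simp only [Refuted, not_or, not_lt] at hr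
        refine ⟨p, r + 1, fun h => ?_, h2, ?_, ?_⟩
        · have := h1' h; omega
        · simp only; nlinarith
        · simp only; omega

theorem beta_le_two_mul (hI : I.Valid) {T : Finset ℕ} (hT : Covering I act smp T) (t : ℕ) :
    (run I act smp t).beta ≤ 2 * ∑ j ∈ T, I.c j := by
  rcases (run_inv hI hT t).beta_le with h | h <;> omega

/-- The family of all sets is a cover, so β never exceeds twice the sum of all costs. This bounds
the number of restarts by a bit length, and the amount spent bounds each phase. -/
theorem exists_pick_none (hI : I.Valid) (hT : Covering I act smp (Finset.range I.m)) :
    ∃ t ≤ stepBound I, (run I act smp t).pick I act smp = none ∧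
      ∀ t' < t, (run I act smp t').pick I act smp ≠ none := by
  classical
  have hex : ∃ t ≤ stepBound I, (run I act smp t).pick I act smp = none := by
    by_contra! hne
    obtain ⟨p, r, h1, h2, h3, h4⟩ := run_steps hI hT (stepBound I)
    have h5 := h1 fun t' ht' => hne t' ht'.le
    have hb := beta_le_two_mul hI hT (stepBound I)
    have hinv := (run_inv hI hT (stepBound I)).spent_le
    have hr : r < phaseBound I := by
      generalize run I act smp (stepBound I) = s at *
      unfold phaseBound
      rcases Nat.eq_zero_or_pos s.beta with h0 | h0
      · rw [h4 h0]; omega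
      · have : r * s.beta ≤ I.n * (4 * I.m.size + 1) * s.beta := by nlinarith
        have := Nat.le_of_mul_le_mul_right this h0
        omega
    have hp : p < (1 + 2 * ∑ j ∈ Finset.range I.m, I.c j).size :=
      Nat.lt_size.2 (h2.trans (by omega))
    have h6 : (p + 1) * phaseBound I ≤ stepBound I := Nat.mul_le_mul_right _ hp
    rw [add_mul] at h6
    omega
  refine ⟨Nat.find hex, (Nat.find_spec hex).1, (Nat.find_spec hex).2, fun t' ht' h => ?_⟩
  exact Nat.find_min hex ht' ⟨ht'.le.trans (Nat.find_spec hex).1, h⟩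

/-- The state in which the learner makes no more mistakes. -/
def final (I : Instance) (act : ℕ → Bool) (smp : ℕ → ℕ) : Learner :=
  run I act smp (stepBound I)

theorem final_pick (hI : I.Valid) (hT : Covering I act smp (Finset.range I.m)) :
    (final I act smp).pick I act smp = none := by
  obtain ⟨t, h1, h2, -⟩ := exists_pick_none hI hT
  rw [final, run_eq_of_pick_none I act smp h2 h1]
  exact h2

/-- From c_j · frac ≤ β w_j and p ≤ c_j, an update adds at most w_j + 2. Adding 2 to both sides
turns w ↦ 2w + 2 into pure doubling. -/
theorem learn_w_le (hI : I.Valid) {u : ℕ} (b : ℕ) {j : ℕ} (hj : j < I.m)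
    (hb : 16 * I.n + 2 ≤ b) (h : s.w j + 2 ≤ b) : (s.learn I u).w j + 2 ≤ 2 * b := by
  rw [learn]
  split
  · simp only [fresh]; omega
  · next hr =>
    simp only
    have hm := hI.mem_le j u
    rcases Nat.eq_zero_or_pos (I.mem j u) with h0 | h0
    · rw [h0]; omega
    · have h1 : I.mem j u = 1 := by omega
      have h2 := hI.price_le j hj u h1
      have h3 : s.frac I j * I.price u / s.beta ≤ s.w j := by
        refine Nat.div_le_of_le_mul ?_
        have := frac_mul_le (I := I) (s := s) j
        nlinarith
      rw [h1]; omega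

theorem run_w_le (hI : I.Valid) (t : ℕ) {j : ℕ} (hj : j < I.m) :
    (run I act smp t).w j + 2 ≤ (16 * I.n + 2) * 2 ^ t := by
  induction t with
  | zero => simp [run, fresh]
  | succ t ih =>
    have h1 : 16 * I.n + 2 ≤ (16 * I.n + 2) * 2 ^ t := Nat.le_mul_of_pos_right _ (by positivity)
    rw [run_succ, step, pow_succ, ← mul_assoc, mul_comm _ 2]
    split
    · omega
    · exact learn_w_le hI _ hj h1 ih

/-! ### Leaving one sample out -/

/-- The loss of the learner on an element `u`. -/
def loss (I : Instance) (s : Learner) (u : ℕ) : ℕ := if s.Mistake I u then I.price u else 0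

/-- Switching off an item that is not the first hit leaves the first hit alone. The stability of the
learner rests on this. -/
theorem find?_congr_of_ne {l : List ℕ} {p q : ℕ → Bool} {i : ℕ} (hpq : ∀ k ≠ i, q k = p k)
    (hq : q i = false) (h : l.find? p ≠ some i) : l.find? q = l.find? p := by
  induction l with
  | nil => rfl
  | cons a l ih =>
    by_cases ha : a = i
    · subst ha
      have hp : p a = false := by
        by_contra hp
        simp at hp
        exact h (by simp [hp])
      rw [List.find?_cons_of_neg (by simp [hq]), List.find?_cons_of_neg (by simp [hp])]
      rw [List.find?_cons_of_neg (by simp [hp])] at h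
      exact ih h
    · by_cases hp : p a = true
      · rw [List.find?_cons_of_pos (by rw [hpq a ha, hp]), List.find?_cons_of_pos hp]
      · rw [List.find?_cons_of_neg (by rw [hpq a ha]; exact hp), List.find?_cons_of_neg hp]
        rw [List.find?_cons_of_neg hp] at h
        exact ih h

theorem pick_congr {act' : ℕ → Bool} {i : ℕ} (hne : ∀ k ≠ i, act' k = act k)
    (hi : act' i = false) (h : s.pick I act smp ≠ some i) :
    s.pick I act' smp = s.pick I act smp :=
  find?_congr_of_ne (fun k hk => by rw [hne k hk]) (by simp [hi]) h

/-- Without a sample on which the learner never makes a mistake, it learns the same. -/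
theorem run_congr {act' : ℕ → Bool} {i : ℕ} (hne : ∀ k ≠ i, act' k = act k)
    (hi : act' i = false) (t : ℕ)
    (h : ∀ t' < t, (run I act smp t').pick I act smp ≠ some i) :
    run I act' smp t = run I act smp t := by
  induction t with
  | zero => rfl
  | succ t ih =>
    rw [run_succ, run_succ, ih fun t' ht' => h t' (by omega), step, step,
      pick_congr hne hi (h t (by omega))]

/-- For a sample that was never picked, the run without it is the full run, whose final state makes
no mistake on it; a picked sample loses at most its price. The picked prices total at most (8·size m
+ 3)β, and β ≤ 2c(T). -/
theorem sum_loss_le (hI : I.Valid) (hN : Covering I act smp (Finset.range I.m))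
    {T : Finset ℕ} (hT : Covering I act smp T) (act' : ℕ → ℕ → Bool)
    (hne : ∀ i, ∀ k ≠ i, act' i k = act k) (hi : ∀ i, act' i i = false) :
    ∑ i ∈ (Finset.range I.n).filter (fun i => act i = true),
      (final I (act' i) smp).loss I (smp i) ≤ (16 * I.m.size + 6) * ∑ j ∈ T, I.c j := by
  classical
  obtain ⟨P, hP, hle⟩ := run_picked hI hT (stepBound I)
  have h1 : ∀ i ∈ (Finset.range I.n).filter (fun i => act i = true),
      (final I (act' i) smp).loss I (smp i) ≤ if i ∈ P then I.price (smp i) else 0 := by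
    intro i hia
    simp only [Finset.mem_filter, Finset.mem_range] at hia
    by_cases hiP : i ∈ P
    · rw [if_pos hiP, loss]; split <;> omega
    · have : final I (act' i) smp = final I act smp :=
        run_congr (hne i) (hi i) _ fun t' ht' h => hiP (hP t' ht' i h)
      rw [this, loss, if_neg (pick_none (final_pick hI hN) hia.1 hia.2)]
      exact Nat.zero_le _
  refine (Finset.sum_le_sum h1).trans ?_
  rw [← Finset.sum_filter]
  refine (Finset.sum_le_sum_of_subset (f := fun i => I.price (smp i)) fun i hi => ?_).trans
    (hle.trans ?_)
  · exact (Finset.mem_filter.1 hi).2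
  · have hb := beta_le_two_mul hI hT (stepBound I)
    have hs := (run_inv hI hT (stepBound I)).spent_le
    nlinarith

end Learner

/-! ## The program -/

namespace Exp

/-- The content of the cell `k`. -/
def var (k : ℕ) : Exp := .read (.lit k)

/-- The address of the entry `e` of the array `a`. -/
def addr (a : ℕ) (e : Exp) : Exp := .add (.lit (32 + a)) (.mul (.lit 8) e)

/-- The entry `e` of the array `a`. -/
def entry (a : ℕ) (e : Exp) : Exp := .read (addr a e)

/-- The number of elements. -/
def numElts : Exp := .input (.lit 0)

/-- The number of sets. -/
def numSets : Exp := .input (.lit 1)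

/-- The number of requests. -/
def numReqs : Exp := .input (.lit 2)

/-- The entry of the incidence matrix for the set `j` and the element `u`. -/
def mem (j u : Exp) : Exp :=
  .input (.add (.add (.lit 3) (.mul (.lit 2) numSets)) (.add (.mul numElts j) u))

/-- The sample `i`. -/
def sample (i : Exp) : Exp :=
  .input (.add (.add (.lit 3) (.mul (.lit 2) numSets)) (.add (.mul numSets numElts) i))

/-- The random bit `k`. -/
def coin (k : Exp) : Exp :=
  .input (.add (.add (.lit 3) (.mul (.lit 2) numSets))
    (.add (.mul numSets numElts) (.add numReqs k)))

/-- The fractional solution of the learner. -/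
def frac (j : Exp) : Exp :=
  .mul (.div (.mul (var 6) (entry 1 j)) (entry 0 j)) (.sub (.lit 1) (.sub (entry 0 j) (var 6)))

/-- The cost of a set, or `0` if it has been bought. -/
def remaining (j : Exp) : Exp := .mul (entry 0 j) (.sub (.lit 1) (entry 2 j))

end Exp

namespace Prog

open Exp

/-- A loop which updates one cell. -/
def accLoop (acc i : ℕ) (init bd e : Exp) : Prog :=
  .seq (.write (.lit acc) init) (.forLoop i bd (.write (.lit acc) e))

/-- A loop which fills an array. -/
def fillLoop (a i : ℕ) (bd e : Exp) : Prog :=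
  .forLoop i bd (.write (addr a (var i)) e)

/-- Computes the bit length of `e`. -/
def sizeLoop (acc q : ℕ) (e : Exp) : Prog :=
  .seq (.write (.lit acc) (.lit 0)) (.seq (.write (.lit q) e)
    (.loop (var q) (.seq (.write (.lit q) (.div (var q) (.lit 2)))
      (.write (.lit acc) (.add (var acc) (.lit 1))))))

/-- Finds the cheapest set which contains `u`. -/
def argmin (u : Exp) : Prog :=
  -- The sum of all costs plus one is a sentinel above every cost. The product in the test below is
  -- nonzero exactly if the set contains u and is strictly cheaper than the best one so far.
  .seq (.write (.lit 11) (.add (var 2) (.lit 1))) (.seq (.write (.lit 12) (.lit 0))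
    (.forLoop 20 numSets (.cond (.mul (mem (var 20) u) (.sub (var 11) (remaining (var 20))))
      (.seq (.write (.lit 11) (remaining (var 20))) (.write (.lit 12) (var 20))) .skip)))

/-- Computes the costs, and the prices of the samples. -/
def prelude : Prog :=
  -- Cells 1, 2, 3, 4, 16 receive the common denominator, the total cost, 2^m, and the bit lengths
  -- of m and n. Four arrays are interleaved from address 32 with stride 8: 0 for costs, 1 for
  -- weights, 2 for purchases, 3 for prices of samples. The learner uses cells 6 (β), 7 (spent) and
  -- 8 (total weight).
  .seq (accLoop 1 20 (.lit 1) numSets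
    (.mul (var 1) (.input (.add (.lit 4) (.mul (.lit 2) (var 20))))))
  (.seq (fillLoop 0 20 numSets
    (.div (.mul (.input (.add (.lit 3) (.mul (.lit 2) (var 20)))) (var 1))
      (.input (.add (.lit 4) (.mul (.lit 2) (var 20))))))
  (.seq (accLoop 2 20 (.lit 0) numSets (.add (var 2) (entry 0 (var 20))))
  (.seq (accLoop 3 20 (.lit 1) numSets (.mul (.lit 2) (var 3)))
  (.seq (sizeLoop 4 5 numSets)
  (.seq (sizeLoop 16 5 numReqs)
  (.forLoop 21 numReqs (.seq (argmin (sample (var 21)))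
    (.write (addr 3 (var 21)) (var 11)))))))))

/-- Searches for the first mistake. -/
def scan : Prog :=
  .seq (.write (.lit 9) (.lit 0)) (.forLoop 21 numReqs
    -- A product of truncated differences serves as a conjunction: nothing found yet, the coin has
    -- the right parity, and n p > β.
    (.cond (.mul (.mul (.sub (.lit 1) (var 9))
        (.sub (.lit 1) (.mod (.add (coin (var 21)) (var 22)) (.lit 2))))
        (.sub (.mul (entry 3 (var 21)) numReqs) (var 6)))
      (.seq (accLoop 13 20 (.lit 0) numSets
          (.add (var 13) (.mul (mem (var 20) (sample (var 21))) (frac (var 20)))))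
        (.cond (.sub (var 8) (.mul (.lit 8) (var 13)))
          (.seq (.write (.lit 9) (.lit 1)) (.write (.lit 10) (var 21))) .skip))
      .skip))

/-- Updates the weights after a mistake. -/
def learn : Prog :=
  .seq (.write (.lit 15) (entry 3 (var 10)))
  -- A sum of truncated differences serves as the disjunction in `Refuted`.
  (.cond (.add (.sub (var 15) (var 6))
      (.sub (var 7) (.mul (.mul (.lit 4) (var 6)) (var 4))))
    (.seq (.write (.lit 6) (.add (var 6)
        (.add (.add (var 6) (.lit 1)) (.sub (var 15) (.add (var 6) (.lit 1))))))
      (.seq (.write (.lit 7) (.lit 0)) (fillLoop 1 20 numSets (.mul (.lit 16) numReqs))))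
    (.seq (.write (.lit 7) (.add (var 7) (var 15)))
      (fillLoop 1 20 numSets (.add (entry 1 (var 20))
        (.mul (mem (var 20) (sample (var 10)))
          (.add (.div (.mul (frac (var 20)) (var 15)) (var 6)) (.lit 2)))))))

/-- Learns from the samples whose coin equals the content of cell `22`. -/
def train : Prog :=
  .seq (.write (.lit 6) (.lit 0)) (.seq (.write (.lit 7) (.lit 0))
  (.seq (fillLoop 1 20 numSets (.mul (.lit 16) numReqs))
  (.seq (.write (.lit 9) (.lit 1))
  (.loop (var 9)
    (.seq (accLoop 8 20 (.lit 0) numSets (.add (var 8) (entry 1 (var 20))))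
    (.seq scan (.cond (var 9) learn .skip)))))))

/-- Buys sets at random, according to the fractional solution. -/
def round : Prog :=
  .forLoop 21 numSets
    -- The digits do not depend on cell 22, so both rounds use the same random number for a given
    -- set. Only independence between different sets is needed.
    (.seq (accLoop 14 20 (.lit 0) numSets (.add (.mul (.lit 2) (var 14))
        (coin (.add numReqs (.add (.mul numSets (var 21)) (var 20))))))
      (.cond (.sub (.mul (.mul (var 3) (.mul (.lit 8) (var 16))) (frac (var 21)))
          (.mul (var 14) (var 8)))
        (.write (addr 2 (var 21)) (.lit 1)) .skip))

/-- Writes the table of the universal map. -/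
def output : Prog :=
  -- All arrays have at most max(m, n) entries, so this address lies beyond them.
  .seq (.write (.lit 0) (.add (.lit 32) (.mul (.lit 8) (.add numSets numReqs))))
  (.forLoop 24 numElts (.seq (argmin (var 24)) (.write (.add (var 0) (var 24)) (var 12))))

/-- The algorithm. -/
def main : Prog :=
  .seq prelude (.seq (.forLoop 22 (.lit 2) (.seq train round)) output)

end Prog

/-! ### Correctness of the program: loops, prices and the prelude -/

section Verification

open Exp Prog

section Loops

variable {x : ℕ → ℕ} {L B : ℕ} {M : ℕ → ℕ} {Q R : (ℕ → ℕ) → Prop}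

theorem WP.accLoop {acc i : ℕ} {init bd e : Exp} (g : ℕ → ℕ) (T : ℕ) (hne : acc ≠ i)
    (hT : T ≤ L) (hL : L < 2 ^ B) (hx : Bounded B x) (hM : Bounded B M)
    (hinit : init.eval x M = g 0) (hg : ∀ j ≤ T, g j < 2 ^ B) (hbd : ∀ M', bd.eval x M' = T)
    (he : ∀ j < T, ∀ M', (∀ a, a ≠ acc → a ≠ i → M' a = M a) → M' i = j → M' acc = g j →
      e.eval x M' = g (j + 1))
    (hQ : ∀ M', Bounded B M' → (∀ a, a ≠ acc → a ≠ i → M' a = M a) → M' acc = g T → Q M') :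
    WP x L B (.accLoop acc i init bd e) M Q := by
  refine WP.seq (WP.write hx hM (by rw [hinit]; exact hg 0 (Nat.zero_le _)) ?_)
  refine WP.forLoop (fun k M' => (∀ a, a ≠ acc → a ≠ i → M' a = M a) ∧ M' acc = g k) T hT
    (hT.trans_lt hL) hx (hM.update _ (by rw [hinit]; exact hg 0 (Nat.zero_le _))) ?_
    (fun k M' _ => hbd M') ?_ (fun M' hM' h => hQ M' hM' h.1 h.2)
  · simp only [Exp.eval, hinit]
    refine ⟨fun a h1 h2 => ?_, ?_⟩
    · rw [Function.update_of_ne h2, Function.update_of_ne h1]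
    · rw [Function.update_of_ne hne, Function.update_self]
  · intro k hk M' hM' hi ⟨h1, h2⟩
    have h3 := he k hk M' h1 hi h2
    refine WP.write hx hM' (by rw [h3]; exact hg _ hk) ?_
    simp only [Exp.eval, h3]
    refine ⟨by rw [Function.update_of_ne hne.symm, hi], fun a h4 h5 => ?_, ?_⟩
    · rw [Function.update_of_ne h5, Function.update_of_ne h4, h1 a h4 h5]
    · rw [Function.update_of_ne hne, Function.update_self]

/-- When the value for entry j is computed, only the entries before j have changed. This permits
updating an array in place from its own old entries, as the learner does with the weights. -/
theorem WP.fillLoop {a i : ℕ} {bd e : Exp} (f : ℕ → ℕ) (T : ℕ) (hi : i < 32)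
    (hT : T ≤ L) (hL : L < 2 ^ B) (hx : Bounded B x) (hM : Bounded B M)
    (hf : ∀ j < T, f j < 2 ^ B) (hbd : ∀ M', bd.eval x M' = T)
    (he : ∀ j < T, ∀ M', (∀ b, b ≠ i → (∀ k < j, b ≠ 32 + a + 8 * k) → M' b = M b) → M' i = j →
      e.eval x M' = f j)
    (hQ : ∀ M', Bounded B M' → (∀ b, b ≠ i → (∀ k < T, b ≠ 32 + a + 8 * k) → M' b = M b) →
      (∀ j < T, M' (32 + a + 8 * j) = f j) → Q M') :
    WP x L B (.fillLoop a i bd e) M Q := by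
  refine WP.forLoop (fun k M' => (∀ b, b ≠ i → (∀ j < k, b ≠ 32 + a + 8 * j) → M' b = M b) ∧
    ∀ j < k, M' (32 + a + 8 * j) = f j) T hT
    (hT.trans_lt hL) hx hM ?_ (fun k M' _ => hbd M') ?_ (fun M' hM' h => hQ M' hM' h.1 h.2)
  · exact ⟨fun b h1 _ => Function.update_of_ne h1 _ _, by simp⟩
  · intro k hk M' hM' hik ⟨h1, h2⟩
    have h3 := he k hk M' h1 hik
    refine WP.write hx hM' (by rw [h3]; exact hf _ hk) ?_
    have h4 : (addr a (var i)).eval x M' = 32 + a + 8 * k := by simp [addr, var, Exp.eval, hik]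
    rw [h3, h4]
    refine ⟨by rw [Function.update_of_ne (by omega), hik], fun b h5 h6 => ?_, fun j hj => ?_⟩
    · rw [Function.update_of_ne h5, Function.update_of_ne (h6 k (by omega)),
        h1 b h5 fun j hj => h6 j (by omega)]
    · rw [Function.update_of_ne (by omega)]
      rcases Nat.lt_succ_iff_lt_or_eq.1 hj with h | rfl
      · rw [Function.update_of_ne (by omega), h2 j h]
      · rw [Function.update_self]

/-- After t halvings the scratch cell holds v / 2^t, which is nonzero exactly for t below the bit
length of v. -/
theorem WP.sizeLoop {acc q v : ℕ} {e : Exp} (hne : acc ≠ q)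
    (hv : v ≤ L) (hL : L < 2 ^ B) (hx : Bounded B x) (hM : Bounded B M)
    (he : ∀ M', e.eval x M' = v)
    (hQ : ∀ M', Bounded B M' → (∀ a, a ≠ acc → a ≠ q → M' a = M a) → M' acc = v.size → Q M') :
    WP x L B (.sizeLoop acc q e) M Q := by
  have hsz : v.size ≤ v := Nat.size_le.2 Nat.lt_two_pow_self
  refine WP.seq (WP.write hx hM (by simp [Exp.eval]) ?_)
  have hM1 := hM.update ((lit acc).eval x M) (k := (lit 0).eval x M) (by simp [Exp.eval])
  refine WP.seq (WP.write hx hM1 (by rw [he]; omega) ?_)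
  rw [he]
  refine WP.loop (fun t M' => (∀ a, a ≠ acc → a ≠ q → M' a = M a) ∧ M' acc = t ∧
    M' q = v / 2 ^ t) v.size (hsz.trans hv) hx (hM1.update _ (by omega)) ?_ ?_ ?_
  · simp only [Exp.eval]
    refine ⟨fun a h1 h2 => ?_, ?_, by simp⟩
    · rw [Function.update_of_ne h2, Function.update_of_ne h1]
    · rw [Function.update_of_ne hne, Function.update_self]
  · intro t ht M' hM' ⟨h1, h2, h3⟩
    have h4 : 2 ^ t ≤ v := Nat.lt_size.1 ht
    refine ⟨?_, ?_⟩
    · simp only [var, Exp.eval, h3]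
      exact (Nat.div_pos h4 (by positivity)).ne'
    have h5 : v / 2 ^ t / 2 < 2 ^ B :=
      ((Nat.div_le_self _ _).trans (Nat.div_le_self _ _)).trans_lt (hv.trans_lt hL)
    have h6 : (div (var q) (.lit 2)).eval x M' = v / 2 ^ t / 2 := by simp [var, Exp.eval, h3]
    refine WP.seq (WP.write hx hM' (by rw [h6]; exact h5) ?_)
    rw [h6]
    have h7 : (Exp.add (var acc) (lit 1)).eval x
        (Function.update M' ((lit q).eval x M') (v / 2 ^ t / 2)) = t + 1 := by
      simp [var, Exp.eval, Function.update_of_ne hne, h2]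
    refine WP.write hx (hM'.update _ h5) (by rw [h7]; omega) ?_
    rw [h7]
    simp only [Exp.eval]
    refine ⟨fun a h8 h9 => ?_, by simp, ?_⟩
    · rw [Function.update_of_ne h8, Function.update_of_ne h9, h1 a h8 h9]
    · rw [Function.update_of_ne hne.symm, Function.update_self, pow_succ, Nat.div_div_eq_div_mul]
  · intro M' hM' ⟨h1, h2, h3⟩
    refine ⟨?_, hQ M' hM' h1 h2⟩
    simp only [var, Exp.eval, h3]
    exact Nat.div_eq_of_lt (Nat.lt_size_self v)

end Loops

/-- The input `x` encodes the instance `J` with `N` elements, the samples, and the coins. -/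
structure Encodes (x : ℕ → ℕ) (N : ℕ) (J : Instance) (smp coins : ℕ → ℕ) : Prop where
  numElts : x 0 = N
  numSets : x 1 = J.m
  numReqs : x 2 = J.n
  cost : ∀ j < J.m, x (3 + 2 * j) * (∏ k ∈ Finset.range J.m, x (4 + 2 * k)) / x (4 + 2 * j) = J.c j
  mem : ∀ j < J.m, ∀ u < N, x (3 + 2 * J.m + (N * j + u)) = J.mem j u
  sample : ∀ i < J.n, x (3 + 2 * J.m + (J.m * N + i)) = smp i
  sample_lt : ∀ i < J.n, smp i < N
  coin : ∀ k < J.n + J.m * J.m, x (3 + 2 * J.m + (J.m * N + (J.n + k))) = coins k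
  coin_le : ∀ k, coins k ≤ 1
  valid : J.Valid
  price : ∀ u < N, ∃ j < J.m, J.mem j u = 1 ∧ J.price u = J.c j

@[simp] theorem Exp.eval_var (x M : ℕ → ℕ) (k : ℕ) : (var k).eval x M = M k := rfl

@[simp] theorem Exp.eval_addr (x M : ℕ → ℕ) (a : ℕ) (e : Exp) :
    (addr a e).eval x M = 32 + a + 8 * e.eval x M := rfl

@[simp] theorem Exp.eval_entry (x M : ℕ → ℕ) (a : ℕ) (e : Exp) :
    (entry a e).eval x M = M (32 + a + 8 * e.eval x M) := rfl

/-- The sum of all costs. -/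
def Instance.sumCost (J : Instance) : ℕ := ∑ j ∈ Finset.range J.m, J.c j

theorem Instance.cost_le_sumCost (J : Instance) {j : ℕ} (hj : j < J.m) : J.c j ≤ J.sumCost :=
  Finset.single_le_sum (f := J.c) (fun _ _ => Nat.zero_le _) (Finset.mem_range.2 hj)

/-- Loops with `L` iterations and cells of `B` bits suffice for the algorithm. -/
structure Fits (x : ℕ → ℕ) (N : ℕ) (J : Instance) (L B : ℕ) : Prop where
  bounded : Bounded B x
  m_le : J.m ≤ L
  n_le : J.n ≤ L
  N_le : N ≤ L
  two_le : 2 ≤ L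
  steps_le : Learner.stepBound J + 1 ≤ L
  lt : L < 2 ^ B
  den : ∀ k ≤ J.m, ∏ j ∈ Finset.range k, x (4 + 2 * j) < 2 ^ B
  big : (2 * J.sumCost + 2) * (8 * J.m + 8) * (16 * J.n + 16) * 2 ^ (Learner.stepBound J + J.m)
    < 2 ^ B

section Main

variable {x : ℕ → ℕ} {N L B : ℕ} {J : Instance} {smp coins : ℕ → ℕ} {M : ℕ → ℕ}
  {Q : (ℕ → ℕ) → Prop}

theorem Fits.lt_of_le (hF : Fits x N J L B) {k : ℕ}
    (h : k ≤ (2 * J.sumCost + 2) * (8 * J.m + 8) * (16 * J.n + 16) *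
      2 ^ (Learner.stepBound J + J.m)) : k < 2 ^ B :=
  h.trans_lt hF.big

theorem Fits.lt_of_le_sumCost (hF : Fits x N J L B) {k : ℕ} (h : k ≤ 2 * J.sumCost + 2) :
    k < 2 ^ B := by
  refine hF.lt_of_le (h.trans ?_)
  have : 0 < 2 ^ (Learner.stepBound J + J.m) := by positivity
  rw [mul_assoc, mul_assoc]
  exact Nat.le_mul_of_pos_right _ (by positivity)

theorem Fits.two_pow_lt (hF : Fits x N J L B) : 2 ^ J.m < 2 ^ B := by
  refine hF.lt_of_le ?_
  rw [pow_add, ← mul_assoc]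
  exact Nat.le_mul_of_pos_left _ (by positivity)

section Eval

variable (hE : Encodes x N J smp coins) (M)
include hE

theorem Encodes.eval_numElts : Exp.numElts.eval x M = N := hE.numElts

theorem Encodes.eval_numSets : Exp.numSets.eval x M = J.m := hE.numSets

theorem Encodes.eval_numReqs : Exp.numReqs.eval x M = J.n := hE.numReqs

theorem Encodes.eval_mem {j u : Exp} (hj : j.eval x M < J.m) (hu : u.eval x M < N) :
    (Exp.mem j u).eval x M = J.mem (j.eval x M) (u.eval x M) := by
  rw [← hE.mem _ hj _ hu]
  simp [Exp.mem, Exp.eval, hE.eval_numSets, hE.eval_numElts]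

theorem Encodes.eval_sample {i : Exp} (hi : i.eval x M < J.n) :
    (Exp.sample i).eval x M = smp (i.eval x M) := by
  rw [← hE.sample _ hi]
  simp [Exp.sample, Exp.eval, hE.eval_numSets, hE.eval_numElts]

theorem Encodes.eval_coin {i : Exp} (hi : i.eval x M < J.n + J.m * J.m) :
    (Exp.coin i).eval x M = coins (i.eval x M) := by
  rw [← hE.coin _ hi]
  simp [Exp.coin, Exp.eval, hE.eval_numSets, hE.eval_numElts, hE.eval_numReqs]

end Eval

/-- The invariant says that the current value is minimal among the sets seen so far and is either
attained or still the sentinel. Every element lies in some set, which excludes the sentinel at the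
end. -/
theorem WP.argmin (hF : Fits x N J L B) (hE : Encodes x N J smp coins) (bought : ℕ → ℕ)
    {e : Exp} {u : ℕ} (hM : Bounded B M) (hu : u < N) (h2 : M 2 = J.sumCost)
    (hc : ∀ j < J.m, M (32 + 8 * j) = J.c j) (hb : ∀ j < J.m, M (34 + 8 * j) = bought j)
    (he : ∀ M', (∀ a, a ≠ 11 → a ≠ 12 → a ≠ 20 → M' a = M a) → e.eval x M' = u)
    (hQ : ∀ M', Bounded B M' → (∀ a, a ≠ 11 → a ≠ 12 → a ≠ 20 → M' a = M a) →
      ∀ k < J.m, M' 12 = k → M' 11 = J.c k * (1 - bought k) → J.mem k u = 1 →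
        (∀ j < J.m, J.mem j u = 1 → J.c k * (1 - bought k) ≤ J.c j * (1 - bought j)) → Q M') :
    WP x L B (.argmin e) M Q := by
  have hle : ∀ j < J.m, J.c j * (1 - bought j) ≤ J.sumCost := fun j hj =>
    (Nat.mul_le_mul_left _ (show 1 - bought j ≤ 1 by omega)).trans
      ((mul_one _).le.trans (J.cost_le_sumCost hj))
  have h11 : ((var 2).add (lit 1)).eval x M = J.sumCost + 1 := by simp [Exp.eval, h2]
  have hlt : J.sumCost + 1 < 2 ^ B := hF.lt_of_le_sumCost (by omega)
  refine WP.seq (WP.write hF.bounded hM (by rw [h11]; exact hlt) ?_)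
  rw [h11]
  have hM1 := hM.update 11 hlt
  refine WP.seq (WP.write hF.bounded hM1 (by simp [Exp.eval]) ?_)
  have hM2 := hM1.update 12 (k := 0) (by positivity)
  simp only [Exp.eval]
  refine WP.forLoop (fun k M' => (∀ a, a ≠ 11 → a ≠ 12 → a ≠ 20 → M' a = M a) ∧
    (∀ j < k, J.mem j u = 1 → M' 11 ≤ J.c j * (1 - bought j)) ∧
    (M' 11 = J.sumCost + 1 ∨ ∃ k' < k, M' 12 = k' ∧ M' 11 = J.c k' * (1 - bought k') ∧
      J.mem k' u = 1)) J.m hF.m_le (hF.m_le.trans_lt hF.lt) hF.bounded hM2 ?_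
      (fun k M' _ => hE.eval_numSets M') ?_ ?_
  · refine ⟨fun a h1 h2 h3 => ?_, by simp, by simp⟩
    simp [Function.update_of_ne, h1, h2, h3]
  · intro k hk M' hM' hi ⟨h3, h4, h5⟩
    have hr : (remaining (var 20)).eval x M' = J.c k * (1 - bought k) := by
      simp only [remaining, Exp.eval, Exp.eval_entry, Exp.eval_var, hi]
      rw [h3 _ (by omega) (by omega) (by omega), h3 _ (by omega) (by omega) (by omega)]
      simp [hc k hk, hb k hk]
    have hm : (Exp.mem (var 20) e).eval x M' = J.mem k u := by
      rw [hE.eval_mem M' (by simpa [hi] using hk) (by rw [he M' h3]; exact hu), he M' h3]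
      simp [hi]
    have hm1 := hE.valid.mem_le k u
    have hb : J.c k * (1 - bought k) < 2 ^ B :=
      hF.lt_of_le_sumCost ((hle k hk).trans (by omega))
    refine WP.cond hF.bounded hM' ?_ ?_
    · intro h6
      simp only [Exp.eval, hr, hm, Exp.eval_var] at h6
      have h7 : J.mem k u = 1 := by
        rcases Nat.eq_zero_or_pos (J.mem k u) with h | h
        · simp [h] at h6
        · omega
      rw [h7] at h6
      refine WP.seq (WP.write hF.bounded hM' (by rw [hr]; exact hb) ?_)
      rw [hr]
      have h8 : (var 20).eval x (Function.update M' ((lit 11).eval x M') (J.c k * (1 - bought k)))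
          = k := by simp [Exp.eval, hi]
      refine WP.write hF.bounded (hM'.update _ hb) (by
        rw [h8]; exact hk.trans_le (hF.m_le.trans hF.lt.le)) ?_
      rw [h8]
      simp only [Exp.eval]
      refine ⟨by simp [hi], fun a h1 h2 h3' => ?_, fun j hj hju => ?_, Or.inr ⟨k, by omega, ?_⟩⟩
      · simp [Function.update_of_ne, h1, h2, h3', h3]
      · rw [Function.update_of_ne (by omega), Function.update_of_ne (by omega),
          Function.update_self]
        rcases Nat.lt_succ_iff_lt_or_eq.1 hj with h | rfl
        · have := h4 j h hju
          omega
        · exact le_rfl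
      · simp [h7]
    · intro h6
      simp only [Exp.eval, hr, hm, Exp.eval_var] at h6
      refine WP.skip hM' ⟨hi, fun a h1 h2 h3' => ?_, fun j hj hju => ?_, ?_⟩
      · simp [Function.update_of_ne, h1, h2, h3', h3]
      · rw [Function.update_of_ne (by omega)]
        rcases Nat.lt_succ_iff_lt_or_eq.1 hj with h | rfl
        · exact h4 j h hju
        · rw [hju] at h6; omega
      · rcases h5 with h5 | ⟨k', h5, h7, h8, h9⟩
        · left; simpa using h5
        · right; exact ⟨k', by omega, by simpa using h7, by simpa using h8, h9⟩
  · intro M' hM' ⟨h3, h4, h5⟩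
    obtain ⟨j, hj, hju, -⟩ := hE.price u hu
    have h6 := h4 j hj hju
    have h7 := hle j hj
    rcases h5 with h5 | ⟨k, hk, h8, h9, h10⟩
    · omega
    · exact hQ M' hM' h3 k hk h8 h9 h10 fun j hj hju => h9 ▸ h4 j hj hju

/-- The memory contains the data which the prelude computes, and the list of bought sets. -/
structure Ready (J : Instance) (smp bought : ℕ → ℕ) (M : ℕ → ℕ) : Prop where
  sumCost : M 2 = J.sumCost
  pow : M 3 = 2 ^ J.m
  sizeSets : M 4 = J.m.size
  sizeReqs : M 16 = J.n.size
  cost : ∀ j < J.m, M (32 + 8 * j) = J.c j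
  bought : ∀ j < J.m, M (34 + 8 * j) = bought j
  price : ∀ i < J.n, M (35 + 8 * i) = J.price (smp i)

/-- The addresses of the data which the prelude computes. -/
def Permanent (a : ℕ) : Prop := a = 2 ∨ a = 3 ∨ a = 4 ∨ a = 16 ∨ 32 ≤ a ∧ a % 8 ≠ 1

theorem Ready.congr {bought M' : ℕ → ℕ} (h : Ready J smp bought M)
    (hM' : ∀ a, Permanent a → M' a = M a) : Ready J smp bought M' where
  sumCost := by rw [hM' _ (by unfold Permanent; omega), h.sumCost]
  pow := by rw [hM' _ (by unfold Permanent; omega), h.pow]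
  sizeSets := by rw [hM' _ (by unfold Permanent; omega), h.sizeSets]
  sizeReqs := by rw [hM' _ (by unfold Permanent; omega), h.sizeReqs]
  cost j hj := by rw [hM' _ (by unfold Permanent; omega), h.cost j hj]
  bought j hj := by rw [hM' _ (by unfold Permanent; omega), h.bought j hj]
  price j hj := by rw [hM' _ (by unfold Permanent; omega), h.price j hj]

theorem WP.prelude (hF : Fits x N J L B) (hE : Encodes x N J smp coins)
    (hM : ∀ a, M a = 0) (hQ : ∀ M', Bounded B M' → Ready J smp (fun _ => 0) M' → Q M') :
    WP x L B .prelude M Q := by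
  have hx := hF.bounded
  have hMB : Bounded B M := fun a => by rw [hM a]; positivity
  refine WP.seq (WP.accLoop (fun k => ∏ j ∈ Finset.range k, x (4 + 2 * j)) J.m (by norm_num)
    hF.m_le hF.lt hx hMB (by simp [Exp.eval]) hF.den hE.eval_numSets ?_ ?_)
  · intro j hj M' h1 h2 h3
    simp only [Exp.eval, Exp.eval_var, h2, h3, Finset.prod_range_succ]
  intro M1 hM1 f1 v1
  refine WP.seq (WP.fillLoop J.c J.m (by norm_num) hF.m_le hF.lt hx hM1
    (fun j hj => hF.lt_of_le_sumCost ((J.cost_le_sumCost hj).trans (by omega))) hE.eval_numSets ?_ ?_)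
  · intro j hj M' h1 h2
    simp only [Exp.eval, Exp.eval_var, h2]
    rw [h1 1 (by omega) (by omega), v1, hE.cost j hj]
  intro M2 hM2 f2 v2
  refine WP.seq (WP.accLoop (fun k => ∑ j ∈ Finset.range k, J.c j) J.m (by norm_num)
    hF.m_le hF.lt hx hM2 (by simp [Exp.eval]) ?_ hE.eval_numSets ?_ ?_)
  · intro j hj
    refine hF.lt_of_le_sumCost (le_trans (Finset.sum_le_sum_of_subset ?_)
      (show J.sumCost ≤ _ by omega))
    simpa using hj
  · intro j hj M' h1 h2 h3
    simp only [Exp.eval, Exp.eval_var, Exp.eval_entry, h2, h3, Finset.sum_range_succ]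
    rw [h1 _ (by omega) (by omega), v2 j hj]
  intro M3 hM3 f3 v3
  refine WP.seq (WP.accLoop (fun k => 2 ^ k) J.m (by norm_num)
    hF.m_le hF.lt hx hM3 (by simp [Exp.eval]) ?_ hE.eval_numSets ?_ ?_)
  · intro j hj
    exact (Nat.pow_le_pow_right (by norm_num) hj).trans_lt hF.two_pow_lt
  · intro j hj M' h1 h2 h3
    simp only [Exp.eval, Exp.eval_var, h3, pow_succ, mul_comm]
  intro M4 hM4 f4 v4
  refine WP.seq (WP.sizeLoop (v := J.m) (by norm_num) hF.m_le hF.lt hx hM4 hE.eval_numSets ?_)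
  intro M5 hM5 f5 v5
  refine WP.seq (WP.sizeLoop (v := J.n) (by norm_num) hF.n_le hF.lt hx hM5 hE.eval_numReqs ?_)
  intro M6 hM6 f6 v6
  have hc6 : ∀ j < J.m, M6 (32 + 8 * j) = J.c j := by
    intro j hj
    rw [f6 _ (by omega) (by omega), f5 _ (by omega) (by omega), f4 _ (by omega) (by omega),
      f3 _ (by omega) (by omega)]
    exact v2 j hj
  have hb6 : ∀ j, M6 (34 + 8 * j) = 0 := by
    intro j
    rw [f6 _ (by omega) (by omega), f5 _ (by omega) (by omega), f4 _ (by omega) (by omega),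
      f3 _ (by omega) (by omega), f2 _ (by omega) (by omega), f1 _ (by omega) (by omega), hM]
  refine WP.forLoop (fun i M' => (∀ a, a ≠ 11 → a ≠ 12 → a ≠ 20 → a ≠ 21 →
      (a < 32 ∨ a % 8 ≠ 3) → M' a = M6 a) ∧ ∀ i' < i, M' (35 + 8 * i') = J.price (smp i'))
    J.n hF.n_le (hF.n_le.trans_lt hF.lt) hx hM6 ?_ (fun i M' _ => hE.eval_numReqs M') ?_ ?_
  · exact ⟨fun a _ _ _ h _ => Function.update_of_ne h _ _, by simp⟩
  · intro i hi M7 hM7 h21 ⟨h1, h2⟩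
    refine WP.seq (WP.argmin hF hE (fun _ => 0) (u := smp i) hM7 (hE.sample_lt i hi) ?_ ?_ ?_ ?_ ?_)
    · rw [h1 _ (by omega) (by omega) (by omega) (by omega) (by omega), f6 _ (by omega) (by omega),
        f5 _ (by omega) (by omega), f4 _ (by omega) (by omega)]
      exact v3
    · intro j hj
      rw [h1 _ (by omega) (by omega) (by omega) (by omega) (by omega), hc6 j hj]
    · intro j hj
      rw [h1 _ (by omega) (by omega) (by omega) (by omega) (by omega), hb6 j]
    · intro M' h3
      rw [hE.eval_sample M' (by simpa [h3 21, h21] using hi)]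
      simp [h3 21, h21]
    · intro M' hM' h3 k hk _ h5 h6 h7
      -- No set has been bought yet, so the smallest remaining cost is the price.
      have h8 : M' 11 = J.price (smp i) := by
        obtain ⟨j, hj, hju, hp⟩ := hE.price (smp i) (hE.sample_lt i hi)
        have h9 := hE.valid.price_le k hk (smp i) h6
        have h10 := h7 j hj hju
        simp at h5 h10
        omega
      have hp : J.price (smp i) < 2 ^ B := h8 ▸ hM' 11
      refine WP.write hx hM' (by simpa [h8] using hp) ?_
      simp only [Exp.eval_addr, Exp.eval_var, h8, h3 21 (by omega) (by omega) (by omega), h21]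
      refine ⟨?_, fun a h11 h12 h13 h14 h15 => ?_, fun i' hi' => ?_⟩
      · rw [Function.update_of_ne (by omega), h3 21 (by omega) (by omega) (by omega), h21]
      · rw [Function.update_of_ne h14, Function.update_of_ne (by omega), h3 a h11 h12 h13,
          h1 a h11 h12 h13 h14 h15]
      · rw [Function.update_of_ne (by omega)]
        rcases Nat.lt_succ_iff_lt_or_eq.1 hi' with h | rfl
        · rw [Function.update_of_ne (by omega), h3 _ (by omega) (by omega) (by omega), h2 i' h]
        · rw [show 32 + 3 + 8 * i' = 35 + 8 * i' by omega, Function.update_self]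
  · intro M7 hM7 ⟨h1, h2⟩
    refine hQ M7 hM7 ⟨?_, ?_, ?_, ?_, ?_, ?_, h2⟩
    · rw [h1 _ (by omega) (by omega) (by omega) (by omega) (by omega), f6 _ (by omega) (by omega),
        f5 _ (by omega) (by omega), f4 _ (by omega) (by omega)]
      exact v3
    · rw [h1 _ (by omega) (by omega) (by omega) (by omega) (by omega), f6 _ (by omega) (by omega),
        f5 _ (by omega) (by omega)]
      exact v4
    · rw [h1 _ (by omega) (by omega) (by omega) (by omega) (by omega), f6 _ (by omega) (by omega)]
      exact v5
    · rw [h1 _ (by omega) (by omega) (by omega) (by omega) (by omega)]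
      exact v6
    · intro j hj
      rw [h1 _ (by omega) (by omega) (by omega) (by omega) (by omega), hc6 j hj]
    · intro j hj
      rw [h1 _ (by omega) (by omega) (by omega) (by omega) (by omega), hb6 j]

end Main

/-! ### Correctness of the program: training, rounding and output -/

/-- The number with the `k` binary digits `f 0, …, f (k - 1)`, most significant digit first. -/
def binary (f : ℕ → ℕ) : ℕ → ℕ
  | 0 => 0
  | k + 1 => 2 * binary f k + f k

theorem binary_lt {f : ℕ → ℕ} (hf : ∀ k, f k ≤ 1) (k : ℕ) : binary f k < 2 ^ k := by
  induction k with
  | zero => simp [binary]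
  | succ k ih =>
    have := hf k
    rw [binary, pow_succ]
    omega

/-- The samples whose coin is `b`. -/
def active (coins : ℕ → ℕ) (b : ℕ) (i : ℕ) : Bool := decide ((coins i + b) % 2 = 0)

/-- The sets bought by rounding the fractional solution of the learner, in addition to those
which have been bought before. -/
def buy (J : Instance) (coins : ℕ → ℕ) (s : Learner) (bought : ℕ → ℕ) (j : ℕ) : ℕ :=
  if binary (fun k => coins (J.n + (J.m * j + k))) J.m * s.total J <
    2 ^ J.m * (8 * J.n.size) * s.frac J j then 1 else bought j

/-- The memory contains the state `s` of the learner. -/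
structure Holds (J : Instance) (s : Learner) (M : ℕ → ℕ) : Prop where
  beta : M 6 = s.beta
  spent : M 7 = s.spent
  w : ∀ j < J.m, M (33 + 8 * j) = s.w j

section Main

variable {x : ℕ → ℕ} {N L B : ℕ} {J : Instance} {smp coins bought : ℕ → ℕ} {M : ℕ → ℕ}
  {Q : (ℕ → ℕ) → Prop} {s : Learner} {b : ℕ}

theorem Holds.congr {M' : ℕ → ℕ} (h : Holds J s M)
    (hM' : ∀ a, a = 6 ∨ a = 7 ∨ 32 ≤ a ∧ a % 8 = 1 → M' a = M a) : Holds J s M' where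
  beta := by rw [hM' _ (by omega), h.beta]
  spent := by rw [hM' _ (by omega), h.spent]
  w j hj := by rw [hM' _ (by omega), h.w j hj]

theorem Holds.eval_frac (h : Holds J s M) (hR : Ready J smp bought M) {e : Exp}
    (he : e.eval x M < J.m) : (Exp.frac e).eval x M = s.frac J (e.eval x M) := by
  simp only [Exp.frac, Exp.eval, Exp.eval_var, Exp.eval_entry, Learner.frac, h.beta]
  simp [h.w _ he, hR.cost _ he]

/-- The numbers of the state of the learner fit into cells with `B` bits. -/
structure Learner.Small (J : Instance) (s : Learner) (B : ℕ) : Prop where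
  beta : s.beta < 2 ^ B
  spent : s.spent < 2 ^ B
  w : ∀ j < J.m, s.w j < 2 ^ B
  total : s.total J < 2 ^ B
  coverage : ∀ u, s.coverage J u < 2 ^ B

theorem Encodes.covering (hE : Encodes x N J smp coins) (act : ℕ → Bool) :
    Learner.Covering J act smp (Finset.range J.m) where
  sub := subset_rfl
  cov i hi _ := by
    obtain ⟨j, hj, hju, -⟩ := hE.price _ (hE.sample_lt i hi)
    exact ⟨j, Finset.mem_range.2 hj, hju⟩

/-- The guess is at most twice the sum of costs, and weights at most double per step up to a
constant. Multiplying by m for the sums, and by β for `coverage`, stays within the product in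
`Fits.big`. -/
theorem Learner.run_small (hF : Fits x N J L B) (hE : Encodes x N J smp coins) (act : ℕ → Bool)
    {t : ℕ} (ht : t ≤ Learner.stepBound J) : (Learner.run J act smp t).Small J B := by
  have hb := Learner.beta_le_two_mul hE.valid (hE.covering act) t
  have hs := (Learner.run_inv hE.valid (hE.covering act) t).spent_le
  have hw := fun j (hj : j < J.m) => Learner.run_w_le (act := act) (smp := smp) hE.valid t hj
  have hsz : J.m.size ≤ J.m := Nat.size_le.2 Nat.lt_two_pow_self
  change _ ≤ 2 * J.sumCost at hb
  have hpow : 2 ^ t ≤ 2 ^ (Learner.stepBound J + J.m) :=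
    Nat.pow_le_pow_right (by norm_num) (by omega)
  have hpow1 : 1 ≤ 2 ^ (Learner.stepBound J + J.m) := Nat.one_le_two_pow
  set s := Learner.run J act smp t
  set p := 2 ^ (Learner.stepBound J + J.m) with hp
  have hwp : ∀ j < J.m, s.w j ≤ (16 * J.n + 16) * p := fun j hj => by
    have := hw j hj
    have : (16 * J.n + 2) * 2 ^ t ≤ (16 * J.n + 16) * p := Nat.mul_le_mul (by omega) hpow
    omega
  have htot : s.total J ≤ J.m * ((16 * J.n + 16) * p) := by
    refine (Finset.sum_le_sum fun j hj => hwp j (Finset.mem_range.1 hj)).trans ?_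
    simp
  have hX : 1 ≤ (16 * J.n + 16) * p := Nat.mul_pos (by omega) hpow1
  set X := (16 * J.n + 16) * p with hXdef
  have hfit : ∀ k, k ≤ (2 * J.sumCost + 2) * (8 * J.m + 8) * X → k < 2 ^ B := fun k hk =>
    hF.lt_of_le (hk.trans_eq (by rw [hXdef]; ring))
  have hbig : X ≤ (2 * J.sumCost + 2) * (8 * J.m + 8) * X :=
    Nat.le_mul_of_pos_left _ (by positivity)
  refine ⟨hF.lt_of_le_sumCost (by omega), ?_, fun j hj => hfit _ ((hwp j hj).trans hbig), ?_, ?_⟩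
  · refine hfit _ (hs.trans ?_)
    have h1 : 4 * s.beta * J.m.size + s.beta ≤ (2 * J.sumCost + 2) * (8 * J.m + 8) := by
      have : s.beta * J.m.size ≤ (2 * J.sumCost) * J.m := Nat.mul_le_mul hb hsz
      nlinarith
    exact h1.trans (Nat.le_mul_of_pos_right _ (by omega))
  · refine hfit _ (htot.trans (Nat.mul_le_mul_right _ ?_))
    nlinarith [Nat.zero_le (J.sumCost * J.m)]
  · intro u
    refine hfit _ ?_
    have h1 : s.coverage J u ≤ ∑ j ∈ Finset.range J.m, 2 * J.sumCost * X := by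
      refine Finset.sum_le_sum fun j hj => ?_
      have hj' := Finset.mem_range.1 hj
      have h2 := hE.valid.mem_le j u
      have h3 : s.frac J j ≤ s.beta * s.w j := by
        unfold Learner.frac
        exact (Nat.mul_le_mul (Nat.div_le_self _ _) (show 1 - (J.c j - s.beta) ≤ 1 by omega)).trans
          (mul_one _).le
      calc J.mem j u * s.frac J j ≤ 1 * (s.beta * s.w j) := Nat.mul_le_mul h2 h3
        _ ≤ _ := by rw [one_mul]; exact Nat.mul_le_mul hb (hwp j hj')
    refine h1.trans ?_
    simp only [Finset.sum_const, Finset.card_range, smul_eq_mul]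
    rw [← mul_assoc]
    refine Nat.mul_le_mul_right _ ?_
    nlinarith [Nat.zero_le (J.sumCost * J.m)]

/-- After k rounds, cells 9 and 10 hold the result of the search among the first k samples. The
coverage is computed only if all cheaper tests have passed. -/
theorem WP.scan (hF : Fits x N J L B) (hE : Encodes x N J smp coins) (hM : Bounded B M)
    (hR : Ready J smp bought M) (hs : Holds J s M) (hsm : s.Small J B)
    (hW : M 8 = s.total J) (hb : M 22 = b)
    (hQ : ∀ M', Bounded B M' →
      (∀ a, a ≠ 9 → a ≠ 10 → a ≠ 13 → a ≠ 20 → a ≠ 21 → M' a = M a) →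
      (s.pick J (active coins b) smp = none ∧ M' 9 = 0 ∨
        ∃ i, s.pick J (active coins b) smp = some i ∧ M' 9 = 1 ∧ M' 10 = i) → Q M') :
    WP x L B .scan M Q := by
  have hx := hF.bounded
  refine WP.seq (WP.write hx hM (by simp [Exp.eval]) ?_)
  have hM1 := hM.update 9 (k := 0) (by positivity)
  simp only [Exp.eval]
  set p : ℕ → Bool := fun i => active coins b i && decide (s.Mistake J (smp i)) with hp
  refine WP.forLoop (fun k M' =>
    (∀ a, a ≠ 9 → a ≠ 10 → a ≠ 13 → a ≠ 20 → a ≠ 21 → M' a = M a) ∧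
    ((List.range k).find? p = none ∧ M' 9 = 0 ∨
      ∃ i, (List.range k).find? p = some i ∧ M' 9 = 1 ∧ M' 10 = i))
    J.n hF.n_le (hF.n_le.trans_lt hF.lt) hx hM1 ?_ (fun k M' _ => hE.eval_numReqs M') ?_ ?_
  · refine ⟨fun a h1 h2 h3 h4 h5 => ?_, Or.inl ⟨by simp, by simp⟩⟩
    simp [Function.update_of_ne, h1, h5]
  · intro i hi M' hM' h21 ⟨h1, h2⟩
    have hR' : Ready J smp bought M' := hR.congr fun a ha => by
      unfold Permanent at ha
      exact h1 a (by omega) (by omega) (by omega) (by omega) (by omega)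
    have hs' : Holds J s M' := hs.congr fun a ha =>
      h1 a (by omega) (by omega) (by omega) (by omega) (by omega)
    have hcoin : (Exp.coin (var 21)).eval x M' = coins i := by
      rw [hE.eval_coin M' (by simp [h21]; omega)]; simp [h21]
    have hcond : (Exp.mul (.mul (.sub (.lit 1) (var 9))
        (.sub (.lit 1) (.mod (.add (Exp.coin (var 21)) (var 22)) (.lit 2))))
        (.sub (.mul (entry 3 (var 21)) Exp.numReqs) (var 6))).eval x M' =
        (1 - M' 9) * (1 - (coins i + b) % 2) * (J.price (smp i) * J.n - s.beta) := by
      simp only [Exp.eval, Exp.eval_var, Exp.eval_entry, hcoin, hE.eval_numReqs, h21, hs'.beta,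
        hR'.price i hi, Nat.reduceAdd]
      rw [h1 22 (by omega) (by omega) (by omega) (by omega) (by omega), hb]
    have hrange : (List.range (i + 1)).find? p =
        ((List.range i).find? p).or (if p i = true then some i else none) := by
      rw [List.range_succ, List.find?_append]
      congr 1
      by_cases h : p i = true <;> simp [h]
    -- This collects the cases in which a round leaves the search result unchanged: a mistake was
    -- found earlier, or sample i is none.
    have hskip : M' 9 = 1 ∨ p i = false →
        (∀ a, a ≠ 9 → a ≠ 10 → a ≠ 13 → a ≠ 20 → a ≠ 21 →
          (Function.update M' 21 (i + 1)) a = M a) ∧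
        ((List.range (i + 1)).find? p = none ∧ (Function.update M' 21 (i + 1)) 9 = 0 ∨
          ∃ k, (List.range (i + 1)).find? p = some k ∧ (Function.update M' 21 (i + 1)) 9 = 1 ∧
          (Function.update M' 21 (i + 1)) 10 = k) := by
      intro h
      refine ⟨fun a h3 h4 h5 h6 h7 => by rw [Function.update_of_ne h7, h1 a h3 h4 h5 h6 h7], ?_⟩
      rw [hrange, Function.update_of_ne (by omega), Function.update_of_ne (by omega)]
      rcases h2 with ⟨h2, h3⟩ | ⟨k, h2, h3, h4⟩
      · left
        have : p i = false := by rcases h with h | h <;> [omega; exact h]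
        simp [h2, this, h3]
      · right
        exact ⟨k, by simp [h2], h3, h4⟩
    refine WP.cond hx hM' ?_ ?_
    · rw [hcond]
      intro hne
      have h9 : M' 9 = 0 := by
        by_contra h
        exact hne (by rw [show 1 - M' 9 = 0 by omega]; simp)
      have hact : (coins i + b) % 2 = 0 := by
        by_contra h
        exact hne (by rw [show 1 - (coins i + b) % 2 = 0 by omega]; simp)
      have hpr : s.beta < J.price (smp i) * J.n := by
        by_contra h
        exact hne (by rw [show J.price (smp i) * J.n - s.beta = 0 by omega]; simp)
      have hnone : (List.range i).find? p = none := by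
        rcases h2 with h2 | ⟨k, _, h3, _⟩
        · exact h2.1
        · omega
      refine WP.seq (WP.accLoop
        (fun k => ∑ j ∈ Finset.range k, J.mem j (smp i) * s.frac J j) J.m (by norm_num)
        hF.m_le hF.lt hx hM' (by simp [Exp.eval]) ?_ hE.eval_numSets ?_ ?_)
      · intro j hj
        refine lt_of_le_of_lt (Finset.sum_le_sum_of_subset ?_) (hsm.coverage (smp i))
        simpa using hj
      · intro j hj M3 h3 h4 h5
        have hR3 : Ready J smp bought M3 := hR'.congr fun a ha => by
          unfold Permanent at ha; exact h3 a (by omega) (by omega)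
        have hs3 : Holds J s M3 := hs'.congr fun a ha => h3 a (by omega) (by omega)
        have h21' : M3 21 = i := by rw [h3 21 (by omega) (by omega), h21]
        have hsmp : (Exp.sample (var 21)).eval x M3 = smp i := by
          rw [hE.eval_sample M3 (by simpa [h21'] using hi)]; simp [h21']
        have hmem : (Exp.mem (var 20) (Exp.sample (var 21))).eval x M3 = J.mem j (smp i) := by
          rw [hE.eval_mem M3 (by simpa [h4] using hj) (by rw [hsmp]; exact hE.sample_lt i hi), hsmp]
          simp [h4]
        have hfr : (Exp.frac (var 20)).eval x M3 = s.frac J j := by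
          rw [hs3.eval_frac hR3 (by simpa [h4] using hj)]; simp [h4]
        simp only [Exp.eval, Exp.eval_var, h5, hmem, hfr, Finset.sum_range_succ]
      · intro M3 hM3 f3 v3
        have h8 : M3 8 = s.total J := by
          rw [f3 8 (by omega) (by omega), h1 8 (by omega) (by omega) (by omega) (by omega) (by omega),
            hW]
        have h21' : M3 21 = i := by rw [f3 21 (by omega) (by omega), h21]
        change M3 13 = s.coverage J (smp i) at v3
        refine WP.cond hx hM3 ?_ ?_
        · simp only [Exp.eval, Exp.eval_var, h8, v3]
          intro h3
          have hpi : p i = true := by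
            simp only [hp, active, hact, decide_true, Bool.true_and, decide_eq_true_eq]
            exact ⟨hpr, by omega⟩
          refine WP.seq (WP.write hx hM3 (by simp only [Exp.eval]; linarith [hF.two_le, hF.lt]) ?_)
          have hv : (var 21).eval x (Function.update M3 ((lit 9).eval x M3) ((lit 1).eval x M3))
              = i := by simp [Exp.eval, h21']
          refine WP.write hx (hM3.update _ (by simp only [Exp.eval]; linarith [hF.two_le, hF.lt]))
            (by rw [hv]; exact hi.trans (hF.n_le.trans_lt hF.lt)) ?_
          rw [hv]
          simp only [Exp.eval]
          refine ⟨by simp [h21'], fun a h4 h5 h6 h7 h8 => ?_, Or.inr ⟨i, ?_, ?_, ?_⟩⟩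
          · simp [Function.update_of_ne, h4, h5, h8, f3 a h6 h7, h1 a h4 h5 h6 h7 h8]
          · rw [hrange, hnone, if_pos hpi]; rfl
          · simp
          · simp
        · simp only [Exp.eval, Exp.eval_var, h8, v3]
          intro h3
          have hpi : p i = false := by
            simp only [hp, active, hact, decide_true, Bool.true_and, decide_eq_false_iff_not]
            intro h4
            have := h4.2
            omega
          refine WP.skip hM3 ⟨h21', ?_⟩
          obtain ⟨h4, h5⟩ := hskip (Or.inr hpi)
          rw [Function.update_of_ne (by omega), Function.update_of_ne (by omega)] at h5
          refine ⟨fun a h6 h7 h8 h9 h10 => ?_, ?_⟩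
          · rw [Function.update_of_ne h10, f3 a h8 h9, h1 a h6 h7 h8 h9 h10]
          · rw [Function.update_of_ne (by omega), Function.update_of_ne (by omega),
              f3 9 (by omega) (by omega), f3 10 (by omega) (by omega)]
            simpa using h5
    · rw [hcond]
      intro h0
      refine WP.skip hM' ⟨h21, hskip ?_⟩
      by_cases h9 : M' 9 = 1
      · exact Or.inl h9
      right
      have h9 : M' 9 = 0 := by
        rcases h2 with h2 | ⟨k, _, h3, _⟩
        · exact h2.2
        · omega
      rw [h9] at h0
      by_contra hpi
      simp only [hp, active, Bool.not_eq_false, Bool.and_eq_true, decide_eq_true_eq] at hpi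
      rw [hpi.1] at h0
      have := hpi.2.1
      omega
  · intro M' hM' ⟨h1, h2⟩
    exact hQ M' hM' h1 h2

theorem WP.learn (hF : Fits x N J L B) (hE : Encodes x N J smp coins) (hM : Bounded B M)
    (hR : Ready J smp bought M) (hs : Holds J s M) {i : ℕ} (hi : i < J.n) (h10 : M 10 = i)
    (hsm : (s.learn J (smp i)).Small J B)
    (hQ : ∀ M', Bounded B M' → (∀ a, a ≠ 6 → a ≠ 7 → a ≠ 15 → a ≠ 20 → (a < 32 ∨ a % 8 ≠ 1) →
      M' a = M a) → Holds J (s.learn J (smp i)) M' → Q M') :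
    WP x L B .learn M Q := by
  have hx := hF.bounded
  have hpr : (entry 3 (var 10)).eval x M = J.price (smp i) := by
    simp [h10, hR.price i hi]
  have hprB : J.price (smp i) < 2 ^ B := by
    have := hM (35 + 8 * i)
    rwa [hR.price i hi] at this
  refine WP.seq (WP.write hx hM (by rw [hpr]; exact hprB) ?_)
  rw [hpr]
  have hM1 := hM.update 15 hprB
  simp only [Exp.eval]
  set M1 := Function.update M 15 (J.price (smp i)) with hM1def
  have f1 : ∀ a, a ≠ 15 → M1 a = M a := fun a ha => Function.update_of_ne ha _ _
  have v1 : M1 15 = J.price (smp i) := Function.update_self _ _ _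
  have hs1 : Holds J s M1 := hs.congr fun a ha => f1 a (by omega)
  have hR1 : Ready J smp bought M1 := hR.congr fun a ha => f1 a (by unfold Permanent at ha; omega)
  have hcond : (Exp.add (.sub (var 15) (var 6))
      (.sub (var 7) (.mul (.mul (.lit 4) (var 6)) (var 4)))).eval x M1 =
      (J.price (smp i) - s.beta) + (s.spent - 4 * s.beta * J.m.size) := by
    simp only [Exp.eval, Exp.eval_var, v1, hs1.beta, hs1.spent, hR1.sizeSets]
  refine WP.cond hx hM1 ?_ ?_
  · rw [hcond]
    intro hne
    have hr : s.Refuted J (smp i) := by unfold Learner.Refuted; omega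
    have hl : s.learn J (smp i) = Learner.fresh J
        (s.beta + (s.beta + 1 + (J.price (smp i) - (s.beta + 1)))) := by
      rw [Learner.learn, if_pos hr]
    have he : (Exp.add (var 6) (.add (.add (var 6) (.lit 1))
        (.sub (var 15) (.add (var 6) (.lit 1))))).eval x M1 = (s.learn J (smp i)).beta := by
      simp only [Exp.eval, Exp.eval_var, v1, hs1.beta, hl, Learner.fresh]
    refine WP.seq (WP.write hx hM1 (by rw [he]; exact hsm.beta) ?_)
    rw [he]
    have hM2 := hM1.update 6 hsm.beta
    refine WP.seq (WP.write hx hM2 (by simp [Exp.eval]) ?_)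
    have hM3 := hM2.update 7 (k := 0) (by positivity)
    simp only [Exp.eval]
    refine WP.fillLoop (s.learn J (smp i)).w J.m (by norm_num) hF.m_le hF.lt hx hM3 hsm.w
      hE.eval_numSets ?_ ?_
    · intro j hj M' _ _
      simp only [Exp.eval, hE.eval_numReqs, hl, Learner.fresh]
    · intro M' hM' f2 v2
      refine hQ M' hM' ?_ ⟨?_, ?_, ?_⟩
      · intro a h6 h7 h15 h20 h32
        rw [f2 a h20 (by intros; omega), Function.update_of_ne h7, Function.update_of_ne h6,
          f1 a h15]
      · rw [f2 6 (by omega) (by intros; omega), Function.update_of_ne (by omega),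
          Function.update_self]
      · rw [f2 7 (by omega) (by intros; omega), Function.update_self, hl]; rfl
      · exact v2
  · rw [hcond]
    intro h0
    have hr : ¬ s.Refuted J (smp i) := by unfold Learner.Refuted; omega
    have hl : s.learn J (smp i) = ⟨s.beta, s.spent + J.price (smp i), fun j => s.w j +
        J.mem j (smp i) * (s.frac J j * J.price (smp i) / s.beta + 2)⟩ := by
      rw [Learner.learn, if_neg hr]
    have he : (Exp.add (var 7) (var 15)).eval x M1 = (s.learn J (smp i)).spent := by
      simp only [Exp.eval, Exp.eval_var, v1, hs1.spent, hl]
    refine WP.seq (WP.write hx hM1 (by rw [he]; exact hsm.spent) ?_)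
    rw [he]
    have hM2 := hM1.update 7 hsm.spent
    simp only [Exp.eval]
    refine WP.fillLoop (s.learn J (smp i)).w J.m (by norm_num) hF.m_le hF.lt hx hM2 hsm.w
      hE.eval_numSets ?_ ?_
    · intro j hj M' h1 h2
      have g : ∀ a, a ≠ 7 → a ≠ 20 → (a < 32 ∨ a % 8 ≠ 1) → M' a = M1 a := by
        intro a h3 h4 h5
        rw [h1 a h4 (by intros; omega), Function.update_of_ne h3]
      have hw : M' (33 + 8 * j) = s.w j := by
        rw [h1 _ (by omega) (by intros; omega), Function.update_of_ne (by omega), hs1.w j hj]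
      have h10' : M' 10 = i := by
        rw [g 10 (by omega) (by omega) (by omega), f1 10 (by omega), h10]
      have hsmp : (Exp.sample (var 10)).eval x M' = smp i := by
        rw [hE.eval_sample M' (by simpa [h10'] using hi)]; simp [h10']
      have hmem : (Exp.mem (var 20) (Exp.sample (var 10))).eval x M' = J.mem j (smp i) := by
        rw [hE.eval_mem M' (by simpa [h2] using hj) (by rw [hsmp]; exact hE.sample_lt i hi), hsmp]
        simp [h2]
      have h6 : M' 6 = s.beta := by rw [g 6 (by omega) (by omega) (by omega), hs1.beta]
      have hfr : (Exp.frac (var 20)).eval x M' = s.frac J j := by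
        simp only [Exp.frac, Exp.eval, Exp.eval_var, Exp.eval_entry, Learner.frac, h2, h6,
          Nat.reduceAdd, Nat.add_zero, hw]
        rw [g _ (by omega) (by omega) (by omega), hR1.cost j hj]
      simp only [Exp.eval, Exp.eval_var, Exp.eval_entry, hmem, hfr, h6, h2, Nat.reduceAdd, hw, hl]
      rw [g 15 (by omega) (by omega) (by omega), v1]
    · intro M' hM' f2 v2
      refine hQ M' hM' ?_ ⟨?_, ?_, ?_⟩
      · intro a h6 h7 h15 h20 h32
        rw [f2 a h20 (by intros; omega), Function.update_of_ne h7, f1 a h15]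
      · rw [f2 6 (by omega) (by intros; omega), Function.update_of_ne (by omega), hs1.beta, hl]
      · rw [f2 7 (by omega) (by intros; omega), Function.update_self]
      · exact v2

end Main

section Main

variable {x : ℕ → ℕ} {N L B : ℕ} {J : Instance} {smp coins bought : ℕ → ℕ} {M : ℕ → ℕ}
  {Q : (ℕ → ℕ) → Prop} {s : Learner} {b : ℕ}

/-- If T is the first time without a mistake, the loop makes T + 1 rounds: T repairs and one scan
that finds nothing. Hence the `min t T` in the invariant, and the additional 1 in `Fits.steps_le`.
-/
theorem WP.train (hF : Fits x N J L B) (hE : Encodes x N J smp coins) (hM : Bounded B M)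
    (hR : Ready J smp bought M) (hb : M 22 = b)
    (hQ : ∀ M', Bounded B M' → Ready J smp bought M' → M' 22 = b →
      Holds J (Learner.final J (active coins b) smp) M' →
      M' 8 = (Learner.final J (active coins b) smp).total J → Q M') :
    WP x L B .train M Q := by
  have hx := hF.bounded
  set act := active coins b with hact
  have h0B : 0 < 2 ^ B := by positivity
  have h1B : 1 < 2 ^ B := lt_of_lt_of_le (by linarith [hF.two_le]) hF.lt.le
  have hsm0 := Learner.run_small hF hE act (Nat.zero_le _)
  refine WP.seq (WP.write hx hM (by simp [Exp.eval]) ?_)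
  have hM1 := hM.update 6 h0B
  refine WP.seq (WP.write hx hM1 (by simp [Exp.eval]) ?_)
  have hM2 := hM1.update 7 h0B
  simp only [Exp.eval]
  refine WP.seq (WP.fillLoop (Learner.fresh J 0).w J.m (by norm_num) hF.m_le hF.lt hx hM2 hsm0.w
    hE.eval_numSets ?_ ?_)
  · intro j hj M' _ _
    simp only [Exp.eval, hE.eval_numReqs, Learner.fresh]
  intro M3 hM3 f3 v3
  refine WP.seq (WP.write hx hM3 (by simpa [Exp.eval] using h1B) ?_)
  have hM4 := hM3.update 9 h1B
  simp only [Exp.eval]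
  have f4 : ∀ a, a ≠ 6 → a ≠ 7 → a ≠ 9 → a ≠ 20 → (a < 32 ∨ a % 8 ≠ 1) →
      Function.update M3 9 1 a = M a := by
    intro a h6 h7 h9 h20 h32
    rw [Function.update_of_ne h9, f3 a h20 (by intros; omega), Function.update_of_ne h7,
      Function.update_of_ne h6]
  obtain ⟨T, hT, hnone, hsome⟩ := Learner.exists_pick_none (act := act) (smp := smp) hE.valid
    (hE.covering act)
  have hfin : Learner.final J act smp = Learner.run J act smp T :=
    Learner.run_eq_of_pick_none _ _ _ hnone hT
  rw [hfin] at hQ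
  refine WP.loop (fun t M' => Ready J smp bought M' ∧ M' 22 = b ∧
      Holds J (Learner.run J act smp (min t T)) M' ∧
      (t ≤ T ∧ M' 9 = 1 ∨ t = T + 1 ∧ M' 9 = 0 ∧ M' 8 = (Learner.run J act smp T).total J))
    (T + 1) (by linarith [hF.steps_le]) hx hM4 ?_ ?_ ?_
  · refine ⟨hR.congr fun a ha => ?_, ?_, ⟨?_, ?_, ?_⟩, Or.inl ⟨Nat.zero_le _, by simp⟩⟩
    · unfold Permanent at ha
      exact f4 a (by omega) (by omega) (by omega) (by omega) (by omega)
    · rw [f4 22 (by omega) (by omega) (by omega) (by omega) (by omega), hb]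
    · rw [Function.update_of_ne (by omega), f3 6 (by omega) (by intros; omega),
        Function.update_of_ne (by omega), Function.update_self, Nat.zero_min]
      rfl
    · rw [Function.update_of_ne (by omega), f3 7 (by omega) (by intros; omega),
        Function.update_self, Nat.zero_min]
      rfl
    · intro j hj
      rw [Function.update_of_ne (by omega), Nat.zero_min]
      exact v3 j hj
  · intro t ht M5 hM5 ⟨hR5, hb5, hs5, h9⟩
    have h9 : M5 9 = 1 := by
      rcases h9 with h | h
      · exact h.2
      · omega
    rw [min_eq_left (by omega)] at hs5
    set s := Learner.run J act smp t with hs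
    have hsm : s.Small J B := Learner.run_small hF hE act (by omega)
    refine ⟨by simp [h9], WP.seq ?_⟩
    refine WP.accLoop (fun k => ∑ j ∈ Finset.range k, s.w j) J.m (by norm_num)
      hF.m_le hF.lt hx hM5 (by simp [Exp.eval]) ?_ hE.eval_numSets ?_ ?_
    · intro j hj
      refine lt_of_le_of_lt (Finset.sum_le_sum_of_subset ?_) hsm.total
      simpa using hj
    · intro j hj M' h1 h2 h3
      simp only [Exp.eval, Exp.eval_var, Exp.eval_entry, h2, h3, Finset.sum_range_succ, Nat.reduceAdd]
      rw [h1 _ (by omega) (by omega), hs5.w j hj]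
    intro M6 hM6 f6 v6
    have hR6 : Ready J smp bought M6 := hR5.congr fun a ha => by
      unfold Permanent at ha; exact f6 a (by omega) (by omega)
    have hs6 : Holds J s M6 := hs5.congr fun a ha => f6 a (by omega) (by omega)
    have hb6 : M6 22 = b := by rw [f6 22 (by omega) (by omega), hb5]
    refine WP.seq (WP.scan hF hE hM6 hR6 hs6 hsm v6 hb6 ?_)
    intro M7 hM7 f7 v7
    have hR7 : Ready J smp bought M7 := hR6.congr fun a ha => by
      unfold Permanent at ha
      exact f7 a (by omega) (by omega) (by omega) (by omega) (by omega)
    have hs7 : Holds J s M7 := hs6.congr fun a ha =>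
      f7 a (by omega) (by omega) (by omega) (by omega) (by omega)
    have hb7 : M7 22 = b := by
      rw [f7 22 (by omega) (by omega) (by omega) (by omega) (by omega), hb6]
    have h87 : M7 8 = s.total J := by
      rw [f7 8 (by omega) (by omega) (by omega) (by omega) (by omega)]; exact v6
    refine WP.cond hx hM7 ?_ ?_
    · intro hne
      obtain ⟨i, hi, h91, h10⟩ : ∃ i, s.pick J act smp = some i ∧ M7 9 = 1 ∧ M7 10 = i := by
        rcases v7 with h | h
        · exact absurd h.2 hne
        · exact h
      have htT : t < T := by
        rcases Nat.lt_succ_iff_lt_or_eq.1 ht with h | rfl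
        · exact h
        · rw [hs, hnone] at hi; simp at hi
      have hstep : Learner.run J act smp (t + 1) = s.learn J (smp i) := by
        rw [Learner.run_succ, ← hs, Learner.step, hi]
      have hsm' : (s.learn J (smp i)).Small J B := by
        rw [← hstep]; exact Learner.run_small hF hE act (by omega)
      refine WP.learn hF hE hM7 hR7 hs7 (Learner.pick_some hi).1 h10 hsm' ?_
      intro M8 hM8 f8 v8
      refine ⟨hR7.congr fun a ha => ?_, ?_, ?_, Or.inl ⟨htT, ?_⟩⟩
      · unfold Permanent at ha
        exact f8 a (by omega) (by omega) (by omega) (by omega) (by omega)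
      · rw [f8 22 (by omega) (by omega) (by omega) (by omega) (by omega), hb7]
      · rw [min_eq_left (by omega), hstep]; exact v8
      · rw [f8 9 (by omega) (by omega) (by omega) (by omega) (by omega), h91]
    · intro h90
      have hn : s.pick J act smp = none := by
        rcases v7 with h | ⟨i, _, h, _⟩
        · exact h.1
        · simp only [Exp.eval_var] at h90; omega
      have htT : t = T := by
        by_contra h
        exact hsome t (by omega) hn
      subst htT
      refine WP.skip hM7 ⟨hR7, hb7, ?_, Or.inr ⟨rfl, h90, h87⟩⟩
      rw [min_eq_right (by omega)]; exact hs7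
  · intro M5 hM5 ⟨hR5, hb5, hs5, h9⟩
    rcases h9 with h | ⟨_, h9, h8⟩
    · omega
    rw [min_eq_right (by omega)] at hs5
    exact ⟨by simp [h9], hQ M5 hM5 hR5 hb5 hs5 h8⟩

theorem WP.round (hF : Fits x N J L B) (hE : Encodes x N J smp coins) (hM : Bounded B M)
    (hR : Ready J smp bought M) (hb : M 22 = b) (hs : Holds J s M) (hW : M 8 = s.total J)
    (hQ : ∀ M', Bounded B M' → Ready J smp (buy J coins s bought) M' → M' 22 = b → Q M') :
    WP x L B .round M Q := by
  have hx := hF.bounded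
  have h1B : 1 < 2 ^ B := lt_of_lt_of_le (by linarith [hF.two_le]) hF.lt.le
  refine WP.forLoop (fun i M' =>
      (∀ a, a ≠ 14 → a ≠ 20 → a ≠ 21 → (a < 32 ∨ a % 8 ≠ 2) → M' a = M a) ∧
      (∀ j < i, M' (34 + 8 * j) = buy J coins s bought j) ∧
      (∀ j < J.m, i ≤ j → M' (34 + 8 * j) = bought j))
    J.m hF.m_le (hF.m_le.trans_lt hF.lt) hx hM ?_ (fun i M' _ => hE.eval_numSets M') ?_ ?_
  · refine ⟨fun a _ _ h _ => Function.update_of_ne h _ _, by simp, fun j hj _ => ?_⟩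
    rw [Function.update_of_ne (by omega), hR.bought j hj]
  · intro i hi M1 hM1 h21 ⟨f1, v1, w1⟩
    set d := fun k => coins (J.n + (J.m * i + k)) with hd
    refine WP.seq (WP.accLoop (binary d) J.m (by norm_num) hF.m_le hF.lt hx hM1
      (by simp [Exp.eval, binary]) ?_ hE.eval_numSets ?_ ?_)
    · intro j hj
      refine (binary_lt (fun k => hE.coin_le _) j).trans_le ?_
      exact (Nat.pow_le_pow_right (by norm_num) hj).trans hF.two_pow_lt.le
    · intro j hj M' h1 h2 h3
      have h21' : M' 21 = i := by rw [h1 21 (by omega) (by omega), h21]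
      have he : (Exp.add numReqs (.add (.mul numSets (var 21)) (var 20))).eval x M' =
          J.n + (J.m * i + j) := by
        simp only [Exp.eval, hE.eval_numReqs, hE.eval_numSets, Exp.eval_var, h21', h2]
      have hlt : J.m * i + j < J.m * J.m := by nlinarith
      simp only [Exp.eval, Exp.eval_var, h3, binary]
      rw [hE.eval_coin M' (by rw [he]; omega), he]
    intro M2 hM2 f2 v2
    have g2 : ∀ a, a ≠ 14 → a ≠ 20 → a ≠ 21 → (a < 32 ∨ a % 8 ≠ 2) → M2 a = M a :=
      fun a h1 h2 h3 h4 => by rw [f2 a h1 h2, f1 a h1 h2 h3 h4]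
    have h21' : M2 21 = i := by rw [f2 21 (by omega) (by omega), h21]
    have hfr : (Exp.frac (var 21)).eval x M2 = s.frac J i := by
      simp only [Exp.frac, Exp.eval, Exp.eval_var, Exp.eval_entry, Learner.frac, h21',
        Nat.reduceAdd, Nat.add_zero]
      rw [g2 6 (by omega) (by omega) (by omega) (by omega),
        g2 _ (by omega) (by omega) (by omega) (by omega),
        g2 _ (by omega) (by omega) (by omega) (by omega), hs.beta, hs.w i hi, hR.cost i hi]
    have hcond : (Exp.sub (.mul (.mul (var 3) (.mul (.lit 8) (var 16))) (Exp.frac (var 21)))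
          (.mul (var 14) (var 8))).eval x M2 =
        2 ^ J.m * (8 * J.n.size) * s.frac J i - binary d J.m * s.total J := by
      simp only [Exp.eval, Exp.eval_var, hfr, v2]
      rw [g2 3 (by omega) (by omega) (by omega) (by omega),
        g2 16 (by omega) (by omega) (by omega) (by omega),
        g2 8 (by omega) (by omega) (by omega) (by omega), hR.pow, hR.sizeReqs, hW]
    refine WP.cond hx hM2 ?_ ?_
    · rw [hcond]
      intro hne
      have hbuy : buy J coins s bought i = 1 := by
        rw [buy, if_pos]; change binary d J.m * _ < _; omega
      refine WP.write hx hM2 (by simpa [Exp.eval] using h1B) ?_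
      simp only [Exp.eval, Exp.eval_addr, Exp.eval_var, h21', Nat.reduceAdd]
      refine ⟨by rw [Function.update_of_ne (by omega), h21'], fun a h1 h2 h3 h4 => ?_,
        fun j hj => ?_, fun j hj hij => ?_⟩
      · rw [Function.update_of_ne h3, Function.update_of_ne (by omega), g2 a h1 h2 h3 h4]
      · rw [Function.update_of_ne (by omega)]
        rcases Nat.lt_succ_iff_lt_or_eq.1 hj with h | rfl
        · rw [Function.update_of_ne (by omega), f2 _ (by omega) (by omega), v1 j h]
        · rw [Function.update_self, hbuy]
      · rw [Function.update_of_ne (by omega), Function.update_of_ne (by omega),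
          f2 _ (by omega) (by omega), w1 j hj (by omega)]
    · rw [hcond]
      intro h0
      have hbuy : buy J coins s bought i = bought i := by
        rw [buy, if_neg]; change ¬ binary d J.m * _ < _; omega
      refine WP.skip hM2 ⟨h21', fun a h1 h2 h3 h4 => ?_, fun j hj => ?_, fun j hj hij => ?_⟩
      · rw [Function.update_of_ne h3, g2 a h1 h2 h3 h4]
      · rw [Function.update_of_ne (by omega), f2 _ (by omega) (by omega)]
        rcases Nat.lt_succ_iff_lt_or_eq.1 hj with h | rfl
        · exact v1 j h
        · rw [hbuy, w1 j hi le_rfl]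
      · rw [Function.update_of_ne (by omega), f2 _ (by omega) (by omega), w1 j hj (by omega)]
  · intro M1 hM1 ⟨f1, v1, _⟩
    refine hQ M1 hM1 ⟨?_, ?_, ?_, ?_, fun j hj => ?_, v1, fun j hj => ?_⟩ ?_
    · rw [f1 _ (by omega) (by omega) (by omega) (by omega), hR.sumCost]
    · rw [f1 _ (by omega) (by omega) (by omega) (by omega), hR.pow]
    · rw [f1 _ (by omega) (by omega) (by omega) (by omega), hR.sizeSets]
    · rw [f1 _ (by omega) (by omega) (by omega) (by omega), hR.sizeReqs]
    · rw [f1 _ (by omega) (by omega) (by omega) (by omega), hR.cost j hj]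
    · rw [f1 _ (by omega) (by omega) (by omega) (by omega), hR.price j hj]
    · rw [f1 _ (by omega) (by omega) (by omega) (by omega), hb]

/-- The set `k` is a cheapest one among those which contain `u`, if bought sets are free. -/
def IsChoice (J : Instance) (bought : ℕ → ℕ) (u k : ℕ) : Prop :=
  k < J.m ∧ J.mem k u = 1 ∧
    ∀ j < J.m, J.mem j u = 1 → J.c k * (1 - bought k) ≤ J.c j * (1 - bought j)

theorem WP.output (hF : Fits x N J L B) (hE : Encodes x N J smp coins) (hM : Bounded B M)
    (hR : Ready J smp bought M)
    (hQ : ∀ M', Bounded B M' → (∀ u < N, IsChoice J bought u (M' (M' 0 + u))) → Q M') :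
    WP x L B .output M Q := by
  have hx := hF.bounded
  set base := 32 + 8 * (J.m + J.n) with hbase
  have he : (Exp.add (.lit 32) (.mul (.lit 8) (.add numSets numReqs))).eval x M = base := by
    simp only [Exp.eval, hE.eval_numSets, hE.eval_numReqs, hbase]
  have hbB : base < 2 ^ B := by
    refine hF.lt_of_le ?_
    have h1 : base ≤ 2 * (8 * J.m + 8) * (16 * J.n + 16) := by
      rw [hbase]; nlinarith [Nat.zero_le (J.m * J.n)]
    refine h1.trans ?_
    have h2 : 0 < 2 ^ (Learner.stepBound J + J.m) := by positivity
    refine le_trans (Nat.mul_le_mul_right _ (Nat.mul_le_mul_right _ (show 2 ≤ 2 * J.sumCost + 2 by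
      omega))) (Nat.le_mul_of_pos_right _ h2)
  refine WP.seq (WP.write hx hM (by rw [he]; exact hbB) ?_)
  rw [he]
  have hM1 := hM.update 0 hbB
  simp only [Exp.eval]
  refine WP.forLoop (fun u M' =>
      (∀ a, a ≠ 0 → a ≠ 11 → a ≠ 12 → a ≠ 20 → a ≠ 24 → a < base → M' a = M a) ∧
      M' 0 = base ∧ ∀ v < u, IsChoice J bought v (M' (base + v)))
    N hF.N_le (hF.N_le.trans_lt hF.lt) hx hM1 ?_ (fun i M' _ => hE.eval_numElts M') ?_ ?_
  · refine ⟨fun a h0 _ _ _ h24 _ => ?_, ?_, by simp⟩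
    · rw [Function.update_of_ne h24, Function.update_of_ne h0]
    · rw [Function.update_of_ne (by omega), Function.update_self]
  · intro u hu M2 hM2 h24 ⟨f2, z2, v2⟩
    refine WP.seq (WP.argmin hF hE bought (u := u) hM2 hu ?_ ?_ ?_ ?_ ?_)
    · rw [f2 2 (by omega) (by omega) (by omega) (by omega) (by omega) (by omega), hR.sumCost]
    · intro j hj
      rw [f2 _ (by omega) (by omega) (by omega) (by omega) (by omega) (by omega), hR.cost j hj]
    · intro j hj
      rw [f2 _ (by omega) (by omega) (by omega) (by omega) (by omega) (by omega), hR.bought j hj]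
    · intro M' h1
      simp [h1, h24]
    · intro M3 hM3 f3 k hk h12 _ h5 h6
      refine WP.write hx hM3 (by simpa [h12] using hk.trans_le (hF.m_le.trans hF.lt.le)) ?_
      have h0 : M3 0 = base := by rw [f3 0 (by omega) (by omega) (by omega), z2]
      have h24' : M3 24 = u := by rw [f3 24 (by omega) (by omega) (by omega), h24]
      simp only [Exp.eval, Exp.eval_var, h12, h0, h24']
      refine ⟨by rw [Function.update_of_ne (by omega), h24'], fun a h1 h2 h3 h4 h7 h8 => ?_, ?_,
        fun v hv => ?_⟩
      · rw [Function.update_of_ne h7, Function.update_of_ne (by omega), f3 a h2 h3 h4,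
          f2 a h1 h2 h3 h4 h7 h8]
      · rw [Function.update_of_ne (by omega), Function.update_of_ne (by omega), h0]
      · rw [Function.update_of_ne (by omega)]
        rcases Nat.lt_succ_iff_lt_or_eq.1 hv with h | rfl
        · rw [Function.update_of_ne (by omega), f3 _ (by omega) (by omega) (by omega)]
          exact v2 v h
        · rw [Function.update_self]
          exact ⟨hk, h5, h6⟩
  · intro M2 hM2 ⟨_, z2, v2⟩
    refine hQ M2 hM2 ?_
    rw [z2]
    exact v2

/-- The sets bought in both rounds. -/
def purchases (J : Instance) (smp coins : ℕ → ℕ) : ℕ → ℕ :=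
  buy J coins (Learner.final J (active coins 1) smp)
    (buy J coins (Learner.final J (active coins 0) smp) fun _ => 0)

theorem WP.main (hF : Fits x N J L B) (hE : Encodes x N J smp coins) :
    WP x L B .main (fun _ => 0) fun M' =>
      ∀ u < N, IsChoice J (purchases J smp coins) u (M' (M' 0 + u)) := by
  have hx := hF.bounded
  refine WP.seq (WP.prelude hF hE (fun _ => rfl) fun M1 hM1 hR1 => ?_)
  -- The purchases before round b; the value at 2 is what the output phase reads.
  set R : ℕ → ℕ → ℕ := fun b => match b with
    | 0 => fun _ => 0
    | 1 => buy J coins (Learner.final J (active coins 0) smp) fun _ => 0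
    | _ => purchases J smp coins with hRdef
  refine WP.seq (WP.forLoop (fun b M' => Ready J smp (R b) M') 2 hF.two_le
    (hF.two_le.trans_lt hF.lt) hx hM1 (hR1.congr fun a ha => ?_) (fun _ _ _ => rfl) ?_ ?_)
  · unfold Permanent at ha
    exact Function.update_of_ne (by omega) _ _
  · intro b hb M2 hM2 h22 hR2
    refine WP.seq (WP.train hF hE hM2 hR2 h22 fun M3 hM3 hR3 h22' hs3 hW3 => ?_)
    refine WP.round hF hE hM3 hR3 h22' hs3 hW3 fun M4 hM4 hR4 h22'' => ⟨h22'', ?_⟩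
    have hnext : R (b + 1) = buy J coins (Learner.final J (active coins b) smp) (R b) := by
      interval_cases b <;> rfl
    rw [hnext]
    refine hR4.congr fun a ha => ?_
    unfold Permanent at ha
    exact Function.update_of_ne (by omega) _ _
  · intro M2 hM2 hR2
    exact WP.output hF hE hM2 hR2 fun M' _ h => h

end Main

end Verification

/-! ## Reading the input -/

theorem getD_append_add {l l' : List ℕ} {a : ℕ} (h : l.length = a) (k : ℕ) :
    (l ++ l').getD (a + k) 0 = l'.getD k 0 := by
  subst h
  rw [List.getD_append_right _ _ _ _ (Nat.le_add_right _ _), Nat.add_sub_cancel_left]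

theorem getD_flatMap {α : Type*} {f : α → List ℕ} {k : ℕ} (hf : ∀ a, (f a).length = k) (l : List α)
    (j : ℕ) (hj : j < l.length) (i : ℕ) (hi : i < k) :
    (l.flatMap f).getD (k * j + i) 0 = (f l[j]).getD i 0 := by
  induction l generalizing j with
  | nil => simp at hj
  | cons a l ih =>
    rw [List.flatMap_cons]
    cases j with
    | zero =>
      rw [List.getD_append _ _ _ _ (by rw [hf]; omega)]
      simp
    | succ j =>
      rw [show k * (j + 1) + i = k + (k * j + i) by ring, getD_append_add (hf a),
        ih j (by simpa using hj)]
      simp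

theorem length_flatMap_eq {α : Type*} {f : α → List ℕ} {k : ℕ} (hf : ∀ a, (f a).length = k)
    (l : List α) : (l.flatMap f).length = l.length * k := by
  simp [List.length_flatMap, hf]

namespace SetSystem

variable (I : SetSystem)

/-- The numerator of the cost of the set `j`. -/
def numCost (j : ℕ) : ℕ := if h : j < I.numSets then (I.cost ⟨j, h⟩).num else 0

/-- The denominator of the cost of the set `j`. -/
def denCost (j : ℕ) : ℕ := if h : j < I.numSets then (I.cost ⟨j, h⟩).den else 1

/-- A common denominator of all costs. -/
def commonDen : ℕ := ∏ k ∈ Finset.range I.numSets, I.denCost k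

/-- The entries of the incidence matrix. -/
def incidence (j u : ℕ) : ℕ :=
  if h : j < I.numSets ∧ u < I.numElts then
    if (⟨u, h.2⟩ : Fin I.numElts) ∈ I.sets ⟨j, h.1⟩ then 1 else 0
  else 0

/-- The cost of the set `j` in units of `1 / I.commonDen`. -/
def intCost (j : ℕ) : ℕ := I.numCost j * I.commonDen / I.denCost j

/-- The instance with integral costs. -/
noncomputable def toInstance (n : ℕ) : Instance where
  m := I.numSets
  n := n
  c := I.intCost
  mem := I.incidence
  price u := sInf {k | ∃ j < I.numSets, I.incidence j u = 1 ∧ I.intCost j = k}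

variable {I}

/-- A function on `Fin n` as a function on the natural numbers. -/
def extend {n : ℕ} (f : Fin n → ℕ) (i : ℕ) : ℕ := if h : i < n then f ⟨i, h⟩ else 0

theorem toInstance_valid (n : ℕ) : (I.toInstance n).Valid where
  mem_le j u := by
    change I.incidence j u ≤ 1
    unfold incidence; split
    · split <;> omega
    · omega
  price_le j hj u hu := Nat.sInf_le ⟨j, hj, hu, rfl⟩

theorem exists_incidence {u : ℕ} (hu : u < I.numElts) :
    ∃ j < I.numSets, I.incidence j u = 1 := by
  obtain ⟨j, hj⟩ := I.covers ⟨u, hu⟩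
  exact ⟨j, j.2, by simp [incidence, hu, hj]⟩

theorem exists_price (n : ℕ) {u : ℕ} (hu : u < I.numElts) :
    ∃ j < (I.toInstance n).m, (I.toInstance n).mem j u = 1 ∧
      (I.toInstance n).price u = (I.toInstance n).c j := by
  obtain ⟨j, hj, hju⟩ := I.exists_incidence hu
  obtain ⟨k, hk, hku, h⟩ := Nat.sInf_mem
    (s := {k | ∃ j < I.numSets, I.incidence j u = 1 ∧ I.intCost j = k}) ⟨_, j, hj, hju, rfl⟩
  exact ⟨k, hk, hku, h.symm⟩

theorem getD_inputList_den {n r : ℕ} (s : Fin n → Fin I.numElts) (ω : Fin r → Bool) {j : ℕ}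
    (hj : j < I.numSets) : (I.inputList s ω).getD (4 + 2 * j) 0 = I.denCost j := by
  have hl : ((List.finRange I.numSets).flatMap
      (fun j => [(I.cost j).num, (I.cost j).den])).length = 2 * I.numSets := by
    rw [length_flatMap_eq (k := 2) (fun _ => rfl)]; simp [mul_comm]
  rw [inputList, description, List.append_assoc, List.append_assoc, List.append_assoc,
    show 4 + 2 * j = 3 + (2 * j + 1) by ring, getD_append_add (a := 3) rfl,
    List.getD_append _ _ _ _ (by omega)]
  have := getD_flatMap (f := fun j => [(I.cost j).num, (I.cost j).den]) (k := 2) (fun _ => rfl)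
    (List.finRange I.numSets) j (by simpa using hj) 1 (by norm_num)
  simpa [denCost, hj] using this

/-- The blocks have lengths 3, 2m, m·N and n, followed by the coins. The hypothesis `hr` says that
there are enough coins for the samples and for m digits per set. -/
theorem encodes {n r : ℕ} (hr : n + I.numSets * I.numSets ≤ r) (s : Fin n → Fin I.numElts)
    (ω : Fin r → Bool) :
    Encodes (fun i => (I.inputList s ω).getD i 0) I.numElts (I.toInstance n)
      (extend fun i => s i) (extend fun i => (ω i).toNat) := by
  set A := (List.finRange I.numSets).flatMap (fun j => [(I.cost j).num, (I.cost j).den]) with hA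
  set C := (List.finRange I.numSets).flatMap (fun j =>
        (List.finRange I.numElts).map fun u => if u ∈ I.sets j then 1 else 0) with hC
  set S := List.ofFn (fun i => (s i : ℕ)) with hS
  set W := List.ofFn (fun i => (ω i).toNat) with hW
  have hl : I.inputList s ω = [I.numElts, I.numSets, n] ++ (A ++ (C ++ (S ++ W))) := by
    simp [inputList, description, hA, hC, hS, hW]
  have hAl : A.length = 2 * I.numSets := by
    rw [hA, length_flatMap_eq (k := 2) (fun _ => rfl)]; simp [mul_comm]
  have hCl : C.length = I.numSets * I.numElts := by
    rw [hC, length_flatMap_eq (k := I.numElts) (fun _ => by simp)]; simp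
  have hSl : S.length = n := by simp [hS]
  have h3 : ∀ k, (I.inputList s ω).getD (3 + k) 0 = (A ++ (C ++ (S ++ W))).getD k 0 := by
    intro k; rw [hl, getD_append_add (a := 3) rfl]
  have hnum : ∀ j < I.numSets, (I.inputList s ω).getD (3 + 2 * j) 0 = I.numCost j := by
    intro j hj
    rw [h3, List.getD_append _ _ _ _ (by omega), hA]
    have := getD_flatMap (f := fun j => [(I.cost j).num, (I.cost j).den]) (k := 2) (fun _ => rfl)
      (List.finRange I.numSets) j (by simpa using hj) 0 (by norm_num)
    simpa [numCost, hj] using this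
  have hden := fun j hj => I.getD_inputList_den s ω (j := j) hj
  have hC' : ∀ k, (I.inputList s ω).getD (3 + 2 * I.numSets + k) 0 = (C ++ (S ++ W)).getD k 0 := by
    intro k; rw [add_assoc, h3, getD_append_add hAl]
  have hS' : ∀ k, (I.inputList s ω).getD (3 + 2 * I.numSets + (I.numSets * I.numElts + k)) 0 =
      (S ++ W).getD k 0 := by
    intro k; rw [hC', getD_append_add hCl]
  refine ⟨by rw [hl]; rfl, by rw [hl]; rfl, by rw [hl]; rfl, ?_, ?_, ?_, ?_, ?_, ?_,
    toInstance_valid n, fun u hu => exists_price n hu⟩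
  · intro j hj
    change j < I.numSets at hj
    have hprod : ∏ k ∈ Finset.range I.numSets, (I.inputList s ω).getD (4 + 2 * k) 0 =
      I.commonDen := Finset.prod_congr rfl fun k hk => hden k (Finset.mem_range.1 hk)
    change (I.inputList s ω).getD (3 + 2 * j) 0 *
      (∏ k ∈ Finset.range I.numSets, (I.inputList s ω).getD (4 + 2 * k) 0) /
      (I.inputList s ω).getD (4 + 2 * j) 0 = I.intCost j
    rw [hnum j hj, hden j hj, hprod, intCost]
  · intro j hj u hu
    change j < I.numSets at hj
    change (I.inputList s ω).getD (3 + 2 * I.numSets + (I.numElts * j + u)) 0 = I.incidence j u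
    have hlt : I.numElts * j + u < I.numSets * I.numElts := by nlinarith
    rw [hC', List.getD_append _ _ _ _ (by omega), hC]
    rw [getD_flatMap (k := I.numElts) (fun _ => by simp) (List.finRange I.numSets) j
      (by simpa using hj) u hu]
    simp [incidence, hj, hu]
  · intro i hi
    change i < n at hi
    change (I.inputList s ω).getD (3 + 2 * I.numSets + (I.numSets * I.numElts + i)) 0 = _
    rw [hS', List.getD_append _ _ _ _ (by omega), hS]
    simp [extend, hi]
  · intro i hi
    change i < n at hi
    simp [extend, hi]
  · intro k hk
    change k < n + I.numSets * I.numSets at hk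
    change (I.inputList s ω).getD (3 + 2 * I.numSets + (I.numSets * I.numElts + (n + k))) 0 = _
    rw [hS', getD_append_add hSl, hW]
    simp [extend, show k < r by omega]
  · intro k
    unfold extend; split
    · exact Bool.toNat_le _
    · omega

end SetSystem

/-! ### Polynomial bounds in the input size -/

theorem sum_flatMap {α : Type*} (l : List α) (f : α → List ℕ) :
    (l.flatMap f).sum = (l.map fun a => (f a).sum).sum := by
  induction l with
  | nil => rfl
  | cons a l ih => simp [ih]

namespace SetSystem

variable {I : SetSystem}

theorem size_eq (n : ℕ) : I.size n = (1 + I.numElts.size) + (1 + I.numSets.size) + (1 + n.size) +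
    ∑ j : Fin I.numSets, ((1 + (I.cost j).num.size) + (1 + (I.cost j).den.size)) +
    ∑ j : Fin I.numSets, ∑ u : Fin I.numElts, (1 + (if u ∈ I.sets j then 1 else 0 : ℕ).size) +
    n := by
  simp only [size, description, List.map_append, List.sum_append, List.map_flatMap, sum_flatMap,
    List.map_map, Fin.sum_univ_def, List.map_cons, List.map_nil, List.sum_cons, List.sum_nil]
  simp [Function.comp_def]
  omega

theorem numElts_eq_zero (h : I.numSets = 0) : I.numElts = 0 := by
  by_contra hne
  obtain ⟨j, -⟩ := I.covers ⟨0, by omega⟩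
  exact absurd j.2 (by omega)

theorem two_mul_numSets_le (n : ℕ) : 2 * I.numSets + n + 3 ≤ I.size n := by
  rw [size_eq]
  have h : ∑ _j : Fin I.numSets, 2 ≤
      ∑ j : Fin I.numSets, ((1 + (I.cost j).num.size) + (1 + (I.cost j).den.size)) :=
    Finset.sum_le_sum fun j _ => by omega
  simp only [Finset.sum_const, Finset.card_univ, Fintype.card_fin, smul_eq_mul] at h
  omega

/-- The incidence matrix has m·N entries. If m = 0, the sets can cover only an empty ground set. -/
theorem numElts_le (n : ℕ) : I.numElts ≤ I.size n := by
  rcases Nat.eq_zero_or_pos I.numSets with h0 | h0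
  · rw [numElts_eq_zero h0]; exact Nat.zero_le _
  rw [size_eq]
  have h : ∑ _j : Fin I.numSets, ∑ _u : Fin I.numElts, 1 ≤
      ∑ j : Fin I.numSets, ∑ u : Fin I.numElts, (1 + (if u ∈ I.sets j then 1 else 0 : ℕ).size) :=
    Finset.sum_le_sum fun j _ => Finset.sum_le_sum fun u _ => by omega
  simp only [Finset.sum_const, Finset.card_univ, Fintype.card_fin, smul_eq_mul, mul_one] at h
  have := Nat.le_mul_of_pos_left I.numElts h0
  omega

theorem size_num_add_le (n : ℕ) (j : Fin I.numSets) :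
    (I.cost j).num.size + ∑ k : Fin I.numSets, (I.cost k).den.size ≤ I.size n := by
  rw [size_eq]
  rw [Finset.sum_add_distrib, Finset.sum_add_distrib, Finset.sum_add_distrib]
  have := Finset.single_le_sum (f := fun j => (I.cost j).num.size) (fun _ _ => Nat.zero_le _)
    (Finset.mem_univ j)
  omega

theorem sum_size_den_le (n : ℕ) : ∑ k : Fin I.numSets, (I.cost k).den.size ≤ I.size n := by
  rw [size_eq]
  rw [Finset.sum_add_distrib, Finset.sum_add_distrib, Finset.sum_add_distrib]
  omega

theorem denCost_pos (j : ℕ) : 0 < I.denCost j := by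
  unfold denCost; split
  · exact NNRat.den_pos _
  · norm_num

/-- The bit lengths of the denominators add up to at most the input size. Partial products are below
the full one since denominators are positive. -/
theorem prod_denCost_le (n : ℕ) {k : ℕ} (hk : k ≤ I.numSets) :
    ∏ j ∈ Finset.range k, I.denCost j ≤ 2 ^ I.size n := by
  have h1 : ∏ j ∈ Finset.range k, I.denCost j ≤ I.commonDen :=
    Finset.prod_le_prod_of_subset_of_one_le' (by simpa using hk) fun j _ _ => denCost_pos j
  refine h1.trans ?_
  unfold commonDen
  rw [← Fin.prod_univ_eq_prod_range]
  calc ∏ j : Fin I.numSets, I.denCost j ≤ ∏ j : Fin I.numSets, 2 ^ (I.cost j).den.size :=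
        Finset.prod_le_prod' fun j _ => by
          simp only [denCost, j.2, dif_pos]; exact (Nat.lt_size_self _).le
    _ = 2 ^ ∑ j : Fin I.numSets, (I.cost j).den.size := Finset.prod_pow_eq_pow_sum _ _ _
    _ ≤ _ := Nat.pow_le_pow_right (by norm_num) (sum_size_den_le n)

theorem intCost_le (n : ℕ) {j : ℕ} (hj : j < I.numSets) : I.intCost j ≤ 2 ^ (2 * I.size n) := by
  refine (Nat.div_le_self _ _).trans ?_
  rw [two_mul, pow_add]
  refine Nat.mul_le_mul ?_ (prod_denCost_le n le_rfl)
  simp only [numCost, hj, dif_pos]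
  refine (Nat.lt_size_self _).le.trans (Nat.pow_le_pow_right (by norm_num) ?_)
  have := size_num_add_le n ⟨j, hj⟩
  omega

theorem sumCost_le (n : ℕ) : (I.toInstance n).sumCost ≤ 2 ^ (3 * I.size n) := by
  have h : (I.toInstance n).sumCost ≤ ∑ j ∈ Finset.range I.numSets, 2 ^ (2 * I.size n) :=
    Finset.sum_le_sum fun j hj => intCost_le n (Finset.mem_range.1 hj)
  refine h.trans ?_
  rw [Finset.sum_const, Finset.card_range, smul_eq_mul, show 3 * I.size n = I.size n + 2 * I.size n by
    ring, pow_add]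
  refine Nat.mul_le_mul_right _ ?_
  have := two_mul_numSets_le (I := I) n
  exact (show I.numSets ≤ I.size n by omega).trans Nat.lt_two_pow_self.le

/-- A polynomial bound for the number of mistakes. -/
noncomputable def mistakePoly : Polynomial ℕ :=
  (3 * Polynomial.X + 3) * (Polynomial.X * (4 * Polynomial.X + 1) + 1)

theorem eval_mistakePoly (k : ℕ) :
    mistakePoly.eval k = (3 * k + 3) * (k * (4 * k + 1) + 1) := by
  simp [mistakePoly]

/-- The number of phases is a bit length, and the integral costs sum to at most 2^(3·size), so
scaling by the common denominator is harmless. -/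
theorem stepBound_le (n : ℕ) :
    Learner.stepBound (I.toInstance n) ≤ mistakePoly.eval (I.size n) := by
  have h := two_mul_numSets_le (I := I) n
  have hsz : I.numSets.size ≤ I.numSets := Nat.size_le.2 Nat.lt_two_pow_self
  rw [eval_mistakePoly]
  refine Nat.mul_le_mul ?_ ?_
  · rw [Nat.size_le]
    have h1 := sumCost_le (I := I) n
    change 1 + 2 * (I.toInstance n).sumCost < _
    have h2 : 1 ≤ 2 ^ (3 * I.size n) := Nat.one_le_two_pow
    rw [pow_add]; omega
  · change n * (4 * I.numSets.size + 1) + 1 ≤ _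
    gcongr <;> omega

/-- A polynomial bound for the number of iterations of each loop. -/
noncomputable def loopPoly : Polynomial ℕ := mistakePoly + Polynomial.X + 3

/-- A polynomial bound for the number of bits of each cell. -/
noncomputable def bitPoly : Polynomial ℕ := mistakePoly + 6 * Polynomial.X + 10

theorem fits {n r : ℕ} (s : Fin n → Fin I.numElts) (ω : Fin r → Bool) :
    Fits (fun i => (I.inputList s ω).getD i 0) I.numElts (I.toInstance n)
      (loopPoly.eval (I.size n)) (bitPoly.eval (I.size n)) := by
  have hsz := two_mul_numSets_le (I := I) n
  have hN := numElts_le (I := I) n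
  have hstep := stepBound_le (I := I) n
  have hsum := sumCost_le (I := I) n
  have hL : loopPoly.eval (I.size n) = mistakePoly.eval (I.size n) + I.size n + 3 := by
    simp [loopPoly]
  have hB : bitPoly.eval (I.size n) = mistakePoly.eval (I.size n) + 6 * I.size n + 10 := by
    simp [bitPoly]
  rw [hL, hB]
  generalize mistakePoly.eval (I.size n) = F at *
  have hpow : 2 ^ I.size n ≤ 2 ^ (F + 6 * I.size n + 10) :=
    Nat.pow_le_pow_right (by norm_num) (by omega)
  have hx : ∀ i, (I.inputList s ω).getD i 0 < 2 ^ I.size n := by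
    intro i
    by_cases hi : i < (I.inputList s ω).length
    · rw [List.getD_eq_getElem _ _ hi]
      have hmem := List.getElem_mem hi
      generalize (I.inputList s ω)[i] = k at hmem
      simp only [inputList, List.mem_append, List.mem_ofFn] at hmem
      rcases hmem with (h | ⟨j, rfl⟩) | ⟨j, rfl⟩
      · rw [← Nat.size_le]
        have h1 : 1 + k.size ≤ ((I.description n).map fun k => 1 + k.size).sum :=
          List.single_le_sum (by simp) _ (List.mem_map_of_mem h)
        unfold size; omega
      · exact (s j).2.trans_le (hN.trans Nat.lt_two_pow_self.le)
      · exact (Bool.toNat_lt _).trans_le (by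
          calc 2 = 2 ^ 1 := rfl
            _ ≤ _ := Nat.pow_le_pow_right (by norm_num) (by omega))
    · rw [List.getD_eq_default _ _ (by omega)]; positivity
  refine ⟨fun i => (hx i).trans_le hpow, ?_, ?_, by omega, by omega, by omega,
    Nat.lt_two_pow_self.trans_le (Nat.pow_le_pow_right (by norm_num) (by omega)), ?_, ?_⟩
  · change I.numSets ≤ _; omega
  · change n ≤ _; omega
  · intro k hk
    change k ≤ I.numSets at hk
    rw [Finset.prod_congr rfl fun j hj => I.getD_inputList_den s ω
      ((Finset.mem_range.1 hj).trans_le hk)]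
    exact (prod_denCost_le n hk).trans_lt (Nat.pow_lt_pow_right (by norm_num) (by omega))
  · change (2 * (I.toInstance n).sumCost + 2) * (8 * I.numSets + 8) * (16 * n + 16) *
      2 ^ (Learner.stepBound (I.toInstance n) + I.numSets) < _
    have h0 : 1 ≤ 2 ^ (3 * I.size n) := Nat.one_le_two_pow
    have h1 : 2 * (I.toInstance n).sumCost + 2 ≤ 2 ^ (3 * I.size n + 2) := by rw [pow_add]; omega
    have hs : I.size n < 2 ^ I.size n := Nat.lt_two_pow_self
    have h2 : 8 * I.numSets + 8 ≤ 2 ^ (I.size n + 3) := by rw [pow_add]; omega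
    have h3 : 16 * n + 16 ≤ 2 ^ (I.size n + 4) := by rw [pow_add]; omega
    have h4 : 2 ^ (Learner.stepBound (I.toInstance n) + I.numSets) ≤ 2 ^ (F + I.size n) :=
      Nat.pow_le_pow_right (by norm_num) (by omega)
    -- The exponents add up to F + 6·size + 9, one less than `bitPoly`.
    refine (Nat.mul_le_mul (Nat.mul_le_mul (Nat.mul_le_mul h1 h2) h3) h4).trans_lt ?_
    rw [← pow_add, ← pow_add, ← pow_add]
    exact Nat.pow_lt_pow_right (by norm_num) (by omega)

/-- The number of coins. -/
noncomputable def coinPoly : Polynomial ℕ := Polynomial.X + Polynomial.X * Polynomial.X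

theorem le_coinPoly (n : ℕ) : n + I.numSets * I.numSets ≤ coinPoly.eval (I.size n) := by
  have h := two_mul_numSets_le (I := I) n
  simp only [coinPoly, Polynomial.eval_add, Polynomial.eval_mul, Polynomial.eval_X]
  gcongr <;> omega

/-- A polynomial bound for the running time. -/
noncomputable def timePoly : Polynomial ℕ := (Prog.main.poly.comp loopPoly) * (bitPoly + 1)

/-- The sets which the algorithm buys in advance. -/
noncomputable def bought {n r : ℕ} (s : Fin n → Fin I.numElts) (ω : Fin r → Bool) : ℕ → ℕ :=
  purchases (I.toInstance n) (extend fun i => s i) (extend fun i => (ω i).toNat)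

/-- The algorithm outputs a universal map, in polynomial time. -/
theorem exists_outputs {n r : ℕ} (hr : n + I.numSets * I.numSets ≤ r) (s : Fin n → Fin I.numElts)
    (ω : Fin r → Bool) : ∃ S : Fin I.numElts → Fin I.numSets,
      I.Outputs Prog.main s ω (timePoly.eval (I.size n)) S ∧
      ∀ u : Fin I.numElts, IsChoice (I.toInstance n) (I.bought s ω) u (S u) := by
  obtain ⟨t, M, h1, h2, -, h4⟩ := WP.main (fits s ω) (encodes hr s ω)
  refine ⟨fun u => ⟨M (M 0 + u), (h4 u u.2).1⟩, ⟨t, M, h1, ?_, fun u => rfl⟩, fun u => h4 u u.2⟩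
  simpa [timePoly] using h2

end SetSystem

/-! ## Expectations -/

section Expect

variable {n N : ℕ} (D : Fin n → PMF (Fin N)) {f g : (Fin n → Fin N) → ℝ}

/-- The probability of a vector of requests. -/
noncomputable def weight (v : Fin n → Fin N) : ℝ := ∏ i, (D i (v i)).toReal

theorem expect_eq (f : (Fin n → Fin N) → ℝ) : expect D f = ∑ v, weight D v * f v := rfl

theorem weight_nonneg (v : Fin n → Fin N) : 0 ≤ weight D v :=
  Finset.prod_nonneg fun _ _ => ENNReal.toReal_nonneg

theorem sum_weight : ∑ v, weight D v = 1 := by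
  have h : ∀ i, ∑ u, (D i u).toReal = 1 := fun i => by
    have := (D i).tsum_coe
    rw [tsum_fintype] at this
    rw [← ENNReal.toReal_sum fun u _ => (D i).apply_ne_top u, this]
    rfl
  have := Finset.prod_univ_sum (fun _ : Fin n => (Finset.univ : Finset (Fin N)))
    (fun i u => (D i u).toReal)
  rw [Fintype.piFinset_univ] at this
  unfold weight
  rw [← this]
  simp [h]

theorem expect_mono (h : ∀ v, f v ≤ g v) : expect D f ≤ expect D g :=
  Finset.sum_le_sum fun v _ => mul_le_mul_of_nonneg_left (h v) (weight_nonneg D v)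

theorem expect_const (c : ℝ) : expect D (fun _ => c) = c := by
  rw [expect_eq, ← Finset.sum_mul, sum_weight, one_mul]

theorem expect_add : expect D (fun v => f v + g v) = expect D f + expect D g := by
  simp only [expect_eq, mul_add, Finset.sum_add_distrib]

theorem expect_mul_left (c : ℝ) : expect D (fun v => c * f v) = c * expect D f := by
  simp only [expect_eq, Finset.mul_sum]
  exact Finset.sum_congr rfl fun v _ => by ring

theorem expect_sum {ι : Type*} (s : Finset ι) (f : ι → (Fin n → Fin N) → ℝ) :
    expect D (fun v => ∑ i ∈ s, f i v) = ∑ i ∈ s, expect D (f i) := by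
  simp only [expect_eq, Finset.mul_sum]
  exact Finset.sum_comm

theorem expect_expect {ι : Type*} [Fintype ι] (f : ι → (Fin n → Fin N) → ℝ) :
    expect D (fun v => 𝔼 i, f i v) = 𝔼 i, expect D (f i) := by
  simp only [Fintype.expect_eq_sum_div_card, div_eq_inv_mul, expect_mul_left, expect_sum]

/-- Exchanging a sample with a request from the same distribution. -/
theorem expect_resample (i : Fin n) (h : (Fin n → Fin N) → Fin N → ℝ)
    (hh : ∀ s u u', h (Function.update s i u) u' = h s u') :
    expect D (fun s => expect D fun v => h s (v i)) = expect D fun s => h s (s i) := by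
  -- Swapping the i-th coordinates of samples and requests preserves the product measure, as both
  -- have law D i, and h does not see the i-th sample.
  have hinv : Function.Involutive (fun p : (Fin n → Fin N) × (Fin n → Fin N) =>
      (Function.update p.1 i (p.2 i), Function.update p.2 i (p.1 i))) := fun p => by simp
  have hw : ∀ s v : Fin n → Fin N, weight D (Function.update s i (v i)) *
      weight D (Function.update v i (s i)) = weight D s * weight D v := by
    intro s v
    unfold weight
    rw [← Finset.prod_mul_distrib, ← Finset.prod_mul_distrib]
    refine Finset.prod_congr rfl fun k _ => ?_
    by_cases hk : k = i
    · subst hk; simp [mul_comm]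
    · simp [Function.update_of_ne hk]
  have h1 : expect D (fun s => expect D fun v => h s (v i)) =
      ∑ p : (Fin n → Fin N) × (Fin n → Fin N), weight D p.1 * weight D p.2 * h p.1 (p.2 i) := by
    simp only [expect_eq, Finset.mul_sum, Fintype.sum_prod_type, mul_assoc]
  have h2 : expect D (fun s => expect D fun _ => h s (s i)) =
      ∑ p : (Fin n → Fin N) × (Fin n → Fin N), weight D p.1 * weight D p.2 * h p.1 (p.1 i) := by
    simp only [expect_eq, Finset.mul_sum, Fintype.sum_prod_type, mul_assoc]
  simp only [expect_const] at h2
  rw [h1, h2]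
  refine Fintype.sum_equiv hinv.toPerm _ _ fun p => ?_
  simp only [Function.Involutive.coe_toPerm, hw, hh, Function.update_self]

end Expect

/-! ### Fair and independent coins -/

theorem coinExpect_eq {r : ℕ} (f : (Fin r → Bool) → ℝ) : coinExpect f = 𝔼 ω, f ω := by
  rw [Fintype.expect_eq_sum_div_card, coinExpect]
  simp

section Coins

variable {ι κ : Type*} [Fintype ι] [Fintype κ] [DecidableEq ι] [DecidableEq κ]

theorem expect_prod_type {α β : Type*} [Fintype α] [Fintype β] (f : α × β → ℝ) :
    𝔼 p, f p = 𝔼 a, 𝔼 b, f (a, b) := by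
  simp only [Fintype.expect_eq_sum_div_card, Fintype.sum_prod_type, Fintype.card_prod,
    ← Finset.sum_div, Nat.cast_mul]
  rw [div_div, mul_comm]

/-- The coins with indices in the range of `e` are fair and independent. -/
theorem expect_comp {e : ι → κ} (he : Function.Injective e) (f : (ι → Bool) → ℝ) :
    𝔼 ω : κ → Bool, f (ω ∘ e) = 𝔼 α, f α := by
  classical
  -- Separate the coins in the range of e from the others, which are then averaged out.
  let E := Equiv.piEquivPiSubtypeProd (fun k => k ∈ Set.range e) (fun _ : κ => Bool)
  let F : ({k // k ∈ Set.range e} → Bool) ≃ (ι → Bool) :=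
    Equiv.arrowCongr (Equiv.ofInjective e he).symm (Equiv.refl Bool)
  have h1 : 𝔼 ω : κ → Bool, f (ω ∘ e) =
      𝔼 p : ({k // k ∈ Set.range e} → Bool) × ({k // k ∉ Set.range e} → Bool), f (F p.1) :=
    Fintype.expect_equiv E _ _ fun ω => rfl
  rw [h1, expect_prod_type]
  simp only [Fintype.expect_const]
  exact Fintype.expect_equiv F _ _ fun _ => rfl

theorem expect_pi_prod {X : Type*} [Fintype X] (h : ι → X → ℝ) :
    𝔼 ρ : ι → X, ∏ j, h j (ρ j) = ∏ j, 𝔼 x, h j x := by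
  simp only [Fintype.expect_eq_sum_div_card, Finset.prod_div_distrib]
  have := Finset.prod_univ_sum (fun _ : ι => (Finset.univ : Finset X)) h
  rw [Fintype.piFinset_univ] at this
  rw [← this]
  simp

/-- Product formula with the factor 1 at every coordinate other than j. -/
theorem expect_pi_apply {X : Type*} [Fintype X] [Nonempty X] (j : ι) (h : X → ℝ) :
    𝔼 ρ : ι → X, h (ρ j) = 𝔼 x, h x := by
  have := expect_pi_prod (fun (k : ι) (x : X) => if k = j then h x else 1)
  simp only [Finset.prod_ite_eq', Finset.mem_univ, if_true] at this
  rw [this, Finset.prod_eq_single j]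
  · simp
  · intro k _ hk; simp [hk]
  · simp

/-- The expectation does not change when a coin is flipped. -/
theorem expect_flip (i : ι) (f : (ι → Bool) → ℝ) :
    𝔼 α, f (Function.update α i (!α i)) = 𝔼 α, f α := by
  have hinv : Function.Involutive (fun α : ι → Bool => Function.update α i (!α i)) := fun α => by
    simp
  exact Fintype.expect_equiv hinv.toPerm _ _ fun _ => rfl

end Coins

/-! ### Threshold rounding with uniform binary numbers -/

theorem binary_congr {f g : ℕ → ℕ} {k : ℕ} (h : ∀ i < k, f i = g i) : binary f k = binary g k := by
  induction k with
  | zero => rfl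
  | succ k ih => rw [binary, binary, ih fun i hi => h i (by omega), h k (by omega)]

theorem binary_inj {f g : ℕ → ℕ} (hf : ∀ i, f i ≤ 1) (hg : ∀ i, g i ≤ 1) {k : ℕ}
    (h : binary f k = binary g k) : ∀ i < k, f i = g i := by
  induction k with
  | zero => simp
  | succ k ih =>
    rw [binary, binary] at h
    have h1 := hf k
    have h2 := hg k
    intro i hi
    rcases Nat.lt_succ_iff_lt_or_eq.1 hi with h3 | rfl
    · exact ih (by omega) i h3
    · omega

/-- The number with the binary digits `x`. -/
def bitsVal {m : ℕ} (x : Fin m → Bool) : ℕ := binary (SetSystem.extend fun i => (x i).toNat) m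

theorem extend_toNat_le {m : ℕ} (x : Fin m → Bool) (i : ℕ) :
    SetSystem.extend (fun i => (x i).toNat) i ≤ 1 := by
  unfold SetSystem.extend; split
  · exact Bool.toNat_le _
  · omega

theorem bitsVal_lt {m : ℕ} (x : Fin m → Bool) : bitsVal x < 2 ^ m := binary_lt (extend_toNat_le x) m

/-- A random number with `m` binary digits is uniformly distributed. -/
theorem expect_bitsVal {m : ℕ} (F : ℕ → ℝ) :
    𝔼 x : Fin m → Bool, F (bitsVal x) = (∑ z ∈ Finset.range (2 ^ m), F z) / 2 ^ m := by
  have hinj : Function.Injective (fun x : Fin m → Bool => (⟨bitsVal x, bitsVal_lt x⟩ : Fin (2 ^ m))) := by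
    intro x y hxy
    have h := binary_inj (extend_toNat_le x) (extend_toNat_le y) (Fin.mk.inj hxy)
    ext i
    have := h i i.2
    simp only [SetSystem.extend, i.2, dif_pos] at this
    cases hx : x i <;> cases hy : y i <;> simp_all
  have hbij := (Fintype.bijective_iff_injective_and_card _).2 ⟨hinj, by simp⟩
  rw [Fintype.expect_eq_sum_div_card, ← Fin.sum_univ_eq_sum_range]
  congr 1
  · exact Fintype.sum_bijective _ hbij _ _ fun _ => rfl
  · simp

/-- The probability that a random number selects a set with the fractional value `y / W`. -/
theorem expect_select_le {m a y W : ℕ} (hW : 0 < W) :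
    𝔼 x : Fin m → Bool, (if bitsVal x * W < 2 ^ m * a * y then (1 : ℝ) else 0) ≤
      a * y / W + (if y = 0 then 0 else 1) / 2 ^ m := by
  rw [expect_bitsVal (fun z => if z * W < 2 ^ m * a * y then (1 : ℝ) else 0)]
  have hW' : (0 : ℝ) < W := by exact_mod_cast hW
  by_cases hy : y = 0
  · simp [hy]
  rw [if_neg hy, Finset.sum_boole, div_le_iff₀ (by positivity), add_mul,
    div_mul_cancel₀ _ (by positivity)]
  -- Counting integers up to a quotient gives its floor plus one; this one is the error 2^(-m), and
  -- it is absent for y = 0.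
  have h1 : (Finset.range (2 ^ m)).filter (fun z => z * W < 2 ^ m * a * y) ⊆
      Finset.range (2 ^ m * a * y / W + 1) := by
    intro z hz
    rw [Finset.mem_filter] at hz
    rw [Finset.mem_range, Nat.lt_succ_iff, Nat.le_div_iff_mul_le hW]
    exact hz.2.le
  have h2 := Finset.card_le_card h1
  rw [Finset.card_range] at h2
  have h3 : (((Finset.range (2 ^ m)).filter (fun z => z * W < 2 ^ m * a * y)).card : ℝ) ≤
      ((2 ^ m * a * y / W : ℕ) : ℝ) + 1 := by exact_mod_cast h2
  refine h3.trans ?_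
  have h4 := Nat.cast_div_le (α := ℝ) (m := 2 ^ m * a * y) (n := W)
  push_cast at h4 ⊢
  have h5 : (a * y / W * 2 ^ m : ℝ) = 2 ^ m * a * y / W := by ring
  linarith

/-- If a y ≥ W, every threshold selects. Otherwise the non-selecting ones start at ⌈2^m a y / W⌉, so
their share is at most 1 − a y / W ≤ exp(−a y / W). Here discretisation only helps. -/
theorem expect_not_select_le {m a y W : ℕ} (hW : 0 < W) :
    𝔼 x : Fin m → Bool, (if bitsVal x * W < 2 ^ m * a * y then (0 : ℝ) else 1) ≤
      Real.exp (-(a * y / W)) := by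
  rw [expect_bitsVal (fun z => if z * W < 2 ^ m * a * y then (0 : ℝ) else 1)]
  have hW' : (0 : ℝ) < W := by exact_mod_cast hW
  by_cases h : W ≤ a * y
  · rw [Finset.sum_eq_zero]
    · rw [zero_div]; positivity
    · intro z hz
      have hz' := Finset.mem_range.1 hz
      rw [if_pos]
      rw [mul_assoc]
      calc z * W < 2 ^ m * W := Nat.mul_lt_mul_of_pos_right hz' hW
        _ ≤ _ := Nat.mul_le_mul_left _ h
  · have h0 : (a * y / W : ℝ) ≤ 1 := by
      rw [div_le_one hW']; exact_mod_cast (not_le.1 h).le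
    have hsum : ∀ z, (if z * W < 2 ^ m * a * y then (0 : ℝ) else 1) =
        if ¬ z * W < 2 ^ m * a * y then 1 else 0 := fun z => by split <;> simp_all
    simp only [hsum]
    rw [Finset.sum_boole, div_le_iff₀ (by positivity)]
    have h1 : (Finset.range (2 ^ m)).filter (fun z => ¬ z * W < 2 ^ m * a * y) ⊆
        Finset.Ico ((2 ^ m * a * y) ⌈/⌉ W) (2 ^ m) := by
      intro z hz
      rw [Finset.mem_filter, Finset.mem_range, not_lt] at hz
      rw [Finset.mem_Ico]
      refine ⟨?_, hz.1⟩
      rw [ceilDiv_le_iff_le_mul hW]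
      exact hz.2.trans_eq (mul_comm _ _)
    have h2 := Finset.card_le_card h1
    rw [Nat.card_Ico] at h2
    have h3 : ((2 ^ m * a * y : ℕ) : ℝ) / W ≤ ((2 ^ m * a * y) ⌈/⌉ W : ℕ) := by
      rw [div_le_iff₀ hW']
      have := le_smul_ceilDiv (a := W) (b := 2 ^ m * a * y) hW
      rw [smul_eq_mul] at this
      exact_mod_cast this.trans_eq (mul_comm _ _)
    have h5 : (2 ^ m * a * y) ⌈/⌉ W ≤ 2 ^ m := by
      rw [ceilDiv_le_iff_le_mul hW, mul_assoc, mul_comm W]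
      exact Nat.mul_le_mul_left _ (not_le.1 h).le
    have h4 : (((Finset.range (2 ^ m)).filter (fun z => ¬ z * W < 2 ^ m * a * y)).card : ℝ) ≤
        2 ^ m - ((2 ^ m * a * y) ⌈/⌉ W : ℕ) := by
      have h6 : (((2 ^ m - (2 ^ m * a * y) ⌈/⌉ W : ℕ)) : ℝ) =
          2 ^ m - ((2 ^ m * a * y) ⌈/⌉ W : ℕ) := by
        rw [Nat.cast_sub h5]; push_cast; ring
      rw [← h6]; exact_mod_cast h2
    have h7 := Real.add_one_le_exp (-(a * y / W : ℝ))
    have h8 : ((2 ^ m * a * y : ℕ) : ℝ) / W = a * y / W * 2 ^ m := by push_cast; ring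
    have h9 : (0 : ℝ) < 2 ^ m := by positivity
    nlinarith

/-! ### Locality of the learner -/

namespace Learner

variable {I : Instance} {act act' : ℕ → Bool} {smp smp' : ℕ → ℕ}

theorem find?_congr {l : List ℕ} {p q : ℕ → Bool} (h : ∀ i ∈ l, p i = q i) :
    l.find? p = l.find? q := by
  induction l with
  | nil => rfl
  | cons a l ih =>
    rw [List.find?_cons, List.find?_cons, h a List.mem_cons_self,
      ih fun i hi => h i (List.mem_cons_of_mem _ hi)]

/-- The learner depends on the active samples only. -/
theorem final_congr (ha : ∀ i < I.n, act' i = act i)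
    (hs : ∀ i < I.n, act i = true → smp' i = smp i) : final I act' smp' = final I act smp := by
  have hpick : ∀ s : Learner, s.pick I act' smp' = s.pick I act smp := by
    intro s
    refine find?_congr fun i hi => ?_
    have hi' : i < I.n := by simpa using hi
    rw [ha i hi']
    cases h : act i with
    | false => rfl
    | true => rw [hs i hi' h]
  have hstep : ∀ s : Learner, s.step I act' smp' = s.step I act smp := by
    intro s
    rw [step, step, hpick]
    split
    · rfl
    · next i hi =>
      obtain ⟨h1, h2, -⟩ := pick_some hi
      rw [hs i h1 h2]
  have hrun : ∀ t, run I act' smp' t = run I act smp t := by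
    intro t
    induction t with
    | zero => rfl
    | succ t ih => rw [run_succ, run_succ, ih, hstep]
  exact hrun _

end Learner

/-! ### The integral instance and its optimum -/

namespace SetSystem

variable {I : SetSystem} {n : ℕ}

theorem commonDen_pos : 0 < I.commonDen := Finset.prod_pos fun j _ => denCost_pos j

/-- Each denominator divides the common one, so the division in `intCost` is exact. -/
theorem intCost_eq (j : Fin I.numSets) : (I.intCost j : ℝ) = I.commonDen * I.cost j := by
  have h1 : I.denCost j ∣ I.commonDen := Finset.dvd_prod_of_mem _ (Finset.mem_range.2 j.2)
  have hd : (I.denCost j : ℝ) ≠ 0 := by exact_mod_cast (denCost_pos (I := I) j).ne'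
  have h2 : I.denCost j = (I.cost j).den := by simp [denCost]
  have h3 : I.numCost j = (I.cost j).num := by simp [numCost]
  have h4 : (I.cost j : ℝ) = (I.cost j).num / (I.cost j).den := by
    rw [NNRat.cast_def]
  rw [intCost, Nat.cast_div (h1.mul_left _) hd, h4, h2, h3]
  push_cast
  ring

theorem commonDen_mul_costOf (T : Finset (Fin I.numSets)) :
    I.commonDen * I.costOf T = ((∑ j ∈ T, I.intCost j : ℕ) : ℝ) := by
  rw [costOf, Finset.mul_sum]
  push_cast
  exact Finset.sum_congr rfl fun j _ => (intCost_eq j).symm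

theorem exists_opt (v : Fin n → Fin I.numElts) : ∃ T, I.Covers T v ∧ I.costOf T = I.opt v := by
  have hfin : {x : ℝ | ∃ T : Finset (Fin I.numSets), I.Covers T v ∧ I.costOf T = x}.Finite :=
    (Set.finite_range I.costOf).subset fun x ⟨T, _, h⟩ => ⟨T, h⟩
  have hne : {x : ℝ | ∃ T : Finset (Fin I.numSets), I.Covers T v ∧ I.costOf T = x}.Nonempty :=
    ⟨_, Finset.univ, fun i => by
      obtain ⟨j, hj⟩ := I.covers (v i)
      exact ⟨j, Finset.mem_univ _, hj⟩, rfl⟩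
  exact hne.csInf_mem hfin

theorem incidence_eq_one {j : Fin I.numSets} {u : Fin I.numElts} :
    I.incidence j u = 1 ↔ u ∈ I.sets j := by
  simp [incidence]

/-- An optimal cover in the instance with integral costs. -/
theorem exists_opt_nat (v : Fin n → Fin I.numElts) : ∃ T : Finset ℕ,
    (∀ act, Learner.Covering (I.toInstance n) act (extend fun i => v i) T) ∧
    ((∑ j ∈ T, (I.toInstance n).c j : ℕ) : ℝ) = I.commonDen * I.opt v := by
  obtain ⟨T, hT, hc⟩ := I.exists_opt v
  refine ⟨T.map Fin.valEmbedding, fun act => ⟨fun j hj => ?_, fun i hi _ => ?_⟩, ?_⟩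
  · obtain ⟨k, -, rfl⟩ := Finset.mem_map.1 hj
    exact Finset.mem_range.2 k.2
  · change i < n at hi
    obtain ⟨j, hj, hju⟩ := hT ⟨i, hi⟩
    refine ⟨j, Finset.mem_map_of_mem Fin.valEmbedding hj, ?_⟩
    simp only [extend, hi, dif_pos]
    exact incidence_eq_one.2 hju
  · rw [← hc, commonDen_mul_costOf, Finset.sum_map]
    rfl

/-- An optimal cover contains some set with v i in it, and the price is a lower bound for the cost
of that set. -/
theorem price_le_opt (v : Fin n → Fin I.numElts) (i : Fin n) :
    ((I.toInstance n).price (v i) : ℝ) ≤ I.commonDen * I.opt v := by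
  obtain ⟨T, hT, hc⟩ := exists_opt_nat v
  rw [← hc]
  obtain ⟨j, hj, hju⟩ := (hT fun _ => true).cov i i.2 rfl
  simp only [extend, i.2, dif_pos] at hju
  have hjm := Finset.mem_range.1 ((hT fun _ => true).sub hj)
  exact_mod_cast ((toInstance_valid n).price_le j hjm _ hju).trans
    (Finset.single_le_sum (f := (I.toInstance n).c) (fun _ _ => Nat.zero_le _) hj)

/-! ### Expected loss on requests with unused samples -/

/-- The state of the learner after learning from the samples whose coin is `b`. -/
noncomputable def learned (s : Fin n → Fin I.numElts) (α : Fin n → Bool) (b : ℕ) : Learner :=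
  Learner.final (I.toInstance n) (active (extend fun i => (α i).toNat) b) (extend fun i => s i)

theorem covering_univ (s : Fin n → Fin I.numElts) (act : ℕ → Bool) :
    Learner.Covering (I.toInstance n) act (extend fun i => s i)
      (Finset.range (I.toInstance n).m) where
  sub := subset_rfl
  cov i hi _ := by
    obtain ⟨j, hj, hju⟩ := I.exists_incidence (s ⟨i, hi⟩).2
    refine ⟨j, Finset.mem_range.2 hj, ?_⟩
    simp only [extend, show i < n from hi, dif_pos]
    exact hju

theorem beta_learned_le (s : Fin n → Fin I.numElts) (α : Fin n → Bool) (b : ℕ) :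
    ((I.learned s α b).beta : ℝ) ≤ 2 * (I.commonDen * I.opt s) := by
  obtain ⟨T, hT, hc⟩ := exists_opt_nat s
  rw [← hc]
  exact_mod_cast Learner.beta_le_two_mul (toInstance_valid n) (hT _) _

/-- The run `b` of the learner uses the sample `i`. -/
def Uses (α : Fin n → Bool) (b : ℕ) (i : Fin n) : Prop := ((α i).toNat + b) % 2 = 0

instance (α : Fin n → Bool) (b : ℕ) (i : Fin n) : Decidable (Uses α b i) :=
  inferInstanceAs (Decidable (_ = _))

theorem active_eq (α : Fin n → Bool) (b : ℕ) (i : Fin n) :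
    active (extend fun i => (α i).toNat) b i = decide (Uses α b i) := by
  unfold active
  exact decide_eq_decide.2 (by simp [extend, Uses])

theorem uses_flip (α : Fin n → Bool) (b : ℕ) (i : Fin n) :
    Uses (Function.update α i (!α i)) b i ↔ ¬ Uses α b i := by
  unfold Uses
  rw [Function.update_self]
  cases α i <;> simp <;> omega

theorem uses_update (α : Fin n → Bool) (b : ℕ) {i k : Fin n} (h : k ≠ i) (a : Bool) :
    Uses (Function.update α i a) b k ↔ Uses α b k := by
  unfold Uses
  rw [Function.update_of_ne h]

/-- The learner does not depend on the samples which it does not use. -/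
theorem learned_update (s : Fin n → Fin I.numElts) {α : Fin n → Bool} {b : ℕ} {i : Fin n}
    (h : ¬ Uses α b i) (u : Fin I.numElts) :
    I.learned (Function.update s i u) α b = I.learned s α b := by
  refine Learner.final_congr (fun _ _ => rfl) fun k hk hak => ?_
  change k < n at hk
  have h1 := active_eq α b ⟨k, hk⟩
  simp only at h1
  rw [h1, decide_eq_true_eq] at hak
  have hne : (⟨k, hk⟩ : Fin n) ≠ i := fun h2 => h (h2 ▸ hak)
  simp [extend, hk, Function.update_of_ne hne]

/-- Leaving each used sample out in turn, the learner has a small total loss. -/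
theorem sum_loss_flip_le (s : Fin n → Fin I.numElts) (α : Fin n → Bool) (b : ℕ) :
    (∑ i : Fin n, if Uses α b i then
      ((I.learned s (Function.update α i (!α i)) b).loss (I.toInstance n) (s i) : ℝ) else 0) ≤
      (16 * I.numSets.size + 6) * (I.commonDen * I.opt s) := by
  classical
  obtain ⟨T, hT, hc⟩ := exists_opt_nat s
  rw [← hc]
  set act := active (extend fun i => (α i).toNat) b with hact
  have h := Learner.sum_loss_le (toInstance_valid n) (covering_univ s act) (hT act)
    (fun i k => if k = i then false else act k) (fun i k hk => by simp [hk]) (fun i => by simp)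
  have h1 : ((∑ i ∈ (Finset.range n).filter (fun i => act i = true),
      (Learner.final (I.toInstance n) (fun k => if k = i then false else act k)
        (extend fun i => s i)).loss (I.toInstance n) (extend (fun i => s i) i) : ℕ) : ℝ) =
      ∑ i : Fin n, if Uses α b i then
      ((I.learned s (Function.update α i (!α i)) b).loss (I.toInstance n) (s i) : ℝ) else 0 := by
    rw [Finset.sum_filter, ← Fin.sum_univ_eq_sum_range (fun i => if act i = true then
      (Learner.final (I.toInstance n) (fun k => if k = i then false else act k)
        (extend fun i => s i)).loss (I.toInstance n) (extend (fun i => s i) i) else 0)]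
    push_cast
    refine Finset.sum_congr rfl fun i _ => ?_
    have h2 : act i = decide (Uses α b i) := active_eq α b i
    by_cases hu : Uses α b i
    · rw [if_pos hu, if_pos (by rw [h2]; simpa using hu)]
      have h3 : extend (fun i => (s i : ℕ)) i = s i := by simp [extend]
      rw [h3, learned]
      congr 2
      -- For a used sample i, flipping its coin deactivates i and nothing else, which is the same as
      -- leaving i out.
      refine Learner.final_congr (fun k hk => ?_) fun _ _ _ => rfl
      change k < n at hk
      have h4 := active_eq (Function.update α i (!α i)) b ⟨k, hk⟩
      have h5 := active_eq α b ⟨k, hk⟩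
      simp only at h4 h5
      rw [h4]
      by_cases hki : k = i
      · rw [if_pos hki, eq_comm, decide_eq_false_iff_not]
        have : (⟨k, hk⟩ : Fin n) = i := Fin.ext hki
        rw [this, uses_flip]
        simpa using hu
      · rw [if_neg hki, hact, h5, decide_eq_decide]
        exact (uses_update α b (fun h => hki (congrArg Fin.val h)) _).symm
    · rw [if_neg hu, if_neg (by rw [h2]; simpa using hu)]
  rw [← h1]
  exact_mod_cast h

/-- The expected loss on requests whose samples have not been used. -/
theorem expect_loss_le (D : Fin n → PMF (Fin I.numElts)) (b : ℕ) :
    expect D (fun s => expect D fun v => 𝔼 α : Fin n → Bool, ∑ i : Fin n,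
      if Uses α b i then 0 else ((I.learned s α b).loss (I.toInstance n) (v i) : ℝ)) ≤
      (16 * I.numSets.size + 6) * (I.commonDen * expect D I.opt) := by
  -- If run b does not use sample i, its state is independent of that sample, so the request v i may
  -- be replaced by s i.
  have h1 : expect D (fun s => expect D fun v => 𝔼 α : Fin n → Bool, ∑ i : Fin n,
      if Uses α b i then 0 else ((I.learned s α b).loss (I.toInstance n) (v i) : ℝ)) =
      expect D (fun s => 𝔼 α : Fin n → Bool, ∑ i : Fin n,
      if Uses α b i then 0 else ((I.learned s α b).loss (I.toInstance n) (s i) : ℝ)) := by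
    simp only [expect_expect, expect_sum]
    refine Finset.expect_congr rfl fun α _ => Finset.sum_congr rfl fun i _ => ?_
    by_cases hu : Uses α b i
    · simp only [if_pos hu, expect_const]
    · simp only [if_neg hu]
      exact expect_resample D i (fun s u => ((I.learned s α b).loss (I.toInstance n) u : ℝ))
        fun s u u' => by rw [learned_update s hu]
  have h2 : ∀ s : Fin n → Fin I.numElts, (𝔼 α : Fin n → Bool, ∑ i : Fin n,
      if Uses α b i then 0 else ((I.learned s α b).loss (I.toInstance n) (s i) : ℝ)) ≤
      (16 * I.numSets.size + 6) * (I.commonDen * I.opt s) := by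
    intro s
    -- Flipping coin i preserves the measure and turns "unused by α" into "used by α, but the
    -- learner is trained without it".
    have h3 : (𝔼 α : Fin n → Bool, ∑ i : Fin n,
        if Uses α b i then 0 else ((I.learned s α b).loss (I.toInstance n) (s i) : ℝ)) =
        𝔼 α : Fin n → Bool, ∑ i : Fin n, if Uses α b i then
        ((I.learned s (Function.update α i (!α i)) b).loss (I.toInstance n) (s i) : ℝ) else 0 := by
      rw [Finset.expect_sum_comm, Finset.expect_sum_comm]
      refine Finset.sum_congr rfl fun i _ => ?_
      rw [← expect_flip i]
      refine Finset.expect_congr rfl fun α _ => ?_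
      by_cases hu : Uses α b i
      · rw [if_pos hu, if_neg ((uses_flip α b i).not.2 (not_not.2 hu))]
      · rw [if_neg hu, if_pos ((uses_flip α b i).2 hu)]
    rw [h3]
    exact Finset.expect_le Finset.univ_nonempty fun α _ => sum_loss_flip_le s α b
  rw [h1]
  refine (expect_mono D h2).trans (le_of_eq ?_)
  rw [expect_mul_left, expect_mul_left]

/-! ### Cost and coverage of the rounded solutions -/

/-- The digits `x` let the set `j` be bought according to the state `l` of the learner. -/
def Selects (I : SetSystem) (n : ℕ) (l : Learner) (x : Fin I.numSets → Bool) (j : ℕ) : Prop :=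
  bitsVal x * l.total (I.toInstance n) <
    2 ^ I.numSets * (8 * n.size) * l.frac (I.toInstance n) j

noncomputable instance (l : Learner) (x : Fin I.numSets → Bool) (j : ℕ) : Decidable (Selects I n l x j) :=
  inferInstanceAs (Decidable (_ < _))

theorem total_learned_pos (hn : 0 < n) (hm : 0 < I.numSets) (s : Fin n → Fin I.numElts)
    (α : Fin n → Bool) (b : ℕ) : 0 < (I.learned s α b).total (I.toInstance n) := by
  have h := (Learner.run_inv (toInstance_valid n) (covering_univ s
    (active (extend fun i => (α i).toNat) b)) (Learner.stepBound (I.toInstance n))).le_w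
  refine lt_of_lt_of_le (show 0 < 16 * n by omega) ((h 0).trans ?_)
  exact Finset.single_le_sum (f := (I.learned s α b).w) (fun _ _ => Nat.zero_le _)
    (Finset.mem_range.2 hm)

/-- Set j is selected with probability at most 8·size(n)·frac/W plus 2^(-m). The main terms cost at
most 8·size(n)·β. The error occurs only for sets of cost at most β and contributes at most m β / 2^m
≤ β. -/
theorem sum_cost_select_le {l : Learner} (hW : 0 < l.total (I.toInstance n)) :
    ∑ j : Fin I.numSets, (I.intCost j : ℝ) *
      (𝔼 x : Fin I.numSets → Bool, if Selects I n l x j then (1 : ℝ) else 0) ≤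
      (8 * n.size + 1) * l.beta := by
  set J := I.toInstance n with hJ
  have hW' : (0 : ℝ) < l.total J := by exact_mod_cast hW
  have h1 : ∀ j : Fin I.numSets, (I.intCost j : ℝ) *
      (𝔼 x : Fin I.numSets → Bool, if Selects I n l x j then (1 : ℝ) else 0) ≤
      8 * n.size / l.total J * (l.beta * l.w j) + l.beta / 2 ^ I.numSets := by
    intro j
    have h2 := expect_select_le (m := I.numSets) (a := 8 * n.size) (y := l.frac J j) hW
    have h3 : (I.intCost j * l.frac J j : ℝ) ≤ l.beta * l.w j := by
      exact_mod_cast Learner.frac_mul_le (I := J) (s := l) j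
    refine (mul_le_mul_of_nonneg_left h2 (Nat.cast_nonneg _)).trans ?_
    rw [mul_add]
    refine add_le_add ?_ ?_
    · push_cast
      rw [show (I.intCost j : ℝ) * (8 * n.size * l.frac J j / l.total J) =
        8 * n.size / l.total J * (I.intCost j * l.frac J j) by ring]
      exact mul_le_mul_of_nonneg_left h3 (by positivity)
    · split
      · simp; positivity
      · next hy =>
        have h4 : (I.intCost j : ℝ) ≤ l.beta := by
          exact_mod_cast (Learner.le_of_frac_ne_zero hy).2
        rw [mul_one_div]
        gcongr
  refine (Finset.sum_le_sum fun j _ => h1 j).trans ?_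
  rw [Finset.sum_add_distrib, ← Finset.mul_sum, ← Finset.mul_sum]
  have h5 : ∑ j : Fin I.numSets, (l.w j : ℝ) = l.total J := by
    rw [Learner.total, Nat.cast_sum, ← Fin.sum_univ_eq_sum_range (fun j => (l.w j : ℝ))]
    rfl
  rw [h5]
  have h6 : (8 * n.size / l.total J * (l.beta * l.total J) : ℝ) = 8 * n.size * l.beta := by
    field_simp
  have h7 : ∑ _j : Fin I.numSets, (l.beta / 2 ^ I.numSets : ℝ) ≤ l.beta := by
    simp only [Finset.sum_const, Finset.card_univ, Fintype.card_fin, nsmul_eq_mul]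
    rw [← mul_div_assoc, div_le_iff₀ (by positivity), mul_comm]
    gcongr
    exact_mod_cast Nat.lt_two_pow_self.le
  rw [h6]
  linarith

/-- Different sets use independent digits, so the failure probabilities multiply to
exp(−8·size(n)·coverage/W). Coverage at least W/8 makes this at most exp(−size n) ≤ 1/n. -/
theorem expect_uncovered_le (hn : 0 < n) {l : Learner} (hW : 0 < l.total (I.toInstance n)) {u : ℕ}
    (hu : l.total (I.toInstance n) ≤ 8 * l.coverage (I.toInstance n) u) :
    (𝔼 ρ : Fin I.numSets → Fin I.numSets → Bool, ∏ j : Fin I.numSets,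
      if I.incidence j u = 1 ∧ Selects I n l (ρ j) j then (0 : ℝ) else 1) ≤ 1 / n := by
  set J := I.toInstance n with hJ
  have hW' : (0 : ℝ) < l.total J := by exact_mod_cast hW
  rw [expect_pi_prod (fun (j : Fin I.numSets) (x : Fin I.numSets → Bool) =>
    if I.incidence j u = 1 ∧ Selects I n l x j then (0 : ℝ) else 1)]
  have h1 : ∀ j : Fin I.numSets, (𝔼 x : Fin I.numSets → Bool,
      if I.incidence j u = 1 ∧ Selects I n l x j then (0 : ℝ) else 1) ≤
      Real.exp (-(8 * n.size / l.total J * (I.incidence j u * l.frac J j : ℕ))) := by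
    intro j
    by_cases h : I.incidence j u = 1
    · simp only [h, true_and, one_mul]
      refine (expect_not_select_le (m := I.numSets) (a := 8 * n.size) (y := l.frac J j) hW).trans
        (le_of_eq ?_)
      push_cast
      congr 2; ring
    · have h0 : I.incidence j u = 0 := by
        have := (toInstance_valid (I := I) n).mem_le j u
        change I.incidence j u ≤ 1 at this
        omega
      simp [h0]
  refine (Finset.prod_le_prod (fun j _ => Finset.expect_nonneg fun x _ => by
    split <;> norm_num) fun j _ => h1 j).trans ?_
  rw [← Real.exp_sum, Finset.sum_neg_distrib, ← Finset.mul_sum, ← Nat.cast_sum,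
    Fin.sum_univ_eq_sum_range (fun j => I.incidence j u * l.frac J j)]
  change Real.exp (-(8 * n.size / l.total J * (l.coverage J u : ℝ))) ≤ _
  have h2 : (n.size : ℝ) ≤ 8 * n.size / l.total J * (l.coverage J u : ℝ) := by
    have h3 : (l.total J : ℝ) ≤ 8 * l.coverage J u := by exact_mod_cast hu
    rw [show (8 * n.size / l.total J * (l.coverage J u : ℝ) : ℝ) =
      n.size * (8 * l.coverage J u) / l.total J by ring, le_div_iff₀ hW']
    gcongr
  refine (Real.exp_le_exp.2 (neg_le_neg h2)).trans ?_
  rw [Real.exp_neg, ← one_div]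
  have h4 : Real.log n ≤ n.size := Learner.log_le_size n
  have h5 : (0 : ℝ) < n := by exact_mod_cast hn
  have h6 : (n : ℝ) ≤ Real.exp n.size := by rwa [← Real.log_le_iff_le_exp h5]
  exact one_div_le_one_div_of_le h5 h6

/-- The cost of a choice function: every set is either bought in advance, or the cheapest one for
some uncovered request. -/
theorem cost_image_le {R : ℕ → ℕ} (hR : ∀ j, R j ≤ 1) {S : Fin I.numElts → Fin I.numSets}
    (hS : ∀ u : Fin I.numElts, IsChoice (I.toInstance n) R u (S u)) (v : Fin n → Fin I.numElts) :
    ∑ j ∈ Finset.univ.image (fun i => S (v i)), I.intCost j ≤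
      ∑ j : Fin I.numSets, I.intCost j * R j +
      ∑ i, (I.toInstance n).price (v i) *
        ∏ j : Fin I.numSets, if I.incidence j (v i) = 1 ∧ R j = 1 then 0 else 1 := by
  set h : Fin I.numSets → ℕ := fun j => I.intCost j * (1 - R j) with hh
  have h1 : ∀ j, I.intCost j = I.intCost j * R j + I.intCost j * (1 - R j) := fun j => by
    have := hR j
    rw [← mul_add, show R j + (1 - R j) = 1 by omega, mul_one]
  rw [Finset.sum_congr rfl fun (j : Fin I.numSets) _ => h1 j, Finset.sum_add_distrib]
  refine add_le_add (Finset.sum_le_sum_of_subset (Finset.subset_univ _)) ?_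
  have h2 : ∑ j ∈ Finset.univ.image (fun i => S (v i)), h j ≤ ∑ i, h (S (v i)) := by
    classical
    have : ∀ A : Finset (Fin n), ∑ j ∈ A.image (fun i => S (v i)), h j ≤ ∑ i ∈ A, h (S (v i)) := by
      intro A
      induction A using Finset.induction_on with
      | empty => simp
      | insert i A hi ih =>
        rw [Finset.image_insert, Finset.sum_insert hi]
        by_cases hm : S (v i) ∈ A.image (fun i => S (v i))
        · rw [Finset.insert_eq_of_mem hm]; omega
        · rw [Finset.sum_insert hm]; omega
    exact this _
  refine h2.trans (Finset.sum_le_sum fun i _ => ?_)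
  obtain ⟨hk, hku, hmin⟩ := hS (v i)
  obtain ⟨j, hj, hju, hp⟩ := exists_price (I := I) n (v i).2
  -- If a bought set contains the request, the choice has remaining cost 0. Otherwise the product is
  -- 1 and the remaining cost is at most the price.
  by_cases hc : ∃ j : Fin I.numSets, I.incidence j (v i) = 1 ∧ R j = 1
  · obtain ⟨j', hj', hR'⟩ := hc
    have h3 := hmin j' j'.2 hj'
    rw [hR'] at h3
    simp only [hh]
    change I.intCost (S (v i)) * (1 - R (S (v i))) ≤ _ at h3
    omega
  · rw [Finset.prod_eq_one fun j' _ => if_neg fun h => hc ⟨j', h⟩, mul_one, hp]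
    refine (hmin j hj hju).trans ?_
    exact (Nat.mul_le_mul_left _ (show 1 - R j ≤ 1 by omega)).trans (mul_one _).le

/-- The sets selected in the two rounds. -/
noncomputable def selected (I : SetSystem) (n : ℕ) (l₀ l₁ : Learner)
    (ρ : Fin I.numSets → Fin I.numSets → Bool) (j : ℕ) : ℕ :=
  if h : j < I.numSets then
    if Selects I n l₁ (ρ ⟨j, h⟩) j ∨ Selects I n l₀ (ρ ⟨j, h⟩) j then 1 else 0
  else 0

/-- Both solutions are bought, so a request may be judged by either learner. Exactly one of the two
runs leaves the sample of that request unused, and only its loss is charged. -/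
theorem expect_cost_selected_le (hn : 0 < n) (hm : 0 < I.numSets) (s v : Fin n → Fin I.numElts)
    (α : Fin n → Bool) :
    (𝔼 ρ : Fin I.numSets → Fin I.numSets → Bool,
      ((∑ j : Fin I.numSets, I.intCost j * I.selected n (I.learned s α 0) (I.learned s α 1) ρ j +
        ∑ i, (I.toInstance n).price (v i) * ∏ j : Fin I.numSets,
          if I.incidence j (v i) = 1 ∧ I.selected n (I.learned s α 0) (I.learned s α 1) ρ j = 1
          then 0 else 1 : ℕ) : ℝ)) ≤
      (8 * n.size + 2) * ((I.learned s α 0).beta + (I.learned s α 1).beta) +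
      ((∑ i, if Uses α 0 i then 0 else ((I.learned s α 0).loss (I.toInstance n) (v i) : ℝ)) +
      ∑ i, if Uses α 1 i then 0 else ((I.learned s α 1).loss (I.toInstance n) (v i) : ℝ)) +
      I.commonDen * I.opt v := by
  set l : ℕ → Learner := fun b => I.learned s α b with hl
  set J := I.toInstance n with hJ
  have hW : ∀ b, 0 < (l b).total J := fun b => total_learned_pos hn hm s α b
  have hn' : (0 : ℝ) < n := by exact_mod_cast hn
  push_cast
  rw [Finset.expect_add_distrib]
  have hcost : (𝔼 ρ : Fin I.numSets → Fin I.numSets → Bool,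
      ∑ j : Fin I.numSets, (I.intCost j : ℝ) * (I.selected n (l 0) (l 1) ρ j : ℝ)) ≤
      (8 * n.size + 1) * ((l 0).beta + (l 1).beta) := by
    have h1 : ∀ ρ : Fin I.numSets → Fin I.numSets → Bool,
        ∑ j : Fin I.numSets, (I.intCost j : ℝ) * (I.selected n (l 0) (l 1) ρ j : ℝ) ≤
        ∑ j : Fin I.numSets, ((I.intCost j : ℝ) * (if Selects I n (l 0) (ρ j) j then 1 else 0) +
          (I.intCost j : ℝ) * (if Selects I n (l 1) (ρ j) j then 1 else 0)) := by
      intro ρ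
      refine Finset.sum_le_sum fun j _ => ?_
      rw [← mul_add]
      refine mul_le_mul_of_nonneg_left ?_ (Nat.cast_nonneg _)
      simp only [selected, j.2, dif_pos]
      by_cases h0 : Selects I n (l 0) (ρ j) j <;> by_cases h1 : Selects I n (l 1) (ρ j) j <;>
        simp [h0, h1]
    refine (Finset.expect_le_expect fun ρ _ => h1 ρ).trans ?_
    rw [Finset.expect_sum_comm]
    simp only [Finset.expect_add_distrib, ← Finset.mul_expect]
    have h2 : ∀ b (j : Fin I.numSets), (𝔼 ρ : Fin I.numSets → Fin I.numSets → Bool,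
        if Selects I n (l b) (ρ j) j then (1 : ℝ) else 0) =
        𝔼 x : Fin I.numSets → Bool, if Selects I n (l b) x j then (1 : ℝ) else 0 := fun b j =>
      expect_pi_apply j fun x => if Selects I n (l b) x j then (1 : ℝ) else 0
    simp only [h2, Finset.sum_add_distrib]
    have h3 := sum_cost_select_le (hW 0)
    have h4 := sum_cost_select_le (hW 1)
    linarith
  have hprice : ∀ i b, (b = 0 ∨ b = 1) →
      (𝔼 ρ : Fin I.numSets → Fin I.numSets → Bool, (J.price (v i) : ℝ) * ∏ j : Fin I.numSets,
        ((if I.incidence j (v i) = 1 ∧ I.selected n (l 0) (l 1) ρ j = 1 then 0 else 1 : ℕ) : ℝ)) ≤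
      (l b).beta / n + (l b).loss J (v i) + I.commonDen * I.opt v / n := by
    intro i b hb
    have hp := price_le_opt v i
    have hp0 : (0 : ℝ) ≤ J.price (v i) := Nat.cast_nonneg _
    have hbeta : (0 : ℝ) ≤ (l b).beta / n := by positivity
    have hloss : (0 : ℝ) ≤ (l b).loss J (v i) := Nat.cast_nonneg _
    have hopt : (0 : ℝ) ≤ I.commonDen * I.opt v / n := div_nonneg (hp0.trans hp) hn'.le
    rw [← Finset.mul_expect]
    set q := 𝔼 ρ : Fin I.numSets → Fin I.numSets → Bool, ∏ j : Fin I.numSets,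
        ((if I.incidence j (v i) = 1 ∧ I.selected n (l 0) (l 1) ρ j = 1 then 0 else 1 : ℕ) : ℝ)
      with hq
    have hq1 : q ≤ 1 := Finset.expect_le Finset.univ_nonempty fun ρ _ =>
      Finset.prod_le_one (fun j _ => Nat.cast_nonneg _) fun j _ => by split <;> norm_num
    have hqp : J.price (v i) * q ≤ J.price (v i) := mul_le_of_le_one_right hp0 hq1
    -- Three cases: a mistake is paid by the loss, a price of at most β/n by the guess, and a well
    -- covered request by its failure probability 1/n times OPT(v).
    by_cases hmis : (l b).Mistake J (v i)
    · have : (l b).loss J (v i) = J.price (v i) := if_pos hmis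
      rw [this]; linarith
    by_cases hch : J.price (v i) * n ≤ (l b).beta
    · have : (J.price (v i) : ℝ) ≤ (l b).beta / n := by
        rw [le_div_iff₀ hn']; exact_mod_cast hch
      linarith
    have hcov : (l b).total J ≤ 8 * (l b).coverage J (v i) := by
      by_contra h
      exact hmis ⟨not_le.1 hch, not_le.1 h⟩
    have h1 := expect_uncovered_le hn (hW b) hcov
    have h2 : q ≤ 1 / n := by
      refine le_trans (Finset.expect_le_expect fun ρ _ => Finset.prod_le_prod
        (fun j _ => Nat.cast_nonneg _) fun j _ => ?_) h1
      by_cases hinc : I.incidence j (v i) = 1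
      · by_cases hsel : Selects I n (l b) (ρ j) j
        · have : I.selected n (l 0) (l 1) ρ j = 1 := by
            simp only [selected, j.2, dif_pos]
            rw [if_pos]
            rcases hb with rfl | rfl
            · exact Or.inr hsel
            · exact Or.inl hsel
          simp [hinc, this, hsel]
        · simp only [hsel, and_false, if_false]
          split <;> norm_num
      · simp [hinc]
    have h3 : J.price (v i) * q ≤ I.commonDen * I.opt v * (1 / n) :=
      mul_le_mul hp h2 (Finset.expect_nonneg fun ρ _ =>
        Finset.prod_nonneg fun j _ => Nat.cast_nonneg _) (hp0.trans hp)
    rw [mul_one_div] at h3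
    linarith
  have hsum : (𝔼 ρ : Fin I.numSets → Fin I.numSets → Bool, ∑ i, (J.price (v i) : ℝ) *
      ∏ j : Fin I.numSets,
        ((if I.incidence j (v i) = 1 ∧ I.selected n (l 0) (l 1) ρ j = 1 then 0 else 1 : ℕ) : ℝ)) ≤
      ((l 0).beta + (l 1).beta) +
      ((∑ i, if Uses α 0 i then 0 else ((l 0).loss J (v i) : ℝ)) +
      ∑ i, if Uses α 1 i then 0 else ((l 1).loss J (v i) : ℝ)) + I.commonDen * I.opt v := by
    rw [Finset.expect_sum_comm]
    have h1 : ∀ i : Fin n, (𝔼 ρ : Fin I.numSets → Fin I.numSets → Bool, (J.price (v i) : ℝ) *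
        ∏ j : Fin I.numSets,
        ((if I.incidence j (v i) = 1 ∧ I.selected n (l 0) (l 1) ρ j = 1 then 0 else 1 : ℕ) : ℝ)) ≤
        ((l 0).beta + (l 1).beta) / n + ((if Uses α 0 i then 0 else ((l 0).loss J (v i) : ℝ)) +
          if Uses α 1 i then 0 else ((l 1).loss J (v i) : ℝ)) + I.commonDen * I.opt v / n := by
      intro i
      have hb0 : (0 : ℝ) ≤ (l 0).beta / n := by positivity
      have hb1 : (0 : ℝ) ≤ (l 1).beta / n := by positivity
      rw [add_div]
      by_cases hu : Uses α 0 i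
      · have hu1 : ¬ Uses α 1 i := by unfold Uses at hu ⊢; omega
        have := hprice i 1 (Or.inr rfl)
        rw [if_pos hu, if_neg hu1]
        linarith
      · have hu1 : Uses α 1 i := by unfold Uses at hu ⊢; omega
        have := hprice i 0 (Or.inl rfl)
        rw [if_neg hu, if_pos hu1]
        linarith
    refine (Finset.sum_le_sum fun i _ => h1 i).trans (le_of_eq ?_)
    rw [Finset.sum_add_distrib, Finset.sum_add_distrib, Finset.sum_add_distrib]
    simp only [Finset.sum_const, Finset.card_univ, Fintype.card_fin, nsmul_eq_mul]
    rw [mul_div_cancel₀ _ hn'.ne', mul_div_cancel₀ _ hn'.ne']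
  simp only [← Nat.cast_prod] at hsum ⊢
  push_cast at hsum ⊢
  linarith

/-! ### From coins to the competitive ratio -/

variable {r : ℕ}

/-- The first `n` coins. -/
def sampleCoins (hr : n + I.numSets * I.numSets ≤ r) (ω : Fin r → Bool) (i : Fin n) : Bool :=
  ω ⟨i, by omega⟩

/-- The coins which are used for buying the set `j`. -/
def setCoins (hr : n + I.numSets * I.numSets ≤ r) (ω : Fin r → Bool) (j k : Fin I.numSets) :
    Bool :=
  ω ⟨n + finProdFinEquiv (j, k), by omega⟩

/-- The first n coins and the m × m block behind them have disjoint positions; any further coins are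
ignored. -/
theorem coinExpect_split (hr : n + I.numSets * I.numSets ≤ r)
    (g : (Fin n → Bool) → (Fin I.numSets → Fin I.numSets → Bool) → ℝ) :
    coinExpect (fun ω : Fin r → Bool => g (sampleCoins hr ω) (setCoins hr ω)) =
      𝔼 α, 𝔼 ρ, g α ρ := by
  let e : Fin n ⊕ (Fin I.numSets × Fin I.numSets) → Fin r :=
    Sum.elim (fun i => ⟨i, by omega⟩) (fun p => ⟨n + finProdFinEquiv p, by omega⟩)
  have he : Function.Injective e := by
    rintro (i | p) (i' | p') h
    · have h1 := congrArg Fin.val h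
      exact congrArg Sum.inl (Fin.ext h1)
    · have h1 : (i : ℕ) = n + finProdFinEquiv p' := congrArg Fin.val h
      omega
    · have h1 : n + finProdFinEquiv p = (i' : ℕ) := congrArg Fin.val h
      omega
    · have h1 : n + (finProdFinEquiv p : ℕ) = n + finProdFinEquiv p' := congrArg Fin.val h
      exact congrArg Sum.inr (finProdFinEquiv.injective (Fin.ext (by omega)))
  rw [coinExpect_eq]
  have h1 := expect_comp he fun γ => g (fun i => γ (Sum.inl i)) (fun j k => γ (Sum.inr (j, k)))
  refine (Eq.trans ?_ h1).trans ?_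
  · rfl
  · rw [← expect_prod_type (fun p : (Fin n → Bool) × (Fin I.numSets → Fin I.numSets → Bool) =>
      g p.1 p.2)]
    exact Fintype.expect_equiv ((Equiv.sumArrowEquivProdArrow _ _ _).trans
      (Equiv.prodCongr (Equiv.refl _) (Equiv.curry _ _ _))) _ _ fun _ => rfl

/-- The program reads digit k of set j at position n + (m j + k), which is the place
`finProdFinEquiv` assigns to (j, k). -/
theorem bought_eq (hr : n + I.numSets * I.numSets ≤ r) (s : Fin n → Fin I.numElts)
    (ω : Fin r → Bool) {j : ℕ} (hj : j < I.numSets) :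
    I.bought s ω j = I.selected n (I.learned s (sampleCoins hr ω) 0)
      (I.learned s (sampleCoins hr ω) 1) (setCoins hr ω) j := by
  have h1 : ∀ b, Learner.final (I.toInstance n) (active (extend fun i => (ω i).toNat) b)
      (extend fun i => s i) = I.learned s (sampleCoins hr ω) b := by
    intro b
    refine Learner.final_congr (fun i hi => ?_) fun _ _ _ => rfl
    change i < n at hi
    simp [active, extend, hi, show i < r by omega, sampleCoins]
  have h2 : binary (fun k => extend (fun i => (ω i).toNat) (n + (I.numSets * j + k))) I.numSets =
      bitsVal (setCoins hr ω ⟨j, hj⟩) := by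
    refine binary_congr fun k hk => ?_
    have h3 : I.numSets * j + k < I.numSets * I.numSets := by nlinarith
    simp [extend, hk, show n + (I.numSets * j + k) < r by omega, setCoins, add_comm k]
  have h3 : ∀ l R, buy (I.toInstance n) (extend fun i => (ω i).toNat) l R j =
      if Selects I n l (setCoins hr ω ⟨j, hj⟩) j then 1 else R j := fun l R =>
    if_congr (by unfold Selects; rw [← h2]; rfl) rfl rfl
  rw [bought, purchases, h1, h1, h3, h3]
  simp only [selected, hj, dif_pos]
  by_cases h4 : Selects I n (I.learned s (sampleCoins hr ω) 1) (setCoins hr ω ⟨j, hj⟩) j <;>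
    by_cases h5 : Selects I n (I.learned s (sampleCoins hr ω) 0) (setCoins hr ω ⟨j, hj⟩) j <;>
    simp [h4, h5]

theorem mul_universalCost_le (hr : n + I.numSets * I.numSets ≤ r) (s v : Fin n → Fin I.numElts)
    (ω : Fin r → Bool) {S : Fin I.numElts → Fin I.numSets}
    (hS : ∀ u : Fin I.numElts, IsChoice (I.toInstance n) (I.bought s ω) u (S u)) :
    I.commonDen * I.universalCost S v ≤
      ((∑ j : Fin I.numSets, I.intCost j * I.selected n (I.learned s (sampleCoins hr ω) 0)
          (I.learned s (sampleCoins hr ω) 1) (setCoins hr ω) j +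
        ∑ i, (I.toInstance n).price (v i) * ∏ j : Fin I.numSets,
          if I.incidence j (v i) = 1 ∧ I.selected n (I.learned s (sampleCoins hr ω) 0)
            (I.learned s (sampleCoins hr ω) 1) (setCoins hr ω) j = 1
          then 0 else 1 : ℕ) : ℝ) := by
  rw [universalCost, commonDen_mul_costOf, Nat.cast_le]
  refine cost_image_le (fun j => ?_) (fun u => ?_) v
  · unfold selected
    split
    · split <;> omega
    · omega
  · obtain ⟨h1, h2, h3⟩ := hS u
    refine ⟨h1, h2, fun j hj hju => ?_⟩
    have h4 := h3 j hj hju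
    rwa [bought_eq hr s ω h1, bought_eq hr s ω hj] at h4

/-- Each guess is at most 2·OPT(s) in scaled units, so the factor 8·size(n) + 2 of their sum gives
32·size(n) + 8. The two losses give 2(16·size(m) + 6), and missed requests give 1. The common
denominator cancels. -/
theorem expect_universalCost_le (hr : n + I.numSets * I.numSets ≤ r) (hn : 0 < n)
    (hm : 0 < I.numSets)
    {S : (Fin n → Fin I.numElts) → (Fin r → Bool) → Fin I.numElts → Fin I.numSets}
    (hS : ∀ s ω (u : Fin I.numElts), IsChoice (I.toInstance n) (I.bought s ω) u (S s ω u))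
    (D : Fin n → PMF (Fin I.numElts)) :
    expect D (fun s => coinExpect fun ω => expect D fun v => I.universalCost (S s ω) v) ≤
      (32 * (n.size + I.numSets.size) + 21) * expect D I.opt := by
  have hD : (0 : ℝ) < I.commonDen := by exact_mod_cast commonDen_pos
  refine le_of_mul_le_mul_left ?_ hD
  set L : ℕ → (Fin n → Fin I.numElts) → (Fin n → Fin I.numElts) → (Fin n → Bool) → ℝ :=
    fun b s v α => ∑ i, if Uses α b i then 0 else
      ((I.learned s α b).loss (I.toInstance n) (v i) : ℝ) with hL
  have h1 : ∀ s v, (𝔼 ω : Fin r → Bool, I.commonDen * I.universalCost (S s ω) v) ≤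
      (32 * n.size + 8) * (I.commonDen * I.opt s) + ((𝔼 α, L 0 s v α) + 𝔼 α, L 1 s v α) +
        I.commonDen * I.opt v := by
    intro s v
    refine (Finset.expect_le_expect fun ω _ => mul_universalCost_le hr s v ω (hS s ω)).trans ?_
    rw [← coinExpect_eq]
    refine (coinExpect_split hr fun α ρ =>
      ((∑ j : Fin I.numSets, I.intCost j * I.selected n (I.learned s α 0) (I.learned s α 1) ρ j +
        ∑ i, (I.toInstance n).price (v i) * ∏ j : Fin I.numSets,
          if I.incidence j (v i) = 1 ∧ I.selected n (I.learned s α 0) (I.learned s α 1) ρ j = 1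
          then 0 else 1 : ℕ) : ℝ)).le.trans ?_
    refine (Finset.expect_le_expect fun α _ => (expect_cost_selected_le hn hm s v α).trans
      (show _ ≤ (32 * n.size + 8) * (I.commonDen * I.opt s) + (L 0 s v α + L 1 s v α) +
        I.commonDen * I.opt v from ?_)).trans (le_of_eq ?_)
    · have h2 := beta_learned_le s α 0
      have h3 := beta_learned_le s α 1
      have h4 : (8 * n.size + 2 : ℝ) * ((I.learned s α 0).beta + (I.learned s α 1).beta) ≤
          (8 * n.size + 2) * (4 * (I.commonDen * I.opt s)) :=
        mul_le_mul_of_nonneg_left (by linarith) (by positivity)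
      simp only [hL]
      linarith
    · rw [Finset.expect_add_distrib, Finset.expect_add_distrib, Finset.expect_add_distrib,
        Fintype.expect_const, Fintype.expect_const]
  have h2 : I.commonDen * expect D (fun s => coinExpect fun ω => expect D fun v =>
      I.universalCost (S s ω) v) =
      expect D (fun s => expect D fun v =>
        𝔼 ω : Fin r → Bool, I.commonDen * I.universalCost (S s ω) v) := by
    rw [← expect_mul_left]
    congr 1
    funext s
    rw [coinExpect_eq, expect_expect, Finset.mul_expect]
    simp only [expect_mul_left]
  rw [h2]
  refine (expect_mono D fun s => expect_mono D fun v => h1 s v).trans ?_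
  simp only [expect_add, expect_const, expect_mul_left]
  have h3 := expect_loss_le D (I := I) 0
  have h4 := expect_loss_le D (I := I) 1
  linarith

/-- A bit length is at most 1 + log₂ k, so the left side is at most 32 log₂(mn) + 85. As log₂(mn) ≥
1, this is at most 117 log₂(mn), and 117 / log 2 < 200. -/
theorem size_add_size_le {m n : ℕ} (h : 2 ≤ m * n) :
    (32 * (n.size + m.size) + 21 : ℝ) ≤ 200 * Real.log (m * n) := by
  have hm : 0 < m := Nat.pos_of_ne_zero (by rintro rfl; simp at h)
  have hn : 0 < n := Nat.pos_of_ne_zero (by rintro rfl; simp at h)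
  have key : ∀ k : ℕ, 0 < k → ((k.size : ℝ) - 1) * Real.log 2 ≤ Real.log k := by
    intro k hk
    have h1 : 0 < k.size := Nat.size_pos.2 hk
    have h2 : 2 ^ (k.size - 1) ≤ k := Nat.lt_size.1 (by omega)
    have h3 : (2 : ℝ) ^ (k.size - 1) ≤ k := by exact_mod_cast h2
    have h4 := Real.log_le_log (by positivity) h3
    rw [Real.log_pow, Nat.cast_sub h1] at h4
    simpa using h4
  have h1 := key m hm
  have h2 := key n hn
  have h3 : Real.log (m * n) = Real.log m + Real.log n :=
    Real.log_mul (by positivity) (by positivity)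
  have h4 : Real.log 2 ≤ Real.log (m * n) :=
    Real.log_le_log (by norm_num) (by exact_mod_cast h)
  have h5 := Real.log_two_gt_d9
  have h6 : (0 : ℝ) ≤ m.size + n.size := by positivity
  nlinarith

end SetSystem

end ProphetSetCover

theorem mainTheorem1 :
    ∃ (P : ProphetSetCover.Prog) (timeBound numCoins : Polynomial ℕ) (C : ℝ),
      ∀ (I : ProphetSetCover.SetSystem) (n : ℕ),
        ∃ S : (Fin n → Fin I.numElts) → (Fin (numCoins.eval (I.size n)) → Bool) →
            Fin I.numElts → Fin I.numSets,
          (∀ s ω, I.Outputs P s ω (timeBound.eval (I.size n)) (S s ω)) ∧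
          (∀ s ω u, u ∈ I.sets (S s ω u)) ∧
          (2 ≤ I.numSets * n → ∀ D : Fin n → PMF (Fin I.numElts),
            I.IsCompetitive S D (C * Real.log (I.numSets * n))) := by
  refine ⟨ProphetSetCover.Prog.main, ProphetSetCover.SetSystem.timePoly,
    ProphetSetCover.SetSystem.coinPoly, 200, fun I n => ?_⟩
  have hr := ProphetSetCover.SetSystem.le_coinPoly (I := I) n
  choose S hS hchoice using fun s ω => ProphetSetCover.SetSystem.exists_outputs hr s ω
  refine ⟨S, hS, fun s ω u => ProphetSetCover.SetSystem.incidence_eq_one.1 (hchoice s ω u).2.1,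
    fun h D => ?_⟩
  have hm : 0 < I.numSets := Nat.pos_of_ne_zero fun h0 => by simp [h0] at h
  have hn : 0 < n := Nat.pos_of_ne_zero fun h0 => by simp [h0] at h
  refine (ProphetSetCover.SetSystem.expect_universalCost_le hr hn hm hchoice D).trans
    (mul_le_mul_of_nonneg_right (ProphetSetCover.SetSystem.size_add_size_le h) ?_)
  refine Finset.sum_nonneg fun v _ => mul_nonneg (ProphetSetCover.weight_nonneg D v) ?_
  obtain ⟨T, -, hT⟩ := ProphetSetCover.SetSystem.exists_opt v
  rw [← hT]
  exact Finset.sum_nonneg fun j _ => by positivity
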